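/- **Setting.** An $n$-punctured ball tangle diagram ($n\ge 0$) is a generic planar diagram, with over/under crossings, of a proper 1-manifold (arcs and closed curves) in a ball $H_0$ with $n$ disjoint balls $H_1,\dots,H_n$ removed from its interior (the holes, numbered); here the diagram has exactly four ends, at the positions NE, NW, SW, SE, on each of the $n+1$ boundary circles. Diagrams are considered up to isotopy, i.e. up to the equivalence relation generated by planar equivalence of diagrams and the tangle Reidemeister moves: the moves of types I, II, III and the move of type IV, which replaces an arc passing beside a hole without crossings by an arc passing around the other side of the hole, either over all four or under all four of the strands leaving the hole. A $0$-punctured ball tangle diagram is called a ball tangle diagram; let $\mathbf{BT}$ be the class of these. If $T^n$ is an $n$-punctured ball tangle diagram and $B^{(1)},\dots,B^{(n)}\in\mathbf{BT}$, then $T^n(B^{(1)},\dots,B^{(n)})\in\mathbf{BT}$ is obtained by putting $B^{(j)}$ in the $j$-th hole of $T^n$, ends being matched by position. For a link diagram $L$ and $A=e^{i\pi/4}$ let $$\langle L\rangle=\sum_{\sigma}A^{\alpha(\sigma)-\beta(\sigma)}(-A^2-A^{-2})^{d(\sigma)-1}$$ be its Kauffman bracket, the sum being over all states $\sigma$ (a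 choice of $A$-type or $B$-type splitting at every crossing), where $\alpha(\sigma)$ and $\beta(\sigma)$ are the numbers of $A$- and $B$-splittings and $d(\sigma)$ is the number of circles of the split diagram. The numerator closure of a ball tangle diagram (closure $1$) joins NE to NW and SW to SE outside the ball; the denominator closure (closure $2$) joins NE to SE and NW to SW. The fundamental tangle $1$ consists of the strands NE–SE and NW–SW, the fundamental tangle $2$ of the strands NE–NW and SW–SE. For $k\in\{1,2\}$ and $\alpha\in\{1,2\}^n$ let $T^n_{k\alpha}$ be the link diagram obtained from $T^n$ by filling the $j$-th hole with the fundamental tangle $\alpha_j$ for every $j$ and then taking closure $k$. Let $\alpha^n_1<\dots<\alpha^n_{2^n}$ be the elements of $\{1,2\}^n$ in lexicographic order. Define the sequences $a_n=(t_1,\dots,t_{2^n})$ by $a_0=(0)$ and $a_{n+1}=(t_1,\dots,t_{2^n},t_1+1,\dots,t_{2^n}+1)$ if $a_n=(t_1,\dots,t_{2^n})$. Let $X(T^n)$ be the complex $2\times 2^n$ matrix with entries $$X(T^n)_{1,l}=(-i)^{t_l}\langle T^n_{1\alpha^n_l}\rangle,\qquad X(T^n)_{2,l}=(-i)^{t_l}\,i\,\langle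 T^n_{2\alpha^n_l}\rangle .$$ Let $PM_{a\times b}(\mathbb Z)$ be the set of integer $a\times b$ matrices modulo multiplication by $\pm1$, with the product $[M][N]=[MN]$, and let $[\xi^n]$ send $\left(\begin{bmatrix}v^1_1\\v^1_2\end{bmatrix},\dots,\begin{bmatrix}v^n_1\\v^n_2\end{bmatrix}\right)\in PM_{2\times1}(\mathbb Z)^n$ to the class modulo $\pm1$ of the column vector of length $2^n$ whose $l$-th entry is $\prod_{j=1}^n v^j_{\alpha^n_{l,j}}$, where $\alpha^n_l=(\alpha^n_{l,1},\dots,\alpha^n_{l,n})$ (for $n=0$ this is $[1]$). **Theorem 3.6.** For every $n\ge 0$ and every $n$-punctured ball tangle diagram $T^n$, the set $$F^n(T^n)=\{\,zX(T^n)\;:\;z\in\mathbb C,\ z^8=1\,\}\cap M_{2\times 2^n}(\mathbb Z)$$ has the form $\{M,-M\}$ for an integer matrix $M$, i.e. it is an element of $PM_{2\times 2^n}(\mathbb Z)$. The map $F^n$ is an isotopy invariant: $F^n(T)=F^n(T')$ if $T$ and $T'$ are isotopic $n$-punctured ball tangle diagrams. Moreover $$F^0\bigl(T^n(B^{(1)},\dots,B^{(n)})\bigr)=F^n(T^n)\,[\xi^n]\bigl(F^0(B^{(1)}),\dots,F^0(B^{(n)})\bigr)$$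 for every $n$-punctured ball tangle diagram $T^n$ and all $B^{(1)},\dots,B^{(n)}\in\mathbf{BT}$. -/

import Mathlib

namespace PBT

/-! ### Diagrams

Diagrams of punctured ball tangles are encoded as planar-diagram codes, that is as combinatorial
maps.  A diagram is a graph drawn in a disc with holes.  Its vertices are the outer boundary
circle, the boundary circles of the holes, the crossings (4-valent) and auxiliary 2-valent points
lying on the strands (a circle without crossings carries at least one such point).  A dart is a
half-edge at a vertex. -/

/-- Half-edges.  The `2 * m₀` ends on the outer circle and the `2 * m h` ends on the boundary of the
hole `h` are numbered counterclockwise as seen in the plane.  The four half-edges at a crossing are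
numbered counterclockwise, `0` and `2` belonging to the under-strand, `1` and `3` to the
over-strand. -/
inductive Dart (m₀ : ℕ) {H : Type} (m : H → ℕ) (X P : Type) : Type
  | outer (i : Fin (2 * m₀)) : Dart m₀ m X P
  | hole (h : H) (i : Fin (2 * m h)) : Dart m₀ m X P
  | cross (x : X) (i : Fin 4) : Dart m₀ m X P
  | pt (p : P) (i : Fin 2) : Dart m₀ m X P

/-- The next half-edge counterclockwise around the same vertex of the sphere.  The outer circle is
seen from its outside, whence the inverse rotation there. -/
def Dart.rot {m₀ : ℕ} {H : Type} {m : H → ℕ} {X P : Type} : Dart m₀ m X P → Dart m₀ m X P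
  | .outer i => .outer ((finRotate _).symm i)
  | .hole h i => .hole h (finRotate _ i)
  | .cross x i => .cross x (finRotate _ i)
  | .pt p i => .pt p (finRotate _ i)

/-- A (not yet planar) diagram with holes indexed by `H`, with `2 * m₀` ends on the outer circle and
`2 * m h` ends on the hole `h`. `X` is the set of crossings, `P` the set of auxiliary points, and
`opp` sends each half-edge to the other half of its edge. -/
structure Diagram (m₀ : ℕ) {H : Type} (m : H → ℕ) where
  finite_holes : Finite H
  X : Type
  P : Type
  finite_X : Finite X
  finite_P : Finite P
  opp : Dart m₀ m X P → Dart m₀ m X P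
  opp_opp : ∀ d, opp (opp d) = d
  opp_ne : ∀ d, opp d ≠ d

namespace Diagram

/-- The half-edges of a diagram. -/
abbrev Darts {m₀ : ℕ} {H : Type} {m : H → ℕ} (D : Diagram m₀ m) : Type :=
  Dart m₀ m D.X D.P

/-- The number of vertices: the orbits of the rotation. -/
noncomputable def numVertices {m₀ : ℕ} {H : Type} {m : H → ℕ} (D : Diagram m₀ m) : ℕ :=
  Nat.card (Quot fun a b : D.Darts => b = a.rot)

/-- The number of edges: the orbits of `opp`. -/
noncomputable def numEdges {m₀ : ℕ} {H : Type} {m : H → ℕ} (D : Diagram m₀ m) : ℕ :=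
  Nat.card (Quot fun a b : D.Darts => b = D.opp a)

/-- The number of faces: the orbits of rotation after `opp`. -/
noncomputable def numFaces {m₀ : ℕ} {H : Type} {m : H → ℕ} (D : Diagram m₀ m) : ℕ :=
  Nat.card (Quot fun a b : D.Darts => b = (D.opp a).rot)

/-- The number of connected components. -/
noncomputable def numComponents {m₀ : ℕ} {H : Type} {m : H → ℕ} (D : Diagram m₀ m) : ℕ :=
  Nat.card (Quot fun a b : D.Darts => b = a.rot ∨ b = D.opp a)

/-- Planarity: `V - E + F = 2 C`, that is, every connected component is a map on the sphere. -/
def Planar {m₀ : ℕ} {H : Type} {m : H → ℕ} (D : Diagram m₀ m) : Prop :=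
  D.numVertices + D.numFaces = D.numEdges + 2 * D.numComponents

/-! ### Operadic composition -/

section comp

variable {m₀ : ℕ} {H : Type} {m : H → ℕ} {K : H → Type} {μ : (h : H) → K h → ℕ}

/-- The crossings of a composite. -/
abbrev CompX (C : Diagram m₀ m) (S : (h : H) → Diagram (m h) (μ h)) : Type :=
  C.X ⊕ (Σ h, (S h).X)

/-- The auxiliary points of a composite: the old ones, and the points where the strands of the
inserted diagrams are attached. -/
abbrev CompP (C : Diagram m₀ m) (S : (h : H) → Diagram (m h) (μ h)) : Type :=
  (C.P ⊕ (Σ h, (S h).P)) ⊕ (Σ h, Fin (2 * m h))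

/-- The half-edges of a composite. -/
abbrev CompDart (C : Diagram m₀ m) (S : (h : H) → Diagram (m h) (μ h)) : Type :=
  Dart m₀ (fun q : (Σ h, K h) => μ q.1 q.2) (CompX C S) (CompP C S)

/-- Half-edges of the outer diagram, seen in the composite. -/
def compOut (C : Diagram m₀ m) (S : (h : H) → Diagram (m h) (μ h)) : C.Darts → CompDart C S
  | .outer i => .outer i
  | .hole h i => .pt (.inr ⟨h, i⟩) 0
  | .cross x i => .cross (.inl x) i
  | .pt p i => .pt (.inl (.inl p)) i

/-- Half-edges of the diagram inserted in the hole `h`, seen in the composite: its outer end `i` is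
attached to the end `i` of the hole `h`. -/
def compIn (C : Diagram m₀ m) (S : (h : H) → Diagram (m h) (μ h)) (h : H) :
    (S h).Darts → CompDart C S
  | .outer i => .pt (.inr ⟨h, i⟩) 1
  | .hole k i => .hole ⟨h, k⟩ i
  | .cross x i => .cross (.inr ⟨h, x⟩) i
  | .pt p i => .pt (.inl (.inr ⟨h, p⟩)) i

/-- The edges of a composite are those of the outer diagram and of the inserted diagrams. -/
def compOpp (C : Diagram m₀ m) (S : (h : H) → Diagram (m h) (μ h)) : CompDart C S → CompDart C S
  | .outer i => compOut C S (C.opp (.outer i))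
  | .hole ⟨h, k⟩ i => compIn C S h ((S h).opp (.hole k i))
  | .cross (.inl x) i => compOut C S (C.opp (.cross x i))
  | .cross (.inr ⟨h, x⟩) i => compIn C S h ((S h).opp (.cross x i))
  | .pt (.inl (.inl p)) i => compOut C S (C.opp (.pt p i))
  | .pt (.inl (.inr ⟨h, p⟩)) i => compIn C S h ((S h).opp (.pt p i))
  | .pt (.inr ⟨h, i⟩) 0 => compOut C S (C.opp (.hole h i))
  | .pt (.inr ⟨h, i⟩) 1 => compIn C S h ((S h).opp (.outer i))

theorem compOpp_out (C : Diagram m₀ m) (S : (h : H) → Diagram (m h) (μ h)) (d : C.Darts) :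
    compOpp C S (compOut C S d) = compOut C S (C.opp d) := by
  cases d <;> rfl

theorem compOpp_in (C : Diagram m₀ m) (S : (h : H) → Diagram (m h) (μ h)) (h : H)
    (d : (S h).Darts) : compOpp C S (compIn C S h d) = compIn C S h ((S h).opp d) := by
  cases d <;> rfl

theorem compOut_injective (C : Diagram m₀ m) (S : (h : H) → Diagram (m h) (μ h)) :
    Function.Injective (compOut C S) := by
  intro a b hab
  cases a <;> cases b <;> simp [compOut] at hab ⊢ <;> aesop

theorem compIn_injective (C : Diagram m₀ m) (S : (h : H) → Diagram (m h) (μ h)) (h : H) :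
    Function.Injective (compIn C S h) := by
  intro a b hab
  cases a <;> cases b <;> simp [compIn] at hab ⊢ <;> aesop

theorem comp_cases (C : Diagram m₀ m) (S : (h : H) → Diagram (m h) (μ h)) (d : CompDart C S) :
    (∃ a, d = compOut C S a) ∨ ∃ h a, d = compIn C S h a := by
  match d with
  | .outer i => exact .inl ⟨.outer i, rfl⟩
  | .hole ⟨h, k⟩ i => exact .inr ⟨h, .hole k i, rfl⟩
  | .cross (.inl x) i => exact .inl ⟨.cross x i, rfl⟩
  | .cross (.inr ⟨h, x⟩) i => exact .inr ⟨h, .cross x i, rfl⟩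
  | .pt (.inl (.inl p)) i => exact .inl ⟨.pt p i, rfl⟩
  | .pt (.inl (.inr ⟨h, p⟩)) i => exact .inr ⟨h, .pt p i, rfl⟩
  | .pt (.inr ⟨h, i⟩) 0 => exact .inl ⟨.hole h i, rfl⟩
  | .pt (.inr ⟨h, i⟩) 1 => exact .inr ⟨h, .outer i, rfl⟩

/-- Operadic composition: for every hole `h` of `C`, the diagram `S h` is put in the hole `h`. -/
def comp (C : Diagram m₀ m) (S : (h : H) → Diagram (m h) (μ h)) :
    Diagram m₀ (fun q : (Σ h, K h) => μ q.1 q.2) where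
  finite_holes := by
    have := C.finite_holes
    have := fun h => (S h).finite_holes
    infer_instance
  X := CompX C S
  P := CompP C S
  finite_X := by
    have := C.finite_holes
    have := C.finite_X
    have := fun h => (S h).finite_X
    infer_instance
  finite_P := by
    have := C.finite_holes
    have := C.finite_P
    have := fun h => (S h).finite_P
    infer_instance
  opp := compOpp C S
  opp_opp := by
    intro d
    rcases comp_cases C S d with ⟨a, rfl⟩ | ⟨h, a, rfl⟩
    · rw [compOpp_out, compOpp_out, C.opp_opp]
    · rw [compOpp_in, compOpp_in, (S h).opp_opp]
  opp_ne := by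
    intro d
    rcases comp_cases C S d with ⟨a, rfl⟩ | ⟨h, a, rfl⟩
    · rw [compOpp_out]
      exact fun e => C.opp_ne a (compOut_injective C S e)
    · rw [compOpp_in]
      exact fun e => (S h).opp_ne a (compIn_injective C S h e)

end comp

section relabel

variable {m₀ : ℕ} {H H' : Type} {m : H → ℕ}

/-- Renaming holes, on half-edges. -/
def relabelTo (e : H' ≃ H) {X P : Type} : Dart m₀ (fun h => m (e h)) X P → Dart m₀ m X P
  | .outer i => .outer i
  | .hole h i => .hole (e h) i
  | .cross x i => .cross x i
  | .pt p i => .pt p i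

/-- The inverse of `relabelTo`. -/
def relabelFrom (e : H' ≃ H) {X P : Type} : Dart m₀ m X P → Dart m₀ (fun h => m (e h)) X P
  | .outer i => .outer i
  | .hole h i => .hole (e.symm h) (Fin.cast (by rw [e.apply_symm_apply]) i)
  | .cross x i => .cross x i
  | .pt p i => .pt p i

theorem hole_cast {X P : Type} {a b : H} (hab : a = b) (i : Fin (2 * m b))
    (h : 2 * m b = 2 * m a) :
    (Dart.hole a (Fin.cast h i) : Dart m₀ m X P) = Dart.hole b i := by
  subst hab; rfl

theorem relabelTo_from (e : H' ≃ H) {X P : Type} (d : Dart m₀ m X P) :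
    relabelTo e (relabelFrom e d) = d := by
  cases d with
  | hole h i => exact hole_cast (e.apply_symm_apply h) i _
  | _ => rfl

theorem relabelFrom_to (e : H' ≃ H) {X P : Type} (d : Dart m₀ (fun h => m (e h)) X P) :
    relabelFrom e (relabelTo e d) = d := by
  cases d with
  | hole h i => exact hole_cast (m := fun h => m (e h)) (e.symm_apply_apply h) i _
  | _ => rfl

/-- Renaming the holes of a diagram along a bijection. -/
def relabel (D : Diagram m₀ m) (e : H' ≃ H) : Diagram m₀ (fun h => m (e h)) where
  finite_holes := by
    have := D.finite_holes
    exact Finite.of_equiv H e.symm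
  X := D.X
  P := D.P
  finite_X := D.finite_X
  finite_P := D.finite_P
  opp d := relabelFrom e (D.opp (relabelTo e d))
  opp_opp d := by rw [relabelTo_from, D.opp_opp, relabelFrom_to]
  opp_ne d hd := D.opp_ne (relabelTo e d) (by
    have := congrArg (relabelTo e) hd
    rwa [relabelTo_from] at this)

end relabel

/-- Diagrams without holes. The value `2` is irrelevant, the index type being empty. -/
abbrev Holeless (m₀ : ℕ) : Type 1 := Diagram m₀ (fun _ : Fin 0 => 2)

/-- Filling all holes of a diagram with diagrams without holes. -/
def fill {m₀ : ℕ} {H : Type} {m : H → ℕ} (T : Diagram m₀ m) (B : (h : H) → Holeless (m h)) :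
    Holeless m₀ :=
  (T.comp B).relabel ⟨fun i => i.elim0, fun q => q.2, fun i => i.elim0, fun q => q.2.elim0⟩

/-! ### Kauffman bracket

Link diagrams are the diagrams without holes and without ends. -/

/-- The pairing `0 ↔ 1`, `2 ↔ 3` of four cyclically ordered ends. -/
def pairH : Fin 4 → Fin 4 := ![1, 0, 3, 2]

/-- The pairing `0 ↔ 3`, `1 ↔ 2` of four cyclically ordered ends. -/
def pairV : Fin 4 → Fin 4 := ![3, 2, 1, 0]

theorem pairH_pairH : ∀ i, pairH (pairH i) = i := by decide

theorem pairV_pairV : ∀ i, pairV (pairV i) = i := by decide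

theorem pairH_ne : ∀ i, pairH i ≠ i := by decide

theorem pairV_ne : ∀ i, pairV i ≠ i := by decide

/-- Following a strand through a crossing split according to the state `σ`, or through an auxiliary
point.  The value `true` is the A-type splitting.  When the over-strand (`1`, `3`) is rotated
counterclockwise it sweeps the regions between `1` and `2` and between `3` and `0`; joining these
two regions connects `0` with `1` and `2` with `3`. -/
def splice {m₀ : ℕ} {H : Type} {m : H → ℕ} (D : Diagram m₀ m) (σ : D.X → Bool) :
    D.Darts → D.Darts
  | .cross x i => .cross x (if σ x then pairH i else pairV i)
  | .pt p i => .pt p (i + 1)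
  | .outer i => .outer i
  | .hole h i => .hole h i

/-- The number `d(σ)` of circles of a link diagram split according to the state `σ`. -/
noncomputable def numCircles (L : Holeless 0) (σ : L.X → Bool) : ℕ :=
  Nat.card (Quot fun a b : L.Darts => b = L.opp a ∨ b = L.splice σ a)

/-- The Kauffman bracket of a link diagram, as a sum over all states. -/
noncomputable def bracket (A : ℂ) (L : Holeless 0) : ℂ :=
  ∑ᶠ σ : L.X → Bool,
    A ^ Nat.card {x // σ x = true} * A⁻¹ ^ Nat.card {x // σ x = false} *
      (-A ^ 2 - A⁻¹ ^ 2) ^ (numCircles L σ - 1)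

/-! ### Elementary diagrams

The ends `0, 1, 2, 3` on a circle with four ends are NE, NW, SW, SE. -/

/-- The closures: `0` is the numerator closure (NE joined to NW, SW joined to SE), `1` is the
denominator closure (NE joined to SE, NW joined to SW), as diagrams with one hole and no ends on the
outer circle. -/
def closer (k : Fin 2) : Diagram 0 (fun _ : Fin 1 => 2) where
  finite_holes := inferInstance
  X := Empty
  P := Empty
  finite_X := inferInstance
  finite_P := inferInstance
  opp
    | .hole h i => .hole h (if k = 0 then pairH i else pairV i)
    | .outer i => .outer i
  opp_opp := by
    rintro (i | ⟨h, i⟩ | ⟨⟨⟩, -⟩ | ⟨⟨⟩, -⟩)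
    · rfl
    · exact congrArg (Dart.hole h) (by split_ifs; exacts [pairH_pairH i, pairV_pairV i])
  opp_ne := by
    rintro (i | ⟨h, i⟩ | ⟨⟨⟩, -⟩ | ⟨⟨⟩, -⟩) e
    · exact i.elim0
    · have e := Dart.hole.inj e
      split_ifs at e
      exacts [pairH_ne i (eq_of_heq e.2), pairV_ne i (eq_of_heq e.2)]

/-- The fundamental ball tangles: `0` consists of the strands NE–SE and NW–SW, `1` of the strands
NE–NW and SW–SE. -/
def fundamental (k : Fin 2) : Holeless 2 where
  finite_holes := inferInstance
  X := Empty
  P := Empty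
  finite_X := inferInstance
  finite_P := inferInstance
  opp
    | .outer i => .outer (if k = 0 then pairV i else pairH i)
    | .hole h i => .hole h i
  opp_opp := by
    rintro (i | ⟨h, i⟩ | ⟨⟨⟩, -⟩ | ⟨⟨⟩, -⟩)
    · exact congrArg Dart.outer (by split_ifs; exacts [pairV_pairV i, pairH_pairH i])
    · rfl
  opp_ne := by
    rintro (i | ⟨h, i⟩ | ⟨⟨⟩, -⟩ | ⟨⟨⟩, -⟩) e
    · have e := Dart.outer.inj e
      split_ifs at e
      exacts [pairV_ne i e, pairH_ne i e]
    · exact h.elim0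

/-- The closure of a ball tangle diagram: numerator closure for `0`, denominator closure for
`1`. -/
def closure (k : Fin 2) (B : Holeless 2) : Holeless 0 :=
  (closer k).fill fun _ => B

/-! ### Isotopy

Isotopy of diagrams is the equivalence relation generated by the isomorphisms of diagrams,
subdivision of strands, and the tangle Reidemeister moves, performed anywhere in a planar
diagram. -/

/-- `D` and `D'` are isomorphic: a bijection of half-edges fixes all ends, preserves edges, and
sends crossings to crossings (preserving the cyclic order and the under-strand) and auxiliary points
to auxiliary points. -/
def Iso {m₀ : ℕ} {H : Type} {m : H → ℕ} (D D' : Diagram m₀ m) : Prop :=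
  ∃ φ : D.Darts ≃ D'.Darts,
    (∀ d, φ (D.opp d) = D'.opp (φ d)) ∧
    (∀ i, φ (.outer i) = .outer i) ∧
    (∀ h i, φ (.hole h i) = .hole h i) ∧
    (∀ x, ∃ x', ∃ s : Fin 4, (s = 0 ∨ s = 2) ∧ ∀ i, φ (.cross x i) = .cross x' (i + s)) ∧
    (∀ p, ∃ p', ∃ s : Fin 2, ∀ i, φ (.pt p i) = .pt p' (i + s))

section subdivide

variable {m₀ : ℕ} {H : Type} {m : H → ℕ}

/-- Old half-edges after adding a new auxiliary point. -/
def subdivideMap {X P : Type} : Dart m₀ m X P → Dart m₀ m X (Option P)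
  | .outer i => .outer i
  | .hole h i => .hole h i
  | .cross x i => .cross x i
  | .pt p i => .pt (some p) i

open Classical in
/-- The edge containing `d` is cut in two by a new auxiliary point. -/
noncomputable def subdivideOpp (D : Diagram m₀ m) (d : D.Darts) :
    Dart m₀ m D.X (Option D.P) → Dart m₀ m D.X (Option D.P)
  | .pt none 0 => subdivideMap d
  | .pt none 1 => subdivideMap (D.opp d)
  | .pt (some p) i => old (.pt p i)
  | .outer i => old (.outer i)
  | .hole h i => old (.hole h i)
  | .cross x i => old (.cross x i)
where
  /-- The other end of the edge at an old half-edge. -/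
  old (a : D.Darts) : Dart m₀ m D.X (Option D.P) :=
    if a = d then .pt none 0 else if a = D.opp d then .pt none 1 else subdivideMap (D.opp a)

theorem subdivideOpp_map (D : Diagram m₀ m) (d a : D.Darts) :
    subdivideOpp D d (subdivideMap a) = subdivideOpp.old D d a := by
  cases a <;> rfl

theorem subdivideMap_injective {X P : Type} :
    Function.Injective (subdivideMap : Dart m₀ m X P → Dart m₀ m X (Option P)) := by
  intro a b hab
  cases a <;> cases b <;> simp [subdivideMap] at hab ⊢ <;> aesop

theorem subdivideMap_ne {X P : Type} (a : Dart m₀ m X P) (i : Fin 2) :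
    subdivideMap a ≠ .pt none i := by
  cases a <;> simp [subdivideMap]

theorem subdivide_cases {X P : Type} (a : Dart m₀ m X (Option P)) :
    (∃ b, a = subdivideMap b) ∨ a = .pt none 0 ∨ a = .pt none 1 := by
  match a with
  | .pt none 0 => exact .inr (.inl rfl)
  | .pt none 1 => exact .inr (.inr rfl)
  | .pt (some p) i => exact .inl ⟨.pt p i, rfl⟩
  | .outer i => exact .inl ⟨.outer i, rfl⟩
  | .hole h i => exact .inl ⟨.hole h i, rfl⟩
  | .cross x i => exact .inl ⟨.cross x i, rfl⟩

/-- Subdivision of the edge containing the half-edge `d` by a new auxiliary point. -/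
noncomputable def subdivide (D : Diagram m₀ m) (d : D.Darts) : Diagram m₀ m where
  finite_holes := D.finite_holes
  X := D.X
  P := Option D.P
  finite_X := D.finite_X
  finite_P := by
    have := D.finite_P
    infer_instance
  opp := subdivideOpp D d
  opp_opp := by
    intro a
    have hd := D.opp_ne d
    rcases subdivide_cases a with ⟨b, rfl⟩ | rfl | rfl
    · rw [subdivideOpp_map, subdivideOpp.old]
      split_ifs with h1 h2
      · rw [h1]; rfl
      · rw [h2]; rfl
      · have h3 : D.opp b ≠ d := fun e => h2 (by rw [← e, D.opp_opp])
        have h4 : D.opp b ≠ D.opp d := fun e => h1 (by rw [← D.opp_opp b, e, D.opp_opp])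
        rw [subdivideOpp_map, subdivideOpp.old, if_neg h3, if_neg h4, D.opp_opp]
    · change subdivideOpp D d (subdivideMap d) = _
      rw [subdivideOpp_map, subdivideOpp.old, if_pos rfl]
    · change subdivideOpp D d (subdivideMap (D.opp d)) = _
      rw [subdivideOpp_map, subdivideOpp.old, if_neg hd, if_pos rfl]
  opp_ne := by
    intro a
    rcases subdivide_cases a with ⟨b, rfl⟩ | rfl | rfl
    · rw [subdivideOpp_map, subdivideOpp.old]
      split_ifs with h1 h2
      · exact (subdivideMap_ne b 0).symm
      · exact (subdivideMap_ne b 1).symm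
      · exact fun e => D.opp_ne b (subdivideMap_injective e)
    · exact subdivideMap_ne d 0
    · exact subdivideMap_ne (D.opp d) 1

end subdivide

/-- A single strand. -/
def strand : Holeless 1 where
  finite_holes := inferInstance
  X := Empty
  P := Empty
  finite_X := inferInstance
  finite_P := inferInstance
  opp
    | .outer i => .outer (finRotate 2 i)
    | .hole h i => .hole h i
  opp_opp := by
    rintro (i | ⟨h, i⟩ | ⟨⟨⟩, -⟩ | ⟨⟨⟩, -⟩)
    · fin_cases i <;> rfl
    · rfl
  opp_ne := by
    rintro (i | ⟨h, i⟩ | ⟨⟨⟩, -⟩ | ⟨⟨⟩, -⟩)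
    · fin_cases i <;> nofun
    · exact h.elim0

/-- A strand with one kink, produced by a move of type I.  The half-edges `1 + s` and `2 + s` of the
crossing are joined by a loop, `s` and `3 + s` lead to the two ends; all four kinks occur. -/
def kink (s : Fin 4) (t : Fin 2) : Holeless 1 where
  finite_holes := inferInstance
  X := Unit
  P := Empty
  finite_X := inferInstance
  finite_P := inferInstance
  opp
    | .outer i => .cross () (if i = t then s else 3 + s)
    | .cross _ i =>
      if i = s then .outer t else
      if i = 1 + s then .cross () (2 + s) else
      if i = 2 + s then .cross () (1 + s) else .outer (t + 1)
    | .hole h i => .hole h i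
  opp_opp := by
    rintro (i | ⟨h, i⟩ | ⟨⟨⟩, i⟩ | ⟨⟨⟩, -⟩)
    · fin_cases s <;> fin_cases t <;> fin_cases i <;> rfl
    · rfl
    · fin_cases s <;> fin_cases t <;> fin_cases i <;> rfl
  opp_ne := by
    rintro (i | ⟨h, i⟩ | ⟨⟨⟩, i⟩ | ⟨⟨⟩, -⟩)
    · nofun
    · exact h.elim0
    · fin_cases s <;> fin_cases t <;> fin_cases i <;> nofun

/-- Two strands crossing twice, the strand NE–SE passing over the strand NW–SW in both crossings
(`0` is the upper one).  A move of type II relates this to the fundamental tangle `0`. -/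
def bigon : Holeless 2 where
  finite_holes := inferInstance
  X := Fin 2
  P := Empty
  finite_X := inferInstance
  finite_P := inferInstance
  opp
    | .outer 0 => .cross 0 3
    | .outer 1 => .cross 0 0
    | .outer 2 => .cross 1 2
    | .outer 3 => .cross 1 3
    | .cross 0 0 => .outer 1
    | .cross 0 1 => .cross 1 1
    | .cross 0 2 => .cross 1 0
    | .cross 0 3 => .outer 0
    | .cross 1 0 => .cross 0 2
    | .cross 1 1 => .cross 0 1
    | .cross 1 2 => .outer 2
    | .cross 1 3 => .outer 3
    | .hole h i => .hole h i
  opp_opp := by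
    rintro (i | ⟨h, i⟩ | ⟨x, i⟩ | ⟨⟨⟩, -⟩)
    · fin_cases i <;> rfl
    · rfl
    · fin_cases x <;> fin_cases i <;> rfl
  opp_ne := by
    rintro (i | ⟨h, i⟩ | ⟨x, i⟩ | ⟨⟨⟩, -⟩)
    · fin_cases i <;> nofun
    · exact h.elim0
    · fin_cases x <;> fin_cases i <;> nofun

/-- Three strands `0–3`, `1–4`, `2–5` crossing pairwise, the strand `0–3` lying over the other two
and passing on the side of the ends `4`, `5` of the crossing `0` of these.  In the crossing `0` the
strand `2–5` is the lower one if `s = 0` and the upper one if `s = 1`; crossing `1` is that of `0–3`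
with `2–5`, crossing `2` that of `0–3` with `1–4`. -/
def triangle (s : Fin 2) : Holeless 3 where
  finite_holes := inferInstance
  X := Fin 3
  P := Empty
  finite_X := inferInstance
  finite_P := inferInstance
  opp
    | .outer 0 => .cross 1 3
    | .outer 1 => .cross 0 (if s = 0 then 3 else 0)
    | .outer 2 => .cross 0 (if s = 0 then 0 else 1)
    | .outer 3 => .cross 2 1
    | .outer 4 => .cross 2 2
    | .outer 5 => .cross 1 2
    | .cross 0 i =>
      if i = (if s = 0 then 0 else 1) then .outer 2 else
      if i = (if s = 0 then 1 else 2) then .cross 2 0 else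
      if i = (if s = 0 then 2 else 3) then .cross 1 0 else .outer 1
    | .cross 1 0 => .cross 0 (if s = 0 then 2 else 3)
    | .cross 1 1 => .cross 2 3
    | .cross 1 2 => .outer 5
    | .cross 1 3 => .outer 0
    | .cross 2 0 => .cross 0 (if s = 0 then 1 else 2)
    | .cross 2 1 => .outer 3
    | .cross 2 2 => .outer 4
    | .cross 2 3 => .cross 1 1
    | .hole h i => .hole h i
  opp_opp := by
    rintro (i | ⟨h, i⟩ | ⟨x, i⟩ | ⟨⟨⟩, -⟩)
    · fin_cases s <;> fin_cases i <;> rfl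
    · rfl
    · fin_cases s <;> fin_cases x <;> fin_cases i <;> rfl
  opp_ne := by
    rintro (i | ⟨h, i⟩ | ⟨x, i⟩ | ⟨⟨⟩, -⟩)
    · fin_cases i <;> nofun
    · exact h.elim0
    · fin_cases s <;> fin_cases x <;> fin_cases i <;> nofun

/-- The same three strands, the strand `0–3` now passing on the side of the ends `1`, `2` of the
crossing `0`.  A move of type III relates this to `triangle`. -/
def triangle' (s : Fin 2) : Holeless 3 where
  finite_holes := inferInstance
  X := Fin 3
  P := Empty
  finite_X := inferInstance
  finite_P := inferInstance
  opp
    | .outer 0 => .cross 2 3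
    | .outer 1 => .cross 2 0
    | .outer 2 => .cross 1 0
    | .outer 3 => .cross 1 1
    | .outer 4 => .cross 0 (if s = 0 then 1 else 2)
    | .outer 5 => .cross 0 (if s = 0 then 2 else 3)
    | .cross 0 i =>
      if i = (if s = 0 then 0 else 1) then .cross 1 2 else
      if i = (if s = 0 then 1 else 2) then .outer 4 else
      if i = (if s = 0 then 2 else 3) then .outer 5 else .cross 2 2
    | .cross 1 0 => .outer 2
    | .cross 1 1 => .outer 3
    | .cross 1 2 => .cross 0 (if s = 0 then 0 else 1)
    | .cross 1 3 => .cross 2 1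
    | .cross 2 0 => .outer 1
    | .cross 2 1 => .cross 1 3
    | .cross 2 2 => .cross 0 (if s = 0 then 3 else 0)
    | .cross 2 3 => .outer 0
    | .hole h i => .hole h i
  opp_opp := by
    rintro (i | ⟨h, i⟩ | ⟨x, i⟩ | ⟨⟨⟩, -⟩)
    · fin_cases s <;> fin_cases i <;> rfl
    · rfl
    · fin_cases s <;> fin_cases x <;> fin_cases i <;> rfl
  opp_ne := by
    rintro (i | ⟨h, i⟩ | ⟨x, i⟩ | ⟨⟨⟩, -⟩)
    · fin_cases i <;> nofun
    · exact h.elim0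
    · fin_cases s <;> fin_cases x <;> fin_cases i <;> nofun

/-- A hole with its four strands leading to the ends `0, 1, 2, 3`, and an arc from the end `4` to the
end `5` without crossings. -/
def arcBeside : Diagram 3 (fun _ : Fin 1 => 2) where
  finite_holes := inferInstance
  X := Empty
  P := Empty
  finite_X := inferInstance
  finite_P := inferInstance
  opp
    | .outer 0 => .hole 0 0
    | .outer 1 => .hole 0 1
    | .outer 2 => .hole 0 2
    | .outer 3 => .hole 0 3
    | .outer 4 => .outer 5
    | .outer 5 => .outer 4
    | .hole _ 0 => .outer 0
    | .hole _ 1 => .outer 1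
    | .hole _ 2 => .outer 2
    | .hole _ 3 => .outer 3
  opp_opp := by
    rintro (i | ⟨h, i⟩ | ⟨⟨⟩, -⟩ | ⟨⟨⟩, -⟩)
    · fin_cases i <;> rfl
    · fin_cases h; fin_cases i <;> rfl
  opp_ne := by
    rintro (i | ⟨h, i⟩ | ⟨⟨⟩, -⟩ | ⟨⟨⟩, -⟩)
    · fin_cases i <;> nofun
    · fin_cases i <;> nofun

/-- The half-edge in direction `j` at the crossings of `arcAround s`. -/
def arcDir (s : Fin 2) (j : Fin 4) : Fin 4 := j + (if s = 0 then 0 else 1)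

/-- The same hole and strands, the arc from the end `4` to the end `5` now going around the hole and
crossing the strands `3, 2, 1, 0`, over all of them if `s = 0` and under all of them if `s = 1`.
The half-edges `s, 1 + s, 2 + s, 3 + s` (modulo `4`) of the crossing on the strand `x` point away from the hole,
towards the next strand counterclockwise, to the hole, and towards the next strand clockwise.
A move of type IV relates this to `arcBeside`. -/
def arcAround (s : Fin 2) : Diagram 3 (fun _ : Fin 1 => 2) where
  finite_holes := inferInstance
  X := Fin 4
  P := Empty
  finite_X := inferInstance
  finite_P := inferInstance
  opp
    | .outer 0 => .cross 0 (arcDir s 0)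
    | .outer 1 => .cross 1 (arcDir s 0)
    | .outer 2 => .cross 2 (arcDir s 0)
    | .outer 3 => .cross 3 (arcDir s 0)
    | .outer 4 => .cross 3 (arcDir s 1)
    | .outer 5 => .cross 0 (arcDir s 3)
    | .hole _ i => .cross i (arcDir s 2)
    | .cross x i =>
      if i = arcDir s 0 then .outer (Fin.castLE (by decide) x) else
      if i = arcDir s 1 then (if x = 3 then .outer 4 else .cross (x + 1) (arcDir s 3)) else
      if i = arcDir s 2 then .hole 0 x else
      (if x = 0 then .outer 5 else .cross (x - 1) (arcDir s 1))
  opp_opp := by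
    rintro (i | ⟨h, i⟩ | ⟨x, i⟩ | ⟨⟨⟩, -⟩)
    · fin_cases s <;> fin_cases i <;> rfl
    · fin_cases s <;> fin_cases h <;> fin_cases i <;> rfl
    · fin_cases s <;> fin_cases x <;> fin_cases i <;> rfl
  opp_ne := by
    rintro (i | ⟨h, i⟩ | ⟨x, i⟩ | ⟨⟨⟩, -⟩)
    · fin_cases i <;> nofun
    · nofun
    · fin_cases s <;> fin_cases x <;> fin_cases i <;> nofun

/-- Isotopy of planar diagrams with the same ends: the smallest equivalence relation which contains
isomorphism, subdivision of strands and the tangle Reidemeister moves of types I, II, III, IV, and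
which is local, i.e. stable under inserting equivalent diagrams in the holes of a planar diagram (and
under renaming holes). -/
inductive Isotopic : {m₀ : ℕ} → {H : Type} → {m : H → ℕ} →
    Diagram m₀ m → Diagram m₀ m → Prop
  | iso {m₀ : ℕ} {H : Type} {m : H → ℕ} {D D' : Diagram m₀ m} :
      D.Planar → Iso D D' → Isotopic D D'
  | subdivide {m₀ : ℕ} {H : Type} {m : H → ℕ} (D : Diagram m₀ m) (d : D.Darts) :
      D.Planar → Isotopic D (D.subdivide d)
  | moveI (s : Fin 4) (t : Fin 2) : Isotopic strand (kink s t)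
  | moveII : Isotopic (fundamental 0) bigon
  | moveIII (s : Fin 2) : Isotopic (triangle s) (triangle' s)
  | moveIV (s : Fin 2) : Isotopic arcBeside (arcAround s)
  | comp {m₀ : ℕ} {H : Type} {m : H → ℕ} {K : H → Type} {μ : (h : H) → K h → ℕ}
      (C : Diagram m₀ m) (S S' : (h : H) → Diagram (m h) (μ h)) :
      C.Planar → (∀ h, Isotopic (S h) (S' h)) → Isotopic (C.comp S) (C.comp S')
  | relabel {m₀ : ℕ} {H H' : Type} {m : H → ℕ} {D D' : Diagram m₀ m} (e : H' ≃ H) :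
      Isotopic D D' → Isotopic (D.relabel e) (D'.relabel e)
  | symm {m₀ : ℕ} {H : Type} {m : H → ℕ} {D D' : Diagram m₀ m} :
      Isotopic D D' → Isotopic D' D
  | trans {m₀ : ℕ} {H : Type} {m : H → ℕ} {D D' D'' : Diagram m₀ m} :
      Isotopic D D' → Isotopic D' D'' → Isotopic D D''

end Diagram

/-- Diagrams of `n`-punctured ball tangles with four ends on each boundary sphere. -/
abbrev TangleDiagram (n : ℕ) : Type 1 := {D : Diagram 2 (fun _ : Fin n => 2) // D.Planar}

/-! ### Lexicographic order -/

/-- The `i`-th tuple (`0 ≤ i < 2 ^ n`) of `{0, 1}ⁿ` in lexicographic order; the entries `0`, `1` stand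
for the two closures and the two fundamental tangles. -/
def lexTuple : (n : ℕ) → ℕ → Fin n → Fin 2
  | 0, _ => Fin.elim0
  | n + 1, i => Fin.cons (if i < 2 ^ n then 0 else 1) (lexTuple n (if i < 2 ^ n then i else i - 2 ^ n))

theorem lexTuple_strictMono (n : ℕ) :
    StrictMono fun i : Fin (2 ^ n) => toLex (lexTuple n i) := by
  suffices h : ∀ i j : ℕ, i < j → j < 2 ^ n → toLex (lexTuple n i) < toLex (lexTuple n j) from
    fun i j hij => h i j hij j.2
  induction n with
  | zero => intro i j h1 h2; simp at h2; omega
  | succ n ih =>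
    intro i j h1 h2
    rw [pow_succ] at h2
    change Pi.Lex (· < ·) (fun {_} => (· < ·)) (lexTuple (n + 1) i) (lexTuple (n + 1) j)
    by_cases hi : i < 2 ^ n
    · by_cases hj : j < 2 ^ n
      · obtain ⟨k, hk1, hk2⟩ := ih i j h1 hj
        refine ⟨k.succ, fun l hl => ?_, ?_⟩
        · refine Fin.cases ?_ (fun l hl => ?_) l hl
          · intro _; simp [lexTuple, hi, hj]
          · simpa [lexTuple, hi, hj] using hk1 l (by simpa using hl)
        · simpa [lexTuple, hi, hj] using hk2
      · exact ⟨0, fun l hl => absurd hl (Fin.not_lt_zero l), by simp [lexTuple, hi, hj]⟩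
    · have hj : ¬ j < 2 ^ n := by omega
      obtain ⟨k, hk1, hk2⟩ := ih (i - 2 ^ n) (j - 2 ^ n) (by omega) (by omega)
      refine ⟨k.succ, fun l hl => ?_, ?_⟩
      · refine Fin.cases ?_ (fun l hl => ?_) l hl
        · intro _; simp [lexTuple, hi, hj]
        · simpa [lexTuple, hi, hj] using hk1 l (by simpa using hl)
      · simpa [lexTuple, hi, hj] using hk2

/-- The `i`-th term (`0 ≤ i < 2 ^ n`) of the sequence `a_n`, where `a_0 = (0)` and `a_{n + 1}` is
`a_n` followed by `a_n + 1`. -/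
def expSeq : ℕ → ℕ → ℕ
  | 0, _ => 0
  | n + 1, i => if i < 2 ^ n then expSeq n i else expSeq n (i - 2 ^ n) + 1

/-! ### The matrix of brackets -/

/-- The link diagram `T_{kα}`: hole `j` is filled with the fundamental tangle `α j`, and then the
closure `k` is taken. -/
def linkOf {n : ℕ} (T : TangleDiagram n) (k : Fin 2) (α : Fin n → Fin 2) : Diagram.Holeless 0 :=
  Diagram.closure k (T.1.fill fun j => Diagram.fundamental (α j))

/-- The matrix `X(T)` of Kauffman brackets at `A = e^{iπ/4}`, before normalization by an eighth root
of unity: its entry `(k, i)` is `(-i)^{t_i} i^k ⟨T_{k α_i}⟩`, rows being numbered by `k = 0, 1`. -/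
noncomputable def bracketMatrix {n : ℕ} (T : TangleDiagram n) :
    Matrix (Fin 2) (Fin (2 ^ n)) ℂ :=
  Matrix.of fun k i =>
    (-Complex.I) ^ expSeq n i * Complex.I ^ (k : ℕ) *
      Diagram.bracket (Complex.exp (Complex.I * Real.pi / 4)) (linkOf T k (lexTuple n i))

/-! ### Matrices modulo sign -/

/-- Equality up to sign. -/
def signSetoid (a b : ℕ) (R : Type) [CommRing R] : Setoid (Matrix (Fin a) (Fin b) R) where
  r M N := M = N ∨ M = -N
  iseqv :=
    { refl := fun _ => .inl rfl
      symm := by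
        rintro M N (rfl | rfl)
        exacts [.inl rfl, .inr (neg_neg N).symm]
      trans := by
        rintro M N Q (rfl | rfl) (rfl | rfl)
        exacts [.inl rfl, .inr rfl, .inr rfl, .inl (neg_neg Q)] }

/-- `PM_{a × b}(R)`: matrices modulo multiplication by `± 1`. -/
def PM (a b : ℕ) (R : Type) [CommRing R] : Type := Quotient (signSetoid a b R)

namespace PM

variable {R : Type} [CommRing R]

/-- The class of a matrix. -/
def mk {a b : ℕ} (M : Matrix (Fin a) (Fin b) R) : PM a b R := Quotient.mk (signSetoid a b R) M

/-- Multiplication of classes, `[M][N] = [MN]`. -/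
def mul {a b c : ℕ} (x : PM a b R) (y : PM b c R) : PM a c R :=
  Quotient.liftOn₂ x y (fun M N => mk (M * N)) (by
    rintro M N M' N' (rfl | rfl) (rfl | rfl) <;> apply Quotient.sound
    · exact .inl rfl
    · exact .inr (Matrix.mul_neg _ _)
    · exact .inr (Matrix.neg_mul _ _)
    · exact .inl (by rw [Matrix.neg_mul, Matrix.mul_neg, neg_neg]))

end PM

/-- The dictionary order function `ξⁿ`: the column vector of length `2ⁿ` whose `i`-th entry is
`∏ j, v j (α_i j)`. -/
def xi {R : Type} [CommRing R] (n : ℕ) (v : Fin n → Matrix (Fin 2) (Fin 1) R) :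
    Matrix (Fin (2 ^ n)) (Fin 1) R :=
  Matrix.of fun i _ => ∏ j, v j (lexTuple n i j) 0

/-- The function `[ξⁿ]` induced by `ξⁿ` on classes modulo sign; see `xiClass_mk`. -/
noncomputable def xiClass {R : Type} [CommRing R] (n : ℕ) (x : Fin n → PM 2 1 R) : PM (2 ^ n) 1 R :=
  PM.mk (xi n fun j => Quotient.out (x j))

theorem xiClass_mk {R : Type} [CommRing R] (n : ℕ) (v : Fin n → Matrix (Fin 2) (Fin 1) R) :
    xiClass n (fun j => PM.mk (v j)) = PM.mk (xi n v) := by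
  have h : ∀ j, ∃ ε : R, (ε = 1 ∨ ε = -1) ∧
      ∀ l, (Quotient.out (PM.mk (v j)) : Matrix (Fin 2) (Fin 1) R) l 0 = ε * v j l 0 := by
    intro j
    rcases (Quotient.mk_out (s := signSetoid 2 1 R) (v j) : _ = _ ∨ _ = _) with h | h
    · exact ⟨1, .inl rfl, fun l => by rw [one_mul]; exact congrFun (congrFun h l) 0⟩
    · exact ⟨-1, .inr rfl, fun l => by rw [neg_one_mul]; exact congrFun (congrFun h l) 0⟩
  choose ε hε h using h
  have hp : (∏ j, ε j) = 1 ∨ (∏ j, ε j) = -1 :=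
    Finset.prod_induction ε (fun r => r = 1 ∨ r = -1)
      (by rintro a b (rfl | rfl) (rfl | rfl) <;> simp) (.inl rfl) (fun j _ => hε j)
  have hx : (xi n fun j => Quotient.out (PM.mk (v j))) = (∏ j, ε j) • xi n v := by
    ext i l
    simp only [xi, Matrix.of_apply, Matrix.smul_apply, smul_eq_mul, h, Finset.prod_mul_distrib]
  apply Quotient.sound
  rcases hp with hp | hp
  · exact .inl (by rw [hx, hp, one_smul])
  · exact .inr (by rw [hx, hp, neg_one_smul])

end PBT

namespace PBT
namespace Diagram

/-! ### Strand components of states -/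

section strands

variable {m₀ : ℕ} {H : Type} {m : H → ℕ}

/-! Split every crossing of a diagram according to a state and let each hole connect its ends by a
given partition. Only two data of the resulting strands matter: the partition of the outer ends
(`part`) and the number of closed strands (`closed`). The state sum `val A δ D r p` adds the weights
of the states inducing the partition `p`, each closed strand contributing `δ`. Splitting commutes
with gluing (`comp_part`, `comp_closed`), so state sums of composites are contracted like tensors
(`val_comp`).

At `A = e^{iπ/4}` the loop value `-A² - A⁻²` is `0`, and only states without closed strands count.
Because of `val_comp`, isotopy invariance reduces to the local moves, each a comparison of finitely
many terms. This is done by a verified label-merging algorithm and evaluation in the kernel. A kink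
costs an eighth root of unity, the other moves cost nothing (`Isotopic.exists_val_eq`).

Planarity enters through two facts about diagrams with four ends on every circle, the holes being
filled with fundamental tangles. First, the outer ends are connected as in one of the two
fundamental tangles (`Planar.exists_part_eq_flat`). Second, for states without closed strands the
parity of the number of A-splittings plus the indices of the tangles in the holes and at the outer
circle depends on the diagram only (`Planar.exists_sign`). Both use a checkerboard colouring of the
half-edges: the circles of a fully split diagram are the cycles of a permutation of the half-edges
of one colour, and switching one splitting multiplies this permutation by a transposition. The
colouring itself comes from the Euler characteristic: it is maximal exactly when every cycle modulo
`2` bounds a set of faces (`euler_iff`), and the set of all edges is a cycle since all valences are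
even. The same criterion shows that composites of planar diagrams are planar.

By the first fact the bracket of `T_{kα}` is the coefficient of `flat k` in the state sum of `T`
with the holes connected by `α` (`bracket_linkOf`), and the state sum of a filling expands over the
fundamental tangles in the holes. The powers of `-i` in the matrix of `T` cancel the powers of `i`
in the column of the fillings, which gives the product formula (`bracketMatrix_fill`).

By the second fact, after multiplication by `A^N`, `N` the number of crossings, every surviving term
is up to sign a power of `i` whose exponent has a fixed parity. One common eighth root of unity
therefore makes all entries integers (`exists_int_smul`). The integer matrix is unique up to sign
because integers with equal eighth powers agree up to sign (`eq_or_eq_neg_of_smul_eq`). -/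

instance finite_darts (D : Diagram m₀ m) : Finite D.Darts := by
  have := D.finite_holes
  have := D.finite_X
  have := D.finite_P
  let f : (Fin (2 * m₀) ⊕ (Σ h, Fin (2 * m h))) ⊕ ((D.X × Fin 4) ⊕ (D.P × Fin 2)) → D.Darts :=
    Sum.elim (Sum.elim .outer fun q => .hole q.1 q.2)
      (Sum.elim (fun q => .cross q.1 q.2) fun q => .pt q.1 q.2)
  refine Finite.of_surjective f ?_
  rintro (i | ⟨h, i⟩ | ⟨x, i⟩ | ⟨p, i⟩)
  exacts [⟨.inl (.inl i), rfl⟩, ⟨.inl (.inr ⟨h, i⟩), rfl⟩, ⟨.inr (.inl (x, i)), rfl⟩,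
    ⟨.inr (.inr (p, i)), rfl⟩]

/-- One step along a strand of the state `σ`, the ends on the hole `h` being connected according to
the partition `r h`. -/
def strandRel (D : Diagram m₀ m) (σ : D.X → Bool) (r : ∀ h, Setoid (Fin (2 * m h)))
    (a b : D.Darts) : Prop :=
  b = D.opp a ∨ b = D.splice σ a ∨ ∃ h i j, a = .hole h i ∧ b = .hole h j ∧ r h i j

/-- The partition of the half-edges into strands of the state `σ`. -/
def strands (D : Diagram m₀ m) (σ : D.X → Bool) (r : ∀ h, Setoid (Fin (2 * m h))) :
    Setoid D.Darts :=
  Relation.EqvGen.setoid (D.strandRel σ r)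

/-- The partition of the outer ends given by the strands of a state. -/
def part (D : Diagram m₀ m) (σ : D.X → Bool) (r : ∀ h, Setoid (Fin (2 * m h))) :
    Setoid (Fin (2 * m₀)) :=
  (D.strands σ r).comap Dart.outer

/-- The number of closed strands of a state. -/
noncomputable def closed (D : Diagram m₀ m) (σ : D.X → Bool) (r : ∀ h, Setoid (Fin (2 * m h))) :
    ℕ :=
  Nat.card {c : Quotient (D.strands σ r) // ∀ i, Quotient.mk _ (Dart.outer i) ≠ c}

variable (D : Diagram m₀ m) (σ : D.X → Bool) (r : ∀ h, Setoid (Fin (2 * m h)))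

theorem strands_opp (a : D.Darts) : D.strands σ r a (D.opp a) :=
  .rel _ _ (.inl rfl)

theorem strands_splice (a : D.Darts) : D.strands σ r a (D.splice σ a) :=
  .rel _ _ (.inr (.inl rfl))

theorem strands_hole {h : H} {i j : Fin (2 * m h)} (hij : r h i j) :
    D.strands σ r (.hole h i) (.hole h j) :=
  .rel _ _ (.inr (.inr ⟨h, i, j, rfl, rfl, hij⟩))

variable {D σ r}

theorem strands_symm {a b : D.Darts} (h : D.strands σ r a b) : D.strands σ r b a :=
  Setoid.symm' _ h

theorem strands_trans {a b c : D.Darts} (h : D.strands σ r a b) (h' : D.strands σ r b c) :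
    D.strands σ r a c :=
  Setoid.trans' _ h h'

/-- A relation respected by the steps along strands is respected by strands. -/
theorem strands_le (s : Setoid D.Darts) (hopp : ∀ a, s a (D.opp a))
    (hsplice : ∀ a, s a (D.splice σ a))
    (hhole : ∀ h i j, r h i j → s (.hole h i) (.hole h j)) : D.strands σ r ≤ s := by
  refine Setoid.eqvGen_le ?_
  rintro a b (rfl | rfl | ⟨h, i, j, rfl, rfl, hij⟩)
  exacts [hopp a, hsplice a, hhole h i j hij]

theorem strands_apply_eq {Q : Type*} (f : D.Darts → Q) (hopp : ∀ a, f a = f (D.opp a))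
    (hsplice : ∀ a, f a = f (D.splice σ a))
    (hhole : ∀ h i j, r h i j → f (.hole h i) = f (.hole h j)) {a b : D.Darts}
    (hab : D.strands σ r a b) : f a = f b :=
  strands_le (Setoid.ker f) hopp hsplice hhole hab

/-- Computation of the partition of the ends from a labelling of the strands. -/
theorem part_eq_ker {Q : Type*} {f : D.Darts → Q} (hf : ∀ a b, f a = f b ↔ D.strands σ r a b) :
    D.part σ r = Setoid.ker fun i => f (.outer i) := by
  ext i j
  exact (hf _ _).symm

/-- Computation of the number of closed strands from a labelling of the strands. -/
theorem closed_eq_card {Q : Type*} {f : D.Darts → Q} (hf : ∀ a b, f a = f b ↔ D.strands σ r a b)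
    (hs : Function.Surjective f) : D.closed σ r = Nat.card {q : Q // ∀ i, f (.outer i) ≠ q} := by
  let g : Quotient (D.strands σ r) → Q := Quotient.lift f fun a b hab => (hf a b).2 hab
  have hg : Function.Bijective g := by
    constructor
    · rintro ⟨a⟩ ⟨b⟩ hab
      exact Quotient.sound ((hf a b).1 hab)
    · intro q
      obtain ⟨a, rfl⟩ := hs q
      exact ⟨Quotient.mk _ a, rfl⟩
  refine Nat.card_congr ((Equiv.ofBijective g hg).subtypeEquiv ?_)
  intro c
  refine forall_congr' fun i => not_congr ?_
  exact hg.1.eq_iff.symm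

end strands

/-! ### Strands of composites -/

section comp

variable {m₀ : ℕ} {H : Type} {m : H → ℕ} {K : H → Type} {μ : (h : H) → K h → ℕ}
variable (C : Diagram m₀ m) (S : (h : H) → Diagram (m h) (μ h))

/-- The half-edges of a composite are those of its pieces. -/
def compSplit : CompDart C S → C.Darts ⊕ (Σ h, (S h).Darts)
  | .outer i => .inl (.outer i)
  | .hole ⟨h, k⟩ i => .inr ⟨h, .hole k i⟩
  | .cross (.inl x) i => .inl (.cross x i)
  | .cross (.inr ⟨h, x⟩) i => .inr ⟨h, .cross x i⟩
  | .pt (.inl (.inl p)) i => .inl (.pt p i)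
  | .pt (.inl (.inr ⟨h, p⟩)) i => .inr ⟨h, .pt p i⟩
  | .pt (.inr ⟨h, i⟩) 0 => .inl (.hole h i)
  | .pt (.inr ⟨h, i⟩) 1 => .inr ⟨h, .outer i⟩

@[simp] theorem compSplit_out (d : C.Darts) : compSplit C S (compOut C S d) = .inl d := by
  cases d <;> rfl

@[simp] theorem compSplit_in (h : H) (d : (S h).Darts) :
    compSplit C S (compIn C S h d) = .inr ⟨h, d⟩ := by
  cases d <;> rfl

/-- The half-edges of a composite are those of its pieces. -/
def compEquiv : C.Darts ⊕ (Σ h, (S h).Darts) ≃ CompDart C S where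
  toFun := Sum.elim (compOut C S) fun q => compIn C S q.1 q.2
  invFun := compSplit C S
  left_inv := by rintro (d | ⟨h, d⟩) <;> simp
  right_inv d := by rcases comp_cases C S d with ⟨a, rfl⟩ | ⟨h, a, rfl⟩ <;> simp

theorem comp_opp_out (d : C.Darts) :
    (C.comp S).opp (compOut C S d) = compOut C S (C.opp d) :=
  compOpp_out C S d

theorem comp_opp_in (h : H) (d : (S h).Darts) :
    (C.comp S).opp (compIn C S h d) = compIn C S h ((S h).opp d) :=
  compOpp_in C S h d

variable {C S}
variable (σ : (C.comp S).X → Bool) (r : (q : Σ h, K h) → Setoid (Fin (2 * μ q.1 q.2)))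

/-- The state of the outer diagram given by a state of a composite. -/
def stateOut (σ : (C.comp S).X → Bool) : C.X → Bool := fun x => σ (.inl x)

/-- The state of an inserted diagram given by a state of a composite. -/
def stateIn (σ : (C.comp S).X → Bool) (h : H) : (S h).X → Bool := fun x => σ (.inr ⟨h, x⟩)

/-- The partitions of the ends of the holes given by the inserted diagrams. -/
def innerPart (h : H) : Setoid (Fin (2 * m h)) :=
  (S h).part (stateIn σ h) fun k => r ⟨h, k⟩

theorem comp_strands_in (h : H) {a b : (S h).Darts}
    (hab : (S h).strands (stateIn σ h) (fun k => r ⟨h, k⟩) a b) :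
    (C.comp S).strands σ r (compIn C S h a) (compIn C S h b) := by
  refine strands_le (((C.comp S).strands σ r).comap (compIn C S h)) ?_ ?_ ?_ hab
  · intro a
    have := (C.comp S).strands_opp σ r (compIn C S h a)
    rwa [comp_opp_in] at this
  · intro a
    have := (C.comp S).strands_splice σ r (compIn C S h a)
    cases a with
    | outer i => exact Setoid.refl' _ _
    | _ => exact this
  · intro k i j hij
    exact (C.comp S).strands_hole σ r (h := ⟨h, k⟩) hij

theorem comp_strands_out {a b : C.Darts} (hab : C.strands (stateOut σ) (innerPart σ r) a b) :
    (C.comp S).strands σ r (compOut C S a) (compOut C S b) := by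
  refine strands_le (((C.comp S).strands σ r).comap (compOut C S)) ?_ ?_ ?_ hab
  · intro a
    have := (C.comp S).strands_opp σ r (compOut C S a)
    rwa [comp_opp_out] at this
  · intro a
    have := (C.comp S).strands_splice σ r (compOut C S a)
    cases a with
    | hole h i => exact Setoid.refl' _ _
    | _ => exact this
  · intro h i j hij
    -- An end of the hole and the matching outer end of the inserted diagram are the two halves of
    -- one auxiliary point, so a splice step joins them.
    have e : ∀ i, (C.comp S).strands σ r (compOut C S (.hole h i)) (compIn C S h (.outer i)) :=
      fun i => (C.comp S).strands_splice σ r (compOut C S (.hole h i))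
    exact strands_trans (strands_trans (e i) (comp_strands_in σ r h hij)) (strands_symm (e j))

/-- The closed strands of the diagram inserted in the hole `h`. -/
abbrev InnerClosed (h : H) : Type :=
  {c : Quotient ((S h).strands (stateIn σ h) fun k => r ⟨h, k⟩) //
    ∀ i, Quotient.mk _ (Dart.outer i) ≠ c}

open Classical in
/-- The strand of a half-edge in an inserted diagram. -/
noncomputable def innerLabel (h : H) (d : (S h).Darts) :
    Quotient (C.strands (stateOut σ) (innerPart σ r)) ⊕ (Σ h, InnerClosed σ r h) :=
  if hd : ∃ i, (S h).strands (stateIn σ h) (fun k => r ⟨h, k⟩) (.outer i) d then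
    .inl (Quotient.mk _ (.hole h hd.choose))
  else .inr ⟨h, Quotient.mk _ d, fun i e => hd ⟨i, Quotient.exact e⟩⟩

/-- Two outer ends on one strand of `S h` are related by `innerPart`, hence lie on one strand of
`C`; the choice made in `innerLabel` is therefore immaterial. -/
theorem innerLabel_of_outer {h : H} {d : (S h).Darts} {i : Fin (2 * m h)}
    (hi : (S h).strands (stateIn σ h) (fun k => r ⟨h, k⟩) (.outer i) d) :
    innerLabel σ r h d = .inl (Quotient.mk _ (.hole h i)) := by
  have hd : ∃ i, (S h).strands (stateIn σ h) (fun k => r ⟨h, k⟩) (.outer i) d := ⟨i, hi⟩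
  rw [innerLabel, dif_pos hd]
  refine congrArg Sum.inl (Quotient.sound (C.strands_hole _ _ ?_))
  exact strands_trans hd.choose_spec (strands_symm hi)

theorem innerLabel_congr {h : H} {a b : (S h).Darts}
    (hab : (S h).strands (stateIn σ h) (fun k => r ⟨h, k⟩) a b) :
    innerLabel (C := C) σ r h a = innerLabel σ r h b := by
  by_cases ha : ∃ i, (S h).strands (stateIn σ h) (fun k => r ⟨h, k⟩) (.outer i) a
  · obtain ⟨i, hi⟩ := ha
    rw [innerLabel_of_outer σ r hi, innerLabel_of_outer σ r (strands_trans hi hab)]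
  · have hb : ¬ ∃ i, (S h).strands (stateIn σ h) (fun k => r ⟨h, k⟩) (.outer i) b :=
      fun ⟨i, hi⟩ => ha ⟨i, strands_trans hi (strands_symm hab)⟩
    rw [innerLabel, innerLabel, dif_neg ha, dif_neg hb]
    congr 3
    exact Quotient.sound hab

/-- The strand of a half-edge in a composite. -/
noncomputable def compLabel (d : CompDart C S) :
    Quotient (C.strands (stateOut σ) (innerPart σ r)) ⊕ (Σ h, InnerClosed σ r h) :=
  Sum.elim (fun a => .inl (Quotient.mk _ a)) (fun q => innerLabel σ r q.1 q.2) (compSplit C S d)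

theorem compLabel_out (d : C.Darts) :
    compLabel σ r (compOut C S d) = .inl (Quotient.mk _ d) := by
  rw [compLabel, compSplit_out]; rfl

theorem compLabel_in (h : H) (d : (S h).Darts) :
    compLabel σ r (compIn C S h d) = innerLabel σ r h d := by
  rw [compLabel, compSplit_in]; rfl

theorem compLabel_surjective : Function.Surjective (compLabel (C := C) (S := S) σ r) := by
  rintro (⟨⟨a⟩⟩ | ⟨h, ⟨⟨a⟩, ha⟩⟩)
  · exact ⟨compOut C S a, compLabel_out σ r a⟩
  · refine ⟨compIn C S h a, ?_⟩
    rw [compLabel_in, innerLabel, dif_neg]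
    · rfl
    · rintro ⟨i, hi⟩
      exact ha i (Quotient.sound hi)

/-- A strand of the composite either meets `C`, and is then a strand of `C` running through the
holes along the inserted diagrams, or stays inside one inserted diagram, where it meets no outer
end. The labels list exactly these possibilities. -/
theorem compLabel_eq_iff (a b : (C.comp S).Darts) :
    compLabel σ r a = compLabel σ r b ↔ (C.comp S).strands σ r a b := by
  have ho : ∀ (h : H) (i : Fin (2 * m h)),
      (C.comp S).strands σ r (compOut C S (.hole h i)) (compIn C S h (.outer i)) :=
    fun h i => (C.comp S).strands_splice σ r (compOut C S (.hole h i))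
  constructor
  · intro hab
    -- every half-edge is equivalent to a representative of its label
    have key : ∀ d : (C.comp S).Darts, (∃ a, compLabel σ r d = .inl (Quotient.mk _ a) ∧
        (C.comp S).strands σ r d (compOut C S a)) ∨ ∃ h a ha,
        compLabel σ r d = .inr ⟨h, Quotient.mk _ a, ha⟩ ∧ d = compIn C S h a := by
      intro d
      rcases comp_cases C S d with ⟨a, rfl⟩ | ⟨h, a, rfl⟩
      · exact .inl ⟨a, compLabel_out σ r a, Setoid.refl' _ _⟩
      · by_cases ha : ∃ i, (S h).strands (stateIn σ h) (fun k => r ⟨h, k⟩) (.outer i) a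
        · obtain ⟨i, hi⟩ := ha
          refine .inl ⟨.hole h i, ?_, ?_⟩
          · rw [compLabel_in, innerLabel_of_outer σ r hi]
          · exact strands_trans (comp_strands_in σ r h (strands_symm hi)) (strands_symm (ho h i))
        · refine .inr ⟨h, a, fun i e => ha ⟨i, Quotient.exact e⟩, ?_, rfl⟩
          rw [compLabel_in, innerLabel, dif_neg ha]
    rcases key a with ⟨a', ha, ha'⟩ | ⟨h, a', ha', ha, rfl⟩ <;>
      rcases key b with ⟨b', hb, hb'⟩ | ⟨k, b', hb', hb, rfl⟩ <;> rw [ha, hb] at hab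
    · exact strands_trans (strands_trans ha' (comp_strands_out σ r (Quotient.exact (Sum.inl.inj hab))))
        (strands_symm hb')
    · exact absurd hab (by simp)
    · exact absurd hab (by simp)
    · obtain ⟨rfl, e⟩ := Sigma.mk.inj (Sum.inr.inj hab)
      exact comp_strands_in σ r h (Quotient.exact (congrArg Subtype.val (eq_of_heq e)))
  · intro hab
    refine strands_apply_eq _ ?_ ?_ ?_ hab
    · intro a
      rcases comp_cases C S a with ⟨a, rfl⟩ | ⟨h, a, rfl⟩
      · rw [comp_opp_out, compLabel_out, compLabel_out]
        exact congrArg Sum.inl (Quotient.sound (C.strands_opp _ _ a))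
      · rw [comp_opp_in, compLabel_in, compLabel_in]
        exact innerLabel_congr σ r ((S h).strands_opp _ _ a)
    · have hj : ∀ (h : H) (i : Fin (2 * m h)), compLabel (C := C) σ r (compOut C S (.hole h i)) =
          compLabel σ r (compIn C S h (.outer i)) := by
        intro h i
        rw [compLabel_out, compLabel_in, innerLabel_of_outer σ r (Setoid.refl' _ _)]
      intro a
      rcases comp_cases C S a with ⟨a, rfl⟩ | ⟨h, a, rfl⟩
      · cases a with
        | hole h i => exact hj h i
        | outer i => rfl
        | cross x i =>
          refine (compLabel_out σ r _).trans (Eq.trans ?_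
            (compLabel_out σ r (C.splice (stateOut σ) (.cross x i))).symm)
          exact congrArg Sum.inl (Quotient.sound (C.strands_splice (stateOut σ) _ (.cross x i)))
        | pt p i =>
          refine (compLabel_out σ r _).trans (Eq.trans ?_
            (compLabel_out σ r (C.splice (stateOut σ) (.pt p i))).symm)
          exact congrArg Sum.inl (Quotient.sound (C.strands_splice (stateOut σ) _ (.pt p i)))
      · cases a with
        | outer i => exact (hj h i).symm
        | hole k i => rfl
        | cross x i =>
          refine (compLabel_in σ r h _).trans (Eq.trans ?_
            (compLabel_in σ r h ((S h).splice (stateIn σ h) (.cross x i))).symm)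
          exact innerLabel_congr σ r ((S h).strands_splice (stateIn σ h) _ (.cross x i))
        | pt p i =>
          refine (compLabel_in σ r h _).trans (Eq.trans ?_
            (compLabel_in σ r h ((S h).splice (stateIn σ h) (.pt p i))).symm)
          exact innerLabel_congr σ r ((S h).strands_splice (stateIn σ h) _ (.pt p i))
    · rintro ⟨h, k⟩ i j hij
      refine (compLabel_in σ r h (.hole k i)).trans
        (Eq.trans ?_ (compLabel_in σ r h (.hole k j)).symm)
      exact innerLabel_congr σ r ((S h).strands_hole _ _ hij)

/-- The partition of the ends of a composite. -/
theorem comp_part : (C.comp S).part σ r = C.part (stateOut σ) (innerPart σ r) := by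
  rw [part_eq_ker (compLabel_eq_iff σ r)]
  ext i j
  change compLabel σ r (compOut C S (.outer i)) = compLabel σ r (compOut C S (.outer j)) ↔ _
  rw [compLabel_out, compLabel_out]
  exact Sum.inl_injective.eq_iff.trans Quotient.eq

/-- The number of closed strands of a composite. -/
theorem comp_closed [Fintype H] : (C.comp S).closed σ r =
    C.closed (stateOut σ) (innerPart σ r) +
      ∑ h, (S h).closed (stateIn σ h) fun k => r ⟨h, k⟩ := by
  rw [closed_eq_card (compLabel_eq_iff σ r) (compLabel_surjective σ r)]
  change Nat.card {q // ∀ i, compLabel σ r (compOut C S (.outer i)) ≠ q} = _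
  simp only [compLabel_out]
  -- Outer ends of the composite are outer ends of `C`, so every label on the right of the sum is a
  -- closed strand.
  have e : {q : Quotient (C.strands (stateOut σ) (innerPart σ r)) ⊕ (Σ h, InnerClosed σ r h) //
      ∀ i, Sum.inl (Quotient.mk _ (Dart.outer i)) ≠ q} ≃
      {c : Quotient (C.strands (stateOut σ) (innerPart σ r)) //
        ∀ i, Quotient.mk _ (Dart.outer i) ≠ c} ⊕ (Σ h, InnerClosed σ r h) :=
    Equiv.subtypeSum.trans (Equiv.sumCongr
      (Equiv.subtypeEquivRight fun c => by simp)
      (Equiv.subtypeUnivEquiv fun c => by simp))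
  rw [Nat.card_congr e, Nat.card_sum, Nat.card_sigma]
  rfl

end comp
end Diagram
end PBT

namespace PBT
namespace Diagram

/-! ### Transport of strands -/

section transport

variable {m₀ : ℕ} {H H' : Type} {m : H → ℕ} {m' : H' → ℕ}
variable {D : Diagram m₀ m} {D' : Diagram m₀ m'} {σ : D.X → Bool} {σ' : D'.X → Bool}
variable {r : ∀ h, Setoid (Fin (2 * m h))} {r' : ∀ h, Setoid (Fin (2 * m' h))}

theorem part_eq_of_map (f : D.Darts → D'.Darts)
    (hf : ∀ a b, D'.strands σ' r' (f a) (f b) ↔ D.strands σ r a b)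
    (ho : ∀ i, f (.outer i) = .outer i) : D.part σ r = D'.part σ' r' := by
  ext i j
  change D.strands σ r _ _ ↔ D'.strands σ' r' _ _
  rw [← hf, ho, ho]

theorem closed_eq_of_map (f : D.Darts → D'.Darts) (hs : Function.Surjective f)
    (hf : ∀ a b, D'.strands σ' r' (f a) (f b) ↔ D.strands σ r a b)
    (ho : ∀ i, f (.outer i) = .outer i) : D.closed σ r = D'.closed σ' r' := by
  rw [closed_eq_card (f := fun a => Quotient.mk (D'.strands σ' r') (f a))
    (fun a b => Quotient.eq.trans (hf a b)) (Quotient.mk_surjective.comp hs)]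
  simp only [ho]
  rfl

theorem strands_iff_of_equiv (φ : D.Darts ≃ D'.Darts)
    (hφ : ∀ a b, D'.strandRel σ' r' (φ a) (φ b) ↔ D.strandRel σ r a b) (a b : D.Darts) :
    D'.strands σ' r' (φ a) (φ b) ↔ D.strands σ r a b := by
  constructor
  · intro h
    have : D'.strands σ' r' ≤ (D.strands σ r).comap φ.symm := by
      refine Setoid.eqvGen_le fun a b hab => ?_
      refine Relation.EqvGen.rel _ _ ((hφ _ _).1 ?_)
      rwa [φ.apply_symm_apply, φ.apply_symm_apply]
    have := this h
    rwa [Setoid.comap_rel, φ.symm_apply_apply, φ.symm_apply_apply] at this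
  · intro h
    have : D.strands σ r ≤ (D'.strands σ' r').comap φ :=
      Setoid.eqvGen_le fun a b hab => Relation.EqvGen.rel _ _ ((hφ _ _).2 hab)
    exact this h

end transport

/-! ### Strands after subdividing an edge -/

section subdivide

variable {m₀ : ℕ} {H : Type} {m : H → ℕ} (D : Diagram m₀ m) (d : D.Darts)

/-- Forgetting the subdivision of an edge. -/
def unsubdivide : (D.subdivide d).Darts → D.Darts
  | .outer i => .outer i
  | .hole h i => .hole h i
  | .cross x i => .cross x i
  | .pt (some p) i => .pt p i
  | .pt none _ => d

/-- The old half-edges after the subdivision of an edge. -/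
def oldDart (a : D.Darts) : (D.subdivide d).Darts := subdivideMap a

theorem subdivide_darts_cases (a : (D.subdivide d).Darts) :
    (∃ b, a = D.oldDart d b) ∨ a = .pt none 0 ∨ a = .pt none 1 :=
  subdivide_cases a

theorem unsubdivide_map (a : D.Darts) : D.unsubdivide d (D.oldDart d a) = a := by
  cases a <;> rfl

theorem subdivide_opp_map (a : D.Darts) :
    (D.subdivide d).opp (D.oldDart d a) = subdivideOpp.old D d a :=
  subdivideOpp_map D d a

variable {D d} (σ : D.X → Bool) (r : ∀ h, Setoid (Fin (2 * m h)))

theorem subdivide_splice_map (a : D.Darts) :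
    (D.subdivide d).splice (show (D.subdivide d).X → Bool from σ) (D.oldDart d a) =
      D.oldDart d (D.splice σ a) := by
  cases a <;> rfl

theorem strands_subdivide_none (i : Fin 2) :
    (D.subdivide d).strands σ r (.pt none i) (D.oldDart d d) := by
  have h0 : (D.subdivide d).strands σ r (.pt none 0) (D.oldDart d d) :=
    (D.subdivide d).strands_opp σ r (.pt none 0)
  fin_cases i
  · exact h0
  · exact strands_trans ((D.subdivide d).strands_splice σ r (.pt none 1)) h0

theorem strands_subdivide_map {a b : D.Darts} (hab : D.strands σ r a b) :
    (D.subdivide d).strands σ r (D.oldDart d a) (D.oldDart d b) := by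
  refine strands_le (((D.subdivide d).strands σ r).comap (D.oldDart d)) ?_ ?_ ?_ hab
  · intro a
    change (D.subdivide d).strands σ r _ _
    have h1 : (D.subdivide d).strands σ r (.pt none 1) (D.oldDart d (D.opp d)) :=
      (D.subdivide d).strands_opp σ r (.pt none 1)
    -- The cut edge is replaced by a path through the new point, so its two old halves remain
    -- connected.
    have hd := strands_trans (strands_symm (strands_subdivide_none (d := d) σ r 1)) h1
    have ho := (D.subdivide d).strands_opp σ r (D.oldDart d a)
    rw [subdivide_opp_map, subdivideOpp.old] at ho
    split_ifs at ho with e1 e2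
    · rwa [e1]
    · rw [e2, D.opp_opp]
      exact strands_symm hd
    · exact ho
  · intro a
    change (D.subdivide d).strands σ r _ _
    have := (D.subdivide d).strands_splice σ r (D.oldDart d a)
    rwa [subdivide_splice_map] at this
  · intro h i j hij
    exact strands_hole (D.subdivide d) σ r hij

theorem strands_unsubdivide (a b : (D.subdivide d).Darts) :
    D.strands σ r (D.unsubdivide d a) (D.unsubdivide d b) ↔ (D.subdivide d).strands σ r a b := by
  constructor
  · have key : ∀ a, (D.subdivide d).strands σ r a (D.oldDart d (D.unsubdivide d a)) := by
      intro a
      rcases D.subdivide_darts_cases d a with ⟨a, rfl⟩ | rfl | rfl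
      · exact (D.unsubdivide_map d a).symm ▸ Setoid.refl' _ _
      · exact strands_subdivide_none σ r 0
      · exact strands_subdivide_none σ r 1
    intro h
    exact strands_trans (strands_trans (key a) (strands_subdivide_map σ r h)) (strands_symm (key b))
  · intro h
    refine strands_le ((D.strands σ r).comap (D.unsubdivide d)) ?_ ?_ ?_ h
    · intro a
      change D.strands σ r _ _
      rcases D.subdivide_darts_cases d a with ⟨a, rfl⟩ | rfl | rfl
      · rw [unsubdivide_map, subdivide_opp_map, subdivideOpp.old]
        split_ifs with e1 e2
        · rw [e1]
          exact Setoid.refl' _ _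
        · rw [e2]
          exact strands_symm (D.strands_opp σ r d)
        · exact (D.unsubdivide_map d (D.opp a)).symm ▸ D.strands_opp σ r a
      · change D.strands σ r d (D.unsubdivide d (D.oldDart d d))
        rw [unsubdivide_map]
      · change D.strands σ r d (D.unsubdivide d (D.oldDart d (D.opp d)))
        rw [unsubdivide_map]
        exact D.strands_opp σ r d
    · intro a
      change D.strands σ r _ _
      rcases D.subdivide_darts_cases d a with ⟨a, rfl⟩ | rfl | rfl
      · have := subdivide_splice_map (d := d) σ a
        rw [this, unsubdivide_map, unsubdivide_map]
        exact D.strands_splice σ r a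
      · exact Setoid.refl' _ _
      · exact Setoid.refl' _ _
    · intro h i j hij
      exact D.strands_hole σ r hij

theorem subdivide_part : (D.subdivide d).part σ r = D.part σ r :=
  part_eq_of_map (D.unsubdivide d) (strands_unsubdivide σ r) fun _ => rfl

theorem subdivide_closed : (D.subdivide d).closed σ r = D.closed σ r :=
  closed_eq_of_map (D.unsubdivide d) (fun a => ⟨D.oldDart d a, D.unsubdivide_map d a⟩)
    (strands_unsubdivide σ r) fun _ => rfl

end subdivide

/-! ### Strands after renaming holes -/

section relabel

variable {m₀ : ℕ} {H H' : Type} {m : H → ℕ} (D : Diagram m₀ m) (e : H' ≃ H)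
variable (σ : D.X → Bool) (r : ∀ h, Setoid (Fin (2 * m h)))

/-- The half-edges of a diagram with renamed holes. -/
def relabelEquiv : (D.relabel e).Darts ≃ D.Darts where
  toFun := relabelTo e
  invFun := relabelFrom e
  left_inv := relabelFrom_to e
  right_inv := relabelTo_from e

theorem relabel_strandRel (a b : (D.relabel e).Darts) :
    D.strandRel σ r (D.relabelEquiv e a) (D.relabelEquiv e b) ↔
      (D.relabel e).strandRel σ (fun h => r (e h)) a b := by
  have hopp : D.relabelEquiv e ((D.relabel e).opp a) = D.opp (D.relabelEquiv e a) :=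
    relabelTo_from e _
  have hsplice : D.relabelEquiv e ((D.relabel e).splice σ a) = D.splice σ (D.relabelEquiv e a) := by
    cases a <;> rfl
  refine or_congr ?_ (or_congr ?_ ?_)
  · rw [← hopp, (D.relabelEquiv e).injective.eq_iff]
  · rw [← hsplice, (D.relabelEquiv e).injective.eq_iff]
  · constructor
    · rintro ⟨h, i, j, ha, hb, hij⟩
      obtain ⟨h, rfl⟩ := e.surjective h
      refine ⟨h, i, j, (D.relabelEquiv e).injective ha, (D.relabelEquiv e).injective hb, hij⟩
    · rintro ⟨h, i, j, rfl, rfl, hij⟩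
      exact ⟨e h, i, j, rfl, rfl, hij⟩

theorem relabel_part : (D.relabel e).part σ (fun h => r (e h)) = D.part σ r :=
  part_eq_of_map (D.relabelEquiv e)
    (strands_iff_of_equiv (D.relabelEquiv e) (D.relabel_strandRel e σ r)) fun _ => rfl

theorem relabel_closed : (D.relabel e).closed σ (fun h => r (e h)) = D.closed σ r :=
  closed_eq_of_map (D.relabelEquiv e) (D.relabelEquiv e).surjective
    (strands_iff_of_equiv (D.relabelEquiv e) (D.relabel_strandRel e σ r)) fun _ => rfl

end relabel

/-! ### Strands of isomorphic diagrams -/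

section iso

variable {m₀ : ℕ} {H : Type} {m : H → ℕ} {D D' : Diagram m₀ m}

/-- A half turn of a crossing preserves each of its two splittings; a quarter turn would exchange
them. -/
theorem pairH_add {s : Fin 4} (hs : s = 0 ∨ s = 2) (i : Fin 4) : pairH (i + s) = pairH i + s := by
  rcases hs with rfl | rfl <;> revert i <;> decide

theorem pairV_add {s : Fin 4} (hs : s = 0 ∨ s = 2) (i : Fin 4) : pairV (i + s) = pairV i + s := by
  rcases hs with rfl | rfl <;> revert i <;> decide

/-- An isomorphism induces a bijection of crossings under which the states have the same strands. -/
theorem Iso.exists_equiv (h : Iso D D') : ∃ e : D.X ≃ D'.X,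
    ∀ (σ : D'.X → Bool) (r : ∀ h, Setoid (Fin (2 * m h))),
      D.part (fun x => σ (e x)) r = D'.part σ r ∧ D.closed (fun x => σ (e x)) r = D'.closed σ r := by
  obtain ⟨φ, hopp, houter, hhole, hcross, hpt⟩ := h
  choose f s hs hf using hcross
  have hfi : Function.Injective f := by
    -- Two crossings with the same image have images differing only by an offset, so some half-edge
    -- of `y` has the same image as half-edge `0` of `x`.
    intro x y hxy
    have h1 : φ (.cross x 0) = φ (.cross y (s x - s y)) := by
      rw [hf, hf, hxy, sub_add_cancel, zero_add]
    exact (Dart.cross.inj (φ.injective h1)).1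
  have hfs : Function.Surjective f := by
    intro x'
    obtain ⟨d, hd⟩ := φ.surjective (.cross x' 0)
    match d with
    | .outer i => rw [houter] at hd; cases hd
    | .hole h i => rw [hhole] at hd; cases hd
    | .cross x i => rw [hf] at hd; exact ⟨x, (Dart.cross.inj hd).1⟩
    | .pt p i =>
      obtain ⟨p', s, h⟩ := hpt p
      rw [h] at hd; cases hd
  refine ⟨Equiv.ofBijective f ⟨hfi, hfs⟩, fun σ r => ?_⟩
  have hsplice : ∀ a, φ (D.splice (fun x => σ (f x)) a) = D'.splice σ (φ a) := by
    rintro (i | ⟨h, i⟩ | ⟨x, i⟩ | ⟨p, i⟩)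
    · simp only [splice, houter]
    · simp only [splice, hhole]
    · simp only [splice, hf]
      split_ifs
      · rw [pairH_add (hs x)]
      · rw [pairV_add (hs x)]
    · obtain ⟨p', s, h⟩ := hpt p
      simp only [splice, h]
      rw [add_right_comm]
  have key := strands_iff_of_equiv (σ := fun x => σ (f x)) (r := r) (σ' := σ) (r' := r) φ (by
    intro a b
    refine or_congr ?_ (or_congr ?_ ?_)
    · rw [← hopp, φ.injective.eq_iff]
    · rw [← hsplice, φ.injective.eq_iff]
    · refine exists_congr fun h => exists_congr fun i => exists_congr fun j => ?_
      rw [← hhole, ← hhole, φ.injective.eq_iff, φ.injective.eq_iff])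
  exact ⟨part_eq_of_map φ key houter, closed_eq_of_map φ φ.surjective key houter⟩

end iso

/-! ### State sums -/

/-- The weight of a state. -/
noncomputable def weight (A : ℂ) {X : Type} (σ : X → Bool) : ℂ :=
  A ^ Nat.card {x // σ x = true} * A⁻¹ ^ Nat.card {x // σ x = false}

theorem weight_eq_prod (A : ℂ) {X : Type} [Fintype X] (σ : X → Bool) :
    weight A σ = ∏ x, if σ x then A else A⁻¹ := by
  rw [weight, Nat.card_eq_fintype_card, Nat.card_eq_fintype_card, Fintype.card_subtype,
    Fintype.card_subtype, Finset.prod_ite, Finset.prod_const, Finset.prod_const]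
  simp

theorem weight_comp_equiv (A : ℂ) {X Y : Type} (e : X ≃ Y) (σ : Y → Bool) :
    weight A (fun x => σ (e x)) = weight A σ := by
  rw [weight, weight,
    Nat.card_congr (e.subtypeEquiv (p := fun x => σ (e x) = true) (q := fun y => σ y = true) fun _ => Iff.rfl),
    Nat.card_congr (e.subtypeEquiv (p := fun x => σ (e x) = false)
      (q := fun y => σ y = false) fun _ => Iff.rfl)]

section val

variable {m₀ : ℕ} {H : Type} {m : H → ℕ}

open Classical in
/-- The coefficient of the partition `p` of the outer ends in the expansion of a diagram into
states, closed strands having the value `δ`. -/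
noncomputable def val (A δ : ℂ) (D : Diagram m₀ m) (r : ∀ h, Setoid (Fin (2 * m h)))
    (p : Setoid (Fin (2 * m₀))) : ℂ :=
  ∑ᶠ σ : D.X → Bool, weight A σ * δ ^ D.closed σ r * if D.part σ r = p then 1 else 0

variable (A δ : ℂ)

theorem Iso.val_eq {D D' : Diagram m₀ m} (h : Iso D D') (r : ∀ h, Setoid (Fin (2 * m h)))
    (p : Setoid (Fin (2 * m₀))) : val A δ D r p = val A δ D' r p := by
  obtain ⟨e, he⟩ := h.exists_equiv
  rw [val, ← finsum_comp_equiv (e.arrowCongr (Equiv.refl Bool)).symm]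
  refine finsum_congr fun σ => ?_
  have h1 : (e.arrowCongr (Equiv.refl Bool)).symm σ = fun x => σ (e x) := rfl
  rw [h1, (he σ r).1, (he σ r).2, weight_comp_equiv]

open Classical in
theorem val_subdivide (D : Diagram m₀ m) (d : D.Darts) (r : ∀ h, Setoid (Fin (2 * m h)))
    (p : Setoid (Fin (2 * m₀))) : val A δ (D.subdivide d) r p = val A δ D r p := by
  exact finsum_congr fun σ => congrArg₂
    (fun (c : ℕ) (s : Setoid _) => weight A σ * δ ^ c * if s = p then (1 : ℂ) else 0)
    (subdivide_closed (D := D) (d := d) σ r) (subdivide_part (D := D) (d := d) σ r)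

open Classical in
theorem val_relabel {H' : Type} (D : Diagram m₀ m) (e : H' ≃ H) (r : ∀ h, Setoid (Fin (2 * m h)))
    (p : Setoid (Fin (2 * m₀))) :
    val A δ (D.relabel e) (fun h => r (e h)) p = val A δ D r p := by
  exact finsum_congr fun σ => congrArg₂
    (fun (c : ℕ) (s : Setoid _) => weight A σ * δ ^ c * if s = p then (1 : ℂ) else 0)
    (relabel_closed D e σ r) (relabel_part D e σ r)

end val

noncomputable instance fintypeSetoid (k : ℕ) : Fintype (Setoid (Fin k)) :=
  have : Finite (Setoid (Fin k)) :=
    Finite.of_injective (fun s : Setoid (Fin k) => (⇑s : Fin k → Fin k → Prop))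
      fun _ _ h => Setoid.ext fun a b => by exact iff_of_eq (congrFun (congrFun h a) b)
  Fintype.ofFinite _

/-! ### State sums of composites -/

section comp

variable {m₀ : ℕ} {H : Type} {m : H → ℕ} {K : H → Type} {μ : (h : H) → K h → ℕ}

/-- The states of a composite are the families of states of its pieces. -/
def compStates (C : Diagram m₀ m) (S : (h : H) → Diagram (m h) (μ h)) :
    ((C.comp S).X → Bool) ≃ (C.X → Bool) × (∀ h, (S h).X → Bool) :=
  (Equiv.sumArrowEquivProdArrow _ _ _).trans
    (Equiv.prodCongr (Equiv.refl _) (Equiv.piCurry fun _ _ => Bool))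

theorem weight_comp [Fintype H] (A : ℂ) (C : Diagram m₀ m) (S : (h : H) → Diagram (m h) (μ h))
    (σ : (C.comp S).X → Bool) :
    weight A σ = weight A (stateOut σ) * ∏ h, weight A (stateIn σ h) := by
  have := C.finite_X
  have := fun h => (S h).finite_X
  let := Fintype.ofFinite C.X
  let := fun h => Fintype.ofFinite (S h).X
  have h1 : weight A σ = ∏ x : C.X ⊕ (Σ h, (S h).X), if σ x then A else A⁻¹ :=
    weight_eq_prod (X := C.X ⊕ (Σ h, (S h).X)) A σ
  rw [h1, Fintype.prod_sum_type, Fintype.prod_sigma, weight_eq_prod]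
  simp only [weight_eq_prod]
  rfl

open Classical in
/-- The expansion of a composite. -/
theorem val_comp [Fintype H] (A δ : ℂ) (C : Diagram m₀ m) (S : (h : H) → Diagram (m h) (μ h))
    (r : (q : Σ h, K h) → Setoid (Fin (2 * μ q.1 q.2))) (p : Setoid (Fin (2 * m₀))) :
    val A δ (C.comp S) r p = ∑ q : (h : H) → Setoid (Fin (2 * m h)),
      (∏ h, val A δ (S h) (fun k => r ⟨h, k⟩) (q h)) * val A δ C q p := by
  have := C.finite_X
  have := fun h => (S h).finite_X
  let := Fintype.ofFinite C.X
  let := fun h => Fintype.ofFinite (S h).X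
  have hL : val A δ (C.comp S) r p = ∑ τ : ∀ h, (S h).X → Bool, ∑ σ : C.X → Bool,
      (∏ h, weight A (τ h) * δ ^ (S h).closed (τ h) fun k => r ⟨h, k⟩) *
      (weight A σ * δ ^ C.closed σ (fun h => (S h).part (τ h) fun k => r ⟨h, k⟩) *
        if C.part σ (fun h => (S h).part (τ h) fun k => r ⟨h, k⟩) = p then 1 else 0) := by
    rw [val, ← finsum_comp_equiv (compStates C S).symm, finsum_eq_sum_of_fintype,
      Fintype.sum_prod_type]
    refine Finset.sum_comm.trans ?_
    refine Finset.sum_congr rfl fun τ _ => Finset.sum_congr rfl fun σ _ => ?_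
    rw [weight_comp, comp_closed, comp_part, pow_add, Finset.prod_mul_distrib,
      Finset.prod_pow_eq_pow_sum]
    change weight A σ * _ * (δ ^ C.closed σ (fun h => (S h).part (τ h) fun k => r ⟨h, k⟩) *
      δ ^ (∑ h, (S h).closed (τ h) fun k => r ⟨h, k⟩)) * (if C.part σ (fun h => (S h).part (τ h)
        fun k => r ⟨h, k⟩) = p then 1 else 0) = _
    change weight A σ * (∏ h, weight A (τ h)) * _ * _ = _
    ring
  -- Expanding the product of sums gives one term for each family of inner states, with the
  -- indicator that the family induces `q`. Exactly one `q` then survives per family in the outer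
  -- sum.
  have hR : ∀ q : (h : H) → Setoid (Fin (2 * m h)),
      (∏ h, val A δ (S h) (fun k => r ⟨h, k⟩) (q h)) =
      ∑ τ : ∀ h, (S h).X → Bool, (∏ h, weight A (τ h) * δ ^ (S h).closed (τ h) fun k => r ⟨h, k⟩) *
        if (fun h => (S h).part (τ h) fun k => r ⟨h, k⟩) = q then 1 else 0 := by
    intro q
    simp only [val, finsum_eq_sum_of_fintype]
    rw [Finset.prod_univ_sum]
    simp only [Fintype.piFinset_univ]
    refine Finset.sum_congr rfl fun τ _ => ?_
    rw [Finset.prod_mul_distrib]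
    congr 1
    rw [Finset.prod_ite_zero]
    simp [funext_iff]
  rw [hL]
  simp only [hR, Finset.sum_mul]
  refine Eq.trans ?_ Finset.sum_comm
  refine Finset.sum_congr rfl fun τ _ => ?_
  simp only [mul_ite, mul_one, mul_zero, ite_mul, zero_mul]
  rw [Finset.sum_ite_eq]
  simp only [Finset.mem_univ, if_true]
  rw [val, finsum_eq_sum_of_fintype, Finset.mul_sum]
  simp

end comp

end Diagram
end PBT

namespace PBT

/-! ### Connected components by merging labels -/

/-- Identification of the labels at the positions `e.1` and `e.2`. -/
def mergeLabels (t : List ℕ) (e : ℕ × ℕ) : List ℕ :=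
  if t.getD e.1 0 = t.getD e.2 0 then t
  else t.map fun w => if w = t.getD e.1 0 then t.getD e.2 0 else w

theorem mergeLabels_length (t : List ℕ) (e : ℕ × ℕ) : (mergeLabels t e).length = t.length := by
  unfold mergeLabels
  split_ifs <;> simp

theorem mergeLabels_getD (t : List ℕ) (e : ℕ × ℕ) {i : ℕ} (hi : i < t.length) :
    (mergeLabels t e).getD i 0 =
      if t.getD i 0 = t.getD e.1 0 then t.getD e.2 0 else t.getD i 0 := by
  unfold mergeLabels
  split_ifs with h1 h2 h2
  · rw [h2, h1]
  · rfl
  all_goals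
    rw [List.getD_eq_getElem _ _ hi] at h2
    rw [List.getD_eq_getElem _ _ (by rwa [List.length_map]), List.getElem_map]
    simp only [h2, if_true, if_false, List.getD_eq_getElem _ _ hi]

theorem foldl_mergeLabels_length (l : List (ℕ × ℕ)) (t : List ℕ) :
    (l.foldl mergeLabels t).length = t.length := by
  induction l generalizing t with
  | nil => rfl
  | cons e l ih => rw [List.foldl_cons, ih, mergeLabels_length]

/-- Equal labels stay equal. -/
theorem foldl_mergeLabels_congr (l : List (ℕ × ℕ)) (t : List ℕ) {i j : ℕ} (hi : i < t.length)
    (hj : j < t.length) (hij : t.getD i 0 = t.getD j 0) :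
    (l.foldl mergeLabels t).getD i 0 = (l.foldl mergeLabels t).getD j 0 := by
  induction l generalizing t with
  | nil => exact hij
  | cons e l ih =>
    rw [List.foldl_cons]
    refine ih _ (by rwa [mergeLabels_length]) (by rwa [mergeLabels_length]) ?_
    rw [mergeLabels_getD t e hi, mergeLabels_getD t e hj, hij]

/-- The labels at the positions to be identified become equal. -/
theorem foldl_mergeLabels_of_mem {l : List (ℕ × ℕ)} (t : List ℕ) {i j : ℕ} (hi : i < t.length)
    (hj : j < t.length) (hij : (i, j) ∈ l) :
    (l.foldl mergeLabels t).getD i 0 = (l.foldl mergeLabels t).getD j 0 := by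
  induction l generalizing t with
  | nil => simp at hij
  | cons e l ih =>
    rw [List.foldl_cons]
    rcases List.mem_cons.1 hij with rfl | hij
    · refine foldl_mergeLabels_congr l _ (by rwa [mergeLabels_length])
        (by rwa [mergeLabels_length]) ?_
      rw [mergeLabels_getD t _ hi, mergeLabels_getD t _ hj]
      simp
    · exact ih _ (by rwa [mergeLabels_length]) (by rwa [mergeLabels_length]) hij

/-- Only labels at connected positions become equal. -/
theorem foldl_mergeLabels_le {Δ : Type*} (s : Setoid Δ) (idx : Δ → ℕ) (l : List (Δ × Δ))
    (hl : ∀ e ∈ l, s e.1 e.2) (t : List ℕ) (ht : ∀ a, idx a < t.length)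
    (hs : ∀ a b, t.getD (idx a) 0 = t.getD (idx b) 0 → s a b) (a b : Δ)
    (hab : ((l.map fun e => (idx e.1, idx e.2)).foldl mergeLabels t).getD (idx a) 0 =
      ((l.map fun e => (idx e.1, idx e.2)).foldl mergeLabels t).getD (idx b) 0) : s a b := by
  induction l generalizing t with
  | nil => exact hs a b hab
  | cons e l ih =>
    rw [List.map_cons, List.foldl_cons] at hab
    refine ih (fun e he => hl e (List.mem_cons_of_mem _ he)) _
      (fun a => by rw [mergeLabels_length]; exact ht a) ?_ hab
    intro a b h
    have he : s e.1 e.2 := hl e (List.mem_cons_self ..)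
    rw [mergeLabels_getD t _ (ht a), mergeLabels_getD t _ (ht b)] at h
    -- Labels equal after the merge were equal before it, or were brought together across `e`, whose
    -- two ends are related.
    split_ifs at h with h1 h2 h2
    · exact hs _ _ (h1.trans h2.symm)
    · exact s.trans' (s.trans' (hs _ _ h1) he) (hs _ _ h)
    · exact s.trans' (hs _ _ h) (s.symm' (s.trans' (hs _ _ h2) he))
    · exact hs _ _ h

/-! ### The eighth root of unity -/

/-- The value `e^{iπ/4}` of the variable of the bracket. -/
noncomputable def root8 : ℂ := Complex.exp (Complex.I * Real.pi / 4)

theorem root8_sq : root8 ^ 2 = Complex.I := by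
  rw [root8, ← Complex.exp_nat_mul]
  rw [show ((2 : ℕ) : ℂ) * (Complex.I * Real.pi / 4) = Real.pi / 2 * Complex.I by push_cast; ring]
  exact Complex.exp_pi_div_two_mul_I

theorem root8_pow_four : root8 ^ 4 = -1 := by
  rw [show root8 ^ 4 = (root8 ^ 2) ^ 2 by ring, root8_sq, Complex.I_sq]

theorem root8_ne_zero : root8 ≠ 0 := Complex.exp_ne_zero _

theorem root8_inv : root8⁻¹ = root8 ^ 7 := by
  refine inv_eq_of_mul_eq_one_right ?_
  rw [show root8 * root8 ^ 7 = (root8 ^ 4) ^ 2 by ring, root8_pow_four]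
  norm_num

/-- From `A⁴ = -1` follows `A⁻² = -A²`. This vanishing of the loop value removes all states with
closed strands. -/
theorem root8_delta : -root8 ^ 2 - root8⁻¹ ^ 2 = 0 := by
  rw [root8_inv, show -root8 ^ 2 - (root8 ^ 7) ^ 2 = -root8 ^ 2 * (1 + (root8 ^ 4) ^ 3) by ring,
    root8_pow_four]
  norm_num

theorem root8_pow (k : ℕ) : root8 ^ k = (-1) ^ (k / 4) * root8 ^ (k % 4) := by
  rw [← root8_pow_four, ← pow_mul, ← pow_add, Nat.div_add_mod]

/-- The coefficient of `root8 ^ j`, `j < 4`, at the code `c` in a sum of powers of `root8` with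
coded factors. -/
def termCoeff (l : List (ℕ × List ℕ)) (c : List ℕ) (j : ℕ) : ℤ :=
  (l.map fun t => if t.2 = c ∧ t.1 % 4 = j then (-1) ^ (t.1 / 4) else 0).sum

/-- As `A⁴ = -1`, each power of `A` is up to sign one with exponent below `4`. Collecting terms by
code and reduced exponent leaves integer coefficients, whose agreement suffices for equality of two
sums and can be decided by evaluation. -/
theorem sum_terms (G : List ℕ → ℂ) (l : List (ℕ × List ℕ)) (s : Finset (List ℕ))
    (hs : ∀ t ∈ l, t.2 ∈ s) : (l.map fun t => root8 ^ t.1 * G t.2).sum =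
      ∑ c ∈ s, ∑ j ∈ Finset.range 4, (termCoeff l c j : ℂ) * root8 ^ j * G c := by
  induction l with
  | nil => simp [termCoeff]
  | cons t l ih =>
    rw [List.map_cons, List.sum_cons, ih fun t ht => hs t (List.mem_cons_of_mem _ ht)]
    have hc : ∀ c j, (termCoeff (t :: l) c j : ℂ) =
        (if t.2 = c then if t.1 % 4 = j then (-1) ^ (t.1 / 4) else 0 else 0) + termCoeff l c j := by
      intro c j
      simp only [termCoeff, List.map_cons, List.sum_cons, ite_and]
      push_cast
      rfl
    simp only [hc, add_mul, Finset.sum_add_distrib]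
    congr 1
    simp only [ite_mul, zero_mul]
    have h1 : ∀ c, (∑ j ∈ Finset.range 4, if t.2 = c then
        if t.1 % 4 = j then (-1) ^ (t.1 / 4) * root8 ^ j * G c else 0 else 0) =
        if t.2 = c then root8 ^ t.1 * G c else 0 := by
      intro c
      split_ifs with h
      · rw [Finset.sum_ite_eq, if_pos (Finset.mem_range.2 (Nat.mod_lt _ (by norm_num))),
          root8_pow t.1]
      · simp
    rw [Finset.sum_congr rfl fun c _ => h1 c, Finset.sum_ite_eq, if_pos (hs t (List.mem_cons_self ..))]

/-- Comparison of two sums of powers of `root8` with coded factors. -/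
theorem sum_terms_eq (G : List ℕ → ℂ) (l l' : List (ℕ × List ℕ))
    (h : ∀ c ∈ (l ++ l').map Prod.snd, ∀ j < 4, termCoeff l c j = termCoeff l' c j) :
    (l.map fun t => root8 ^ t.1 * G t.2).sum = (l'.map fun t => root8 ^ t.1 * G t.2).sum := by
  rw [sum_terms G l ((l ++ l').map Prod.snd).toFinset,
    sum_terms G l' ((l ++ l').map Prod.snd).toFinset]
  · refine Finset.sum_congr rfl fun c hc => Finset.sum_congr rfl fun j hj => ?_
    rw [h c (List.mem_toFinset.1 hc) j (Finset.mem_range.1 hj)]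
  · intro t ht
    exact List.mem_toFinset.2 (List.mem_map_of_mem (List.mem_append_right _ ht))
  · intro t ht
    exact List.mem_toFinset.2 (List.mem_map_of_mem (List.mem_append_left _ ht))

namespace Diagram

/-! ### Computation of state sums -/

/-- The flat pairing of four ends as in the fundamental tangle `k`. -/
def flatPair (k : Fin 2) : Fin 4 → Fin 4 := if k = 0 then pairV else pairH

theorem flatPair_flatPair : ∀ (k : Fin 2) (i : Fin 4), flatPair k (flatPair k i) = i := by decide

/-- The partition of four ends given by the fundamental tangle `k`. -/
def flat (k : Fin 2) : Setoid (Fin 4) where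
  r i j := j = i ∨ j = flatPair k i
  iseqv :=
    { refl := fun _ => .inl rfl
      symm := by revert k; decide
      trans := by revert k; decide }

theorem flat_iff (k : Fin 2) (i j : Fin 4) : flat k i j ↔ j = i ∨ j = flatPair k i := Iff.rfl

theorem flat_injective : Function.Injective flat := by
  intro k l h
  have h0 : flat l 0 (flatPair k 0) := h ▸ (flat_iff k 0 _).2 (.inr rfl)
  rw [flat_iff] at h0
  clear h
  revert k l
  decide

section compute

variable {m₀ n N : ℕ} (D : Diagram m₀ (fun _ : Fin n => 2)) (e : D.X ≃ Fin N)

/-- Numbering of the half-edges of a diagram without auxiliary points. -/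
def dartIndex : D.Darts → ℕ
  | .outer i => i
  | .hole h i => 2 * m₀ + (4 * h + i)
  | .cross x i => 2 * m₀ + (4 * n + (4 * e x + i))
  | .pt _ _ => 0

/-- The list of the half-edges of a diagram without auxiliary points. -/
def dartList : List D.Darts :=
  (List.finRange (2 * m₀)).map .outer ++
    ((List.finRange n).flatMap (fun h => (List.finRange 4).map fun i => .hole h i) ++
      (List.finRange N).flatMap fun x => (List.finRange 4).map fun i => .cross (e.symm x) i)

/-- The strand of a half-edge, passing through the holes according to `hc`. -/
def spliceFlat (σ : D.X → Bool) (hc : Fin n → Fin 2) : D.Darts → D.Darts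
  | .hole h i => .hole h (flatPair (hc h) i)
  | d => D.splice σ d

/-- The pairs of half-edges to be identified for a state. -/
def dartPairs (σ : D.X → Bool) (hc : Fin n → Fin 2) : List (D.Darts × D.Darts) :=
  (dartList D e).flatMap fun d => [(d, D.opp d), (d, spliceFlat D σ hc d)]

/-- Labels of the half-edges by strands of a state. -/
def stateLabels (σ : D.X → Bool) (hc : Fin n → Fin 2) : List ℕ :=
  ((dartPairs D e σ hc).map fun q => (dartIndex D e q.1, dartIndex D e q.2)).foldl mergeLabels
    (List.range (2 * m₀ + (4 * n + 4 * N)))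

/-- Labels of the outer ends by strands of a state. -/
def outerLabels (σ : D.X → Bool) (hc : Fin n → Fin 2) : List ℕ :=
  (stateLabels D e σ hc).take (2 * m₀)

/-- Every strand of a state has an outer end. -/
def noneClosed (σ : D.X → Bool) (hc : Fin n → Fin 2) : Bool :=
  (dartList D e).all fun d =>
    (stateLabels D e σ hc).getD (dartIndex D e d) 0 ∈ outerLabels D e σ hc

/-- All states. -/
def allStates : (N : ℕ) → List (Fin N → Bool)
  | 0 => [Fin.elim0]
  | N + 1 => (allStates N).map (Fin.cons true) ++ (allStates N).map (Fin.cons false)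

theorem sum_allStates (N : ℕ) (f : (Fin N → Bool) → ℂ) :
    ∑ σ, f σ = ((allStates N).map f).sum := by
  induction N with
  | zero =>
    rw [Fintype.sum_unique]
    simp only [allStates, List.map_cons, List.map_nil, List.sum_cons, List.sum_nil, add_zero]
    congr 1
  | succ N ih =>
    rw [← (Fin.consEquiv fun _ => Bool).sum_comp, Fintype.sum_prod_type, Fintype.sum_bool,
      allStates, List.map_append, List.sum_append, List.map_map, List.map_map, ih, ih]
    rfl

/-- The terms of a state sum with `δ = 0`: exponents of `root8` and coded partitions of the
outer ends. -/
def stateTerms (hc : Fin n → Fin 2) : List (ℕ × List ℕ) :=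
  ((allStates N).filter fun σ => noneClosed D e (fun x => σ (e x)) hc).map fun σ =>
    (((List.finRange N).map fun x => if σ x then 1 else 7).sum,
      (outerLabels D e (fun x => σ (e x)) hc).map fun w =>
        (outerLabels D e (fun x => σ (e x)) hc).idxOf w)

variable {D e}

/-- The numbering of half-edges starts with the outer ends, so their labels are the initial segment.
-/
theorem outerLabels_eq (σ : D.X → Bool) (hc : Fin n → Fin 2) :
    outerLabels D e σ hc = (List.finRange (2 * m₀)).map fun i =>
      (stateLabels D e σ hc).getD (dartIndex D e (.outer i)) 0 := by
  have hl : (stateLabels D e σ hc).length = 2 * m₀ + (4 * n + 4 * N) := by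
    rw [stateLabels, foldl_mergeLabels_length, List.length_range]
  refine List.ext_getElem (by simp [outerLabels, hl]) fun i h1 h2 => ?_
  rw [List.length_map, List.length_finRange] at h2
  simp only [outerLabels, List.getElem_take, List.getElem_map, List.getElem_finRange]
  exact (List.getD_eq_getElem _ _ (by omega)).symm

variable [IsEmpty D.P]

theorem dartIndex_lt (a : D.Darts) : dartIndex D e a < 2 * m₀ + (4 * n + 4 * N) := by
  rcases a with i | ⟨h, i⟩ | ⟨x, i⟩ | ⟨p, i⟩
  · simp only [dartIndex]; omega
  · simp only [dartIndex]; omega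
  · simp only [dartIndex]; omega
  · exact isEmptyElim p

theorem dartIndex_injective : Function.Injective (dartIndex D e) := by
  rintro (i | ⟨h, i⟩ | ⟨x, i⟩ | ⟨p, i⟩) (j | ⟨k, j⟩ | ⟨y, j⟩ | ⟨q, j⟩) hab
  all_goals first | exact isEmptyElim p | exact isEmptyElim q | skip
  all_goals simp only [dartIndex] at hab
  · exact congrArg _ (by omega)
  · omega
  · omega
  · omega
  · obtain rfl : h = k := by omega
    obtain rfl : i = j := by omega
    rfl
  · omega
  · omega
  · omega
  · obtain rfl : x = y := e.injective (by omega)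
    obtain rfl : i = j := by omega
    rfl

theorem mem_dartList (a : D.Darts) : a ∈ dartList D e := by
  rcases a with i | ⟨h, i⟩ | ⟨x, i⟩ | ⟨p, i⟩
  · simp [dartList]
  · simp [dartList]
  · simpa [dartList] using ⟨e x, by simp⟩
  · exact isEmptyElim p

/-- Initially all labels are distinct and only half-edges related by a step are merged; conversely
every step along a strand is among the merged pairs. A hole with a flat pairing contributes a single
involution, so a finite list of pairs suffices. -/
theorem stateLabels_eq_iff (σ : D.X → Bool) (hc : Fin n → Fin 2) (a b : D.Darts) :
    (stateLabels D e σ hc).getD (dartIndex D e a) 0 =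
      (stateLabels D e σ hc).getD (dartIndex D e b) 0 ↔
    D.strands σ (fun h => flat (hc h)) a b := by
  have hlen : ∀ a, dartIndex D e a < (List.range (2 * m₀ + (4 * n + 4 * N))).length :=
    fun a => by rw [List.length_range]; exact dartIndex_lt a
  constructor
  · refine foldl_mergeLabels_le _ _ _ ?_ _ hlen ?_ a b
    · intro q hq
      obtain ⟨d, -, hd⟩ := List.mem_flatMap.1 hq
      rw [List.mem_cons, List.mem_singleton] at hd
      rcases hd with rfl | rfl
      · exact D.strands_opp _ _ d
      · cases d with
        | hole h i => exact D.strands_hole _ _ (.inr rfl)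
        | _ => exact D.strands_splice _ _ _
    · intro a b hab
      rw [List.getD_eq_getElem _ _ (hlen a), List.getD_eq_getElem _ _ (hlen b), List.getElem_range,
        List.getElem_range] at hab
      rw [dartIndex_injective hab]
  · have key : ∀ a, ∀ b ∈ [D.opp a, spliceFlat D σ hc a],
        (stateLabels D e σ hc).getD (dartIndex D e a) 0 =
          (stateLabels D e σ hc).getD (dartIndex D e b) 0 := by
      intro a b hb
      refine foldl_mergeLabels_of_mem _ (hlen a) (hlen b) ?_
      refine List.mem_map.2 ⟨(a, b), List.mem_flatMap.2 ⟨a, mem_dartList a, ?_⟩, rfl⟩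
      simpa using hb
    intro hab
    refine strands_apply_eq (fun a => (stateLabels D e σ hc).getD (dartIndex D e a) 0)
      (fun a => key a _ (by simp)) ?_ ?_ hab
    · intro a
      cases a with
      | hole h i => rfl
      | _ => exact key _ _ (by simp [spliceFlat])
    · rintro h i j (rfl | rfl)
      · rfl
      · exact key (.hole h i) _ (by simp [spliceFlat])

theorem noneClosed_iff (σ : D.X → Bool) (hc : Fin n → Fin 2) :
    noneClosed D e σ hc = true ↔ D.closed σ (fun h => flat (hc h)) = 0 := by
  rw [closed, Nat.card_eq_zero, or_iff_left (not_infinite_iff_finite.2 inferInstance),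
    isEmpty_subtype, noneClosed, List.all_eq_true, outerLabels_eq]
  simp only [decide_eq_true_eq, List.mem_map, List.mem_finRange, true_and, stateLabels_eq_iff,
    not_forall, not_not]
  constructor
  · rintro h ⟨a⟩
    obtain ⟨i, hi⟩ := h a (mem_dartList a)
    exact ⟨i, Quotient.sound hi⟩
  · intro h a _
    obtain ⟨i, hi⟩ := h (Quotient.mk _ a)
    exact ⟨i, Quotient.exact hi⟩

/-- The partition with a given code. -/
def codePart (k : ℕ) (c : List ℕ) : Setoid (Fin k) := Setoid.ker fun i => c.getD i 0

/-- Replacing a label by the position of its first occurrence keeps the partition and makes the code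
canonical, so terms of different diagrams can be matched by equality of codes. -/
theorem codePart_eq (σ : D.X → Bool) (hc : Fin n → Fin 2) :
    codePart (2 * m₀) ((outerLabels D e σ hc).map fun w => (outerLabels D e σ hc).idxOf w) =
      D.part σ fun h => flat (hc h) := by
  ext i j
  change _ ↔ D.strands _ _ _ _
  rw [← stateLabels_eq_iff (e := e), codePart, Setoid.ker_def]
  have hl : (outerLabels D e σ hc).length = 2 * m₀ := by simp [outerLabels_eq]
  rw [List.getD_eq_getElem _ _ (by simp [hl]), List.getD_eq_getElem _ _ (by simp [hl]),
    List.getElem_map, List.getElem_map, List.idxOf_inj (List.getElem_mem _)]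
  simp only [outerLabels_eq, List.getElem_map, List.getElem_finRange]
  rfl

open Classical in
/-- Computation of state sums with `δ = 0`. -/
theorem val_eq_sum_terms (hc : Fin n → Fin 2) (p : Setoid (Fin (2 * m₀))) :
    val root8 0 D (fun h => flat (hc h)) p = ((stateTerms D e hc).map fun t =>
      root8 ^ t.1 * if codePart (2 * m₀) t.2 = p then 1 else 0).sum := by
  -- A B-splitting contributes `A⁻¹ = A⁷`, whence the exponent `7`.
  have hw : ∀ σ : Fin N → Bool, weight root8 (fun x => σ (e x)) =
      root8 ^ ((List.finRange N).map fun x => if σ x then 1 else 7).sum := by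
    intro σ
    rw [weight_comp_equiv, weight_eq_prod, ← Fin.sum_univ_def, ← Finset.prod_pow_eq_pow_sum]
    refine Finset.prod_congr rfl fun x _ => ?_
    split_ifs
    · rw [pow_one]
    · exact root8_inv
  rw [val, ← finsum_comp_equiv (e.arrowCongr (Equiv.refl Bool)).symm, finsum_eq_sum_of_fintype,
    sum_allStates, stateTerms, List.map_map]
  have hf : ∀ (l : List (Fin N → Bool)) (q : (Fin N → Bool) → Bool) (f : (Fin N → Bool) → ℂ),
      ((l.filter q).map f).sum = (l.map fun σ => if q σ then f σ else 0).sum := by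
    intro l q f
    induction l with
    | nil => rfl
    | cons a l ih =>
      by_cases h : q a <;> simp [h, ih]
  rw [hf]
  congr 1
  refine List.map_congr_left fun σ _ => ?_
  have h1 : (e.arrowCongr (Equiv.refl Bool)).symm σ = fun x => σ (e x) := rfl
  simp only [h1, Function.comp, codePart_eq, hw]
  -- A state without closed strands has factor `0 ^ 0 = 1`; every other state vanishes.
  by_cases h2 : noneClosed D e (fun x => σ (e x)) hc = true
  · rw [if_pos h2, (noneClosed_iff _ hc).1 h2, pow_zero, mul_one]
  · rw [if_neg h2, zero_pow (mt (noneClosed_iff _ hc).2 h2), mul_zero, zero_mul]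

end compute

end Diagram
end PBT

namespace PBT
namespace Diagram

/-! ### Invariance of state sums -/

theorem root8_pow_eight : root8 ^ 8 = 1 := by
  rw [show root8 ^ 8 = (root8 ^ 4) ^ 2 by ring, root8_pow_four]
  norm_num

section moves

variable {m₀ n N N' : ℕ} {D D' : Diagram m₀ (fun _ : Fin n => 2)}

/-- Agreement of two state sums up to the factor `root8 ^ u`, in computable form. -/
def termsAgree (u : ℕ) (l l' : List (ℕ × List ℕ)) : Bool :=
  ((l ++ l').map Prod.snd).all fun c => (List.range 4).all fun j =>
    termCoeff l c j = termCoeff (l'.map fun t => (t.1 + u, t.2)) c j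

/-- The factor `root8 ^ u` shifts every exponent on the right by `u`, which turns the identity into
a comparison of integer coefficients. -/
theorem val_eq_of_termsAgree (e : D.X ≃ Fin N) (e' : D'.X ≃ Fin N') [IsEmpty D.P] [IsEmpty D'.P]
    (hc : Fin n → Fin 2) (u : ℕ)
    (h : termsAgree u (stateTerms D e hc) (stateTerms D' e' hc) = true)
    (p : Setoid (Fin (2 * m₀))) :
    val root8 0 D (fun h => flat (hc h)) p =
      root8 ^ u * val root8 0 D' (fun h => flat (hc h)) p := by
  classical
  rw [val_eq_sum_terms (e := e), val_eq_sum_terms (e := e'), ← List.sum_map_mul_left,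
    sum_terms_eq (fun c => if codePart (2 * m₀) c = p then 1 else 0) _
      ((stateTerms D' e' hc).map fun t => (t.1 + u, t.2)), List.map_map]
  · congr 1
    refine List.map_congr_left fun t _ => ?_
    simp only [Function.comp, pow_add]
    ring
  · intro c hc j hj
    rw [termsAgree, List.all_eq_true] at h
    have := h c (by simpa using hc)
    rw [List.all_eq_true] at this
    simpa using this j (List.mem_range.2 hj)

end moves

instance : IsEmpty strand.P := inferInstanceAs (IsEmpty Empty)
instance (s : Fin 4) (t : Fin 2) : IsEmpty (kink s t).P := inferInstanceAs (IsEmpty Empty)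
instance (k : Fin 2) : IsEmpty (fundamental k).P := inferInstanceAs (IsEmpty Empty)
instance : IsEmpty bigon.P := inferInstanceAs (IsEmpty Empty)
instance (s : Fin 2) : IsEmpty (triangle s).P := inferInstanceAs (IsEmpty Empty)
instance (s : Fin 2) : IsEmpty (triangle' s).P := inferInstanceAs (IsEmpty Empty)
instance : IsEmpty arcBeside.P := inferInstanceAs (IsEmpty Empty)
instance (s : Fin 2) : IsEmpty (arcAround s).P := inferInstanceAs (IsEmpty Empty)

/-- The trivial numbering of the crossings of a diagram without crossings. -/
def emptyEquiv : Empty ≃ Fin 0 := Equiv.equivOfIsEmpty _ _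

/-- The trivial numbering of the crossings of a diagram with one crossing. -/
def unitEquiv : Unit ≃ Fin 1 := Equiv.ofUnique _ _

/-- One splitting of a kink cuts off a circle and vanishes; the other restores the strand with
weight `A` or `A⁻¹`, according to `s`. The exponent `7` or `1` undoes this weight. -/
theorem termsAgree_moveI : ∀ (s : Fin 4) (t : Fin 2),
    termsAgree (if s = 0 ∨ s = 2 then 7 else 1) (stateTerms strand emptyEquiv Fin.elim0)
      (stateTerms (kink s t) unitEquiv Fin.elim0) = true := by
  decide +kernel

/-- Of the four states, one has a closed circle and vanishes, one restores the uncrossed strands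
with weight `1`, and the other two, with weights `A²` and `A⁻²` and the same connection of the ends,
cancel. -/
theorem termsAgree_moveII :
    termsAgree 0 (stateTerms (fundamental 0) emptyEquiv Fin.elim0)
      (stateTerms bigon (Equiv.refl (Fin 2)) Fin.elim0) = true := by
  decide +kernel

theorem termsAgree_moveIII : ∀ s : Fin 2,
    termsAgree 0 (stateTerms (triangle s) (Equiv.refl (Fin 3)) Fin.elim0)
      (stateTerms (triangle' s) (Equiv.refl (Fin 3)) Fin.elim0) = true := by
  decide +kernel

/-- A hole enters only through the partition of its ends, so the two flat pairings are tested one by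
one. -/
theorem termsAgree_moveIV : ∀ s k : Fin 2,
    termsAgree 0 (stateTerms arcBeside emptyEquiv fun _ => k)
      (stateTerms (arcAround s) (Equiv.refl (Fin 4)) fun _ => k) = true := by
  decide +kernel

theorem val_moveI (s : Fin 4) (t : Fin 2) (hc : Fin 0 → Fin 2) (p : Setoid (Fin (2 * 1))) :
    val root8 0 strand (fun h => flat (hc h)) p = root8 ^ (if s = 0 ∨ s = 2 then 7 else 1) *
      val root8 0 (kink s t) (fun h => flat (hc h)) p := by
  rw [Subsingleton.elim hc Fin.elim0]
  refine val_eq_of_termsAgree (D := strand) (D' := kink s t) (N := 0) (N' := 1) emptyEquiv unitEquiv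
    _ _ ?_ p
  exact termsAgree_moveI s t

theorem val_moveII (hc : Fin 0 → Fin 2) (p : Setoid (Fin (2 * 2))) :
    val root8 0 (fundamental 0) (fun h => flat (hc h)) p =
      root8 ^ 0 * val root8 0 bigon (fun h => flat (hc h)) p := by
  rw [Subsingleton.elim hc Fin.elim0]
  refine val_eq_of_termsAgree (D := fundamental 0) (D' := bigon) (N := 0) (N' := 2) emptyEquiv
    (Equiv.refl (Fin 2)) _ _ ?_ p
  exact termsAgree_moveII

theorem val_moveIII (s : Fin 2) (hc : Fin 0 → Fin 2) (p : Setoid (Fin (2 * 3))) :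
    val root8 0 (triangle s) (fun h => flat (hc h)) p =
      root8 ^ 0 * val root8 0 (triangle' s) (fun h => flat (hc h)) p := by
  rw [Subsingleton.elim hc Fin.elim0]
  refine val_eq_of_termsAgree (D := triangle s) (D' := triangle' s) (N := 3) (N' := 3)
    (Equiv.refl (Fin 3)) (Equiv.refl (Fin 3)) _ _ ?_ p
  exact termsAgree_moveIII s

theorem val_moveIV (s k : Fin 2) (p : Setoid (Fin (2 * 3))) :
    val root8 0 arcBeside (fun _ => flat k) p =
      root8 ^ 0 * val root8 0 (arcAround s) (fun _ => flat k) p := by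
  refine val_eq_of_termsAgree (D := arcBeside) (D' := arcAround s) (N := 0) (N' := 4) emptyEquiv
    (Equiv.refl (Fin 4)) (fun _ => k) _ ?_ p
  exact termsAgree_moveIV s k

/-- A partition of the ends of a hole is admissible unless the hole has four ends and the partition
is not given by a fundamental tangle. -/
def IsFlat : (k : ℕ) → Setoid (Fin (2 * k)) → Prop
  | 2, s => ∃ k, s = flat k
  | _, _ => True

/-- The state sums of isotopic diagrams agree up to an eighth root of unity. -/
theorem Isotopic.exists_val_eq {m₀ : ℕ} {H : Type} {m : H → ℕ} {D D' : Diagram m₀ m}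
    (h : Isotopic D D') : ∃ u : ℕ, ∀ r : (h : H) → Setoid (Fin (2 * m h)),
      (∀ h, IsFlat (m h) (r h)) → ∀ p, val root8 0 D r p = root8 ^ u * val root8 0 D' r p := by
  have hr : ∀ r : (h : Fin 0) → Setoid (Fin (2 * 2)), r = fun h => flat (Fin.elim0 h) :=
    fun r => funext fun h => h.elim0
  induction h with
  | iso _ h => exact ⟨0, fun r _ p => by rw [h.val_eq, pow_zero, one_mul]⟩
  | subdivide D d _ => exact ⟨0, fun r _ p => by rw [val_subdivide, pow_zero, one_mul]⟩
  | moveI s t => exact ⟨_, fun r _ p => hr r ▸ val_moveI s t _ p⟩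
  | moveII => exact ⟨_, fun r _ p => hr r ▸ val_moveII _ p⟩
  | moveIII s => exact ⟨_, fun r _ p => hr r ▸ val_moveIII s _ p⟩
  | moveIV s =>
    refine ⟨0, fun r hr p => ?_⟩
    -- This is the base case that needs admissibility: the move is verified for flat pairings in the
    -- hole only.
    obtain ⟨k, hk⟩ : ∃ k, r 0 = flat k := hr 0
    have hk : r = fun _ => flat k := funext fun h => by rw [Subsingleton.elim h 0]; exact hk
    rw [hk]
    exact val_moveIV s k p
  | @comp m₀ H m K μ C S S' _ _ ih =>
    have := C.finite_holes
    let := Fintype.ofFinite H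
    choose u hu using ih
    -- The factor coming from `C` is the same on both sides for every `q`, admissible or not; only
    -- the factors of the pieces change, and their roots of unity multiply.
    refine ⟨∑ h, u h, fun r hr p => ?_⟩
    rw [val_comp, val_comp, Finset.mul_sum]
    refine Finset.sum_congr rfl fun q _ => ?_
    rw [← mul_assoc, ← Finset.prod_pow_eq_pow_sum, ← Finset.prod_mul_distrib]
    refine congrArg (· * _) (Finset.prod_congr rfl fun h _ => ?_)
    exact hu h _ (fun k => hr ⟨h, k⟩) _
  | @relabel m₀ H H' m D D' e _ ih =>
    obtain ⟨u, hu⟩ := ih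
    refine ⟨u, fun r hr p => ?_⟩
    obtain ⟨r, rfl⟩ : ∃ r' : (h : H) → Setoid (Fin (2 * m h)), r = fun h => r' (e h) :=
      ⟨Equiv.piCongrLeft (fun h => Setoid (Fin (2 * m h))) e r, funext fun h =>
        (Equiv.piCongrLeft_apply_apply (fun h => Setoid (Fin (2 * m h))) e r h).symm⟩
    rw [val_relabel, val_relabel]
    refine hu r (fun h => ?_) p
    obtain ⟨h, rfl⟩ := e.surjective h
    exact hr h
  | symm _ ih =>
    obtain ⟨u, hu⟩ := ih
    -- Modulo `8` the exponent `7 * u` is the negative of `u`.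
    refine ⟨7 * u, fun r hr p => ?_⟩
    rw [hu r hr p, ← mul_assoc, ← pow_add, show 7 * u + u = 8 * u by ring, pow_mul,
      root8_pow_eight, one_pow, one_mul]
  | trans _ _ ih ih' =>
    obtain ⟨u, hu⟩ := ih
    obtain ⟨v, hv⟩ := ih'
    exact ⟨u + v, fun r hr p => by rw [hu r hr p, hv r hr p, pow_add, mul_assoc]⟩

end Diagram
end PBT

namespace PBT

/-! ### Planarity as exactness

A combinatorial map is planar if and only if every cycle modulo `2` is the boundary of a set of
faces. -/

section homology

variable {Δ Q : Type*} (opp : Δ → Δ)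

/-- The edges of a combinatorial map. -/
abbrev EdgeQuot : Type _ := Quot fun a b : Δ => b = opp a

variable {opp}

theorem edgeQuot_opp (d : Δ) : (Quot.mk _ (opp d) : EdgeQuot opp) = Quot.mk _ d :=
  (Quot.sound rfl : (Quot.mk _ d : EdgeQuot opp) = Quot.mk _ (opp d)).symm

variable (hopp : ∀ d, opp (opp d) = d)

/-- The sum of the values of a function at the two sides, or the two ends, of an edge. -/
def edgeSum (q : Δ → Q) : (Q → ZMod 2) →ₗ[ZMod 2] (EdgeQuot opp → ZMod 2) where
  toFun f := Quot.lift (fun d => f (q d) + f (q (opp d))) (by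
    rintro a b rfl
    simp only [hopp]
    exact add_comm _ _)
  map_add' f g := by
    ext ⟨d⟩
    simp only [Pi.add_apply]
    ring
  map_smul' c f := by
    ext ⟨d⟩
    simp only [Pi.smul_apply, smul_eq_mul, RingHom.id_apply]
    ring

theorem edgeSum_mk (q : Δ → Q) (f : Q → ZMod 2) (d : Δ) :
    edgeSum hopp q f (Quot.mk _ d) = f (q d) + f (q (opp d)) := rfl

/-- Modulo `2` the kernel consists of the functions taking equal values at the two sides of every
edge, that is, the functions constant on components. Rank-nullity gives the count. -/
theorem finrank_edgeSum {C : Type*} [Finite Q] [Finite C] (q : Δ → Q)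
    (c : Q → C) (hc : Function.Surjective c)
    (hcopp : ∀ d, c (q (opp d)) = c (q d))
    (hinv : ∀ f : Q → ZMod 2, (∀ d, f (q (opp d)) = f (q d)) → ∃ g : C → ZMod 2, f = g ∘ c) :
    Module.finrank (ZMod 2) (LinearMap.range (edgeSum hopp q)) + Nat.card C = Nat.card Q := by
  have := Fintype.ofFinite Q
  have := Fintype.ofFinite C
  have hker : LinearMap.ker (edgeSum hopp q) =
      LinearMap.range (LinearMap.funLeft (ZMod 2) (ZMod 2) c) := by
    ext f
    rw [LinearMap.mem_ker, LinearMap.mem_range]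
    constructor
    · intro hf
      obtain ⟨g, rfl⟩ := hinv f fun d => by
        have := congrFun hf (Quot.mk _ d)
        rw [edgeSum_mk] at this
        exact (CharTwo.add_eq_zero.1 this).symm
      exact ⟨g, rfl⟩
    · rintro ⟨g, rfl⟩
      ext ⟨d⟩
      rw [edgeSum_mk, LinearMap.funLeft_apply, LinearMap.funLeft_apply, hcopp]
      exact CharTwo.add_self_eq_zero _
  have h1 := LinearMap.finrank_range_add_finrank_ker (edgeSum hopp q)
  rw [hker, LinearMap.finrank_range_of_inj (LinearMap.funLeft_injective_of_surjective _ _ _ hc),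
    Module.finrank_fintype_fun_eq_card, Module.finrank_fintype_fun_eq_card] at h1
  rwa [Nat.card_eq_fintype_card, Nat.card_eq_fintype_card]

/-- A sum over half-edges is a sum over edges. -/
theorem sum_darts_eq (hopp : ∀ d, opp (opp d) = d) [Fintype Δ] [Fintype (EdgeQuot opp)] (hne : ∀ d, opp d ≠ d)
    (h : Δ → ZMod 2) :
    ∑ d, h d = ∑ e : EdgeQuot opp, (h e.out + h (opp e.out)) := by
  classical
  rw [← Finset.sum_fiberwise Finset.univ (fun d => (Quot.mk _ d : EdgeQuot opp)) h]
  refine Finset.sum_congr rfl fun e _ => ?_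
  have hfib : (Finset.univ.filter fun d => (Quot.mk _ d : EdgeQuot opp) = e) =
      {e.out, opp e.out} := by
    ext d
    simp only [Finset.mem_filter, Finset.mem_univ, true_and, Finset.mem_insert,
      Finset.mem_singleton]
    constructor
    · intro hd
      have h1 : Relation.EqvGen (fun a b : Δ => b = opp a) d e.out :=
        Quot.eqvGen_exact (hd.trans e.out_eq.symm)
      have h2 : ∀ a b, Relation.EqvGen (fun a b : Δ => b = opp a) a b → a = b ∨ a = opp b := by
        intro a b hab
        induction hab with
        | rel a b hab => exact .inr (by rw [hab, hopp])
        | refl a => exact .inl rfl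
        | symm a b _ ih =>
          rcases ih with rfl | rfl
          · exact .inl rfl
          · exact .inr (hopp _).symm
        | trans a b c _ _ ih ih' =>
          rcases ih with rfl | rfl
          · exact ih'
          · rcases ih' with rfl | rfl
            · exact .inr rfl
            · exact .inl (hopp _)
      exact h2 _ _ h1
    · rintro (rfl | rfl)
      · exact e.out_eq
      · exact (edgeQuot_opp _).trans e.out_eq
  rw [hfib, Finset.sum_pair (hne _).symm]

/-- Summing by parts: each edge consists of two half-edges, so `edgeSum` is adjoint to summation
over the half-edges at each element of `Q`. -/
theorem sum_edgeSum_mul [Fintype Δ] [Fintype (EdgeQuot opp)] (hne : ∀ d, opp d ≠ d) (q : Δ → Q)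
    (f : Q → ZMod 2) (x : EdgeQuot opp → ZMod 2) :
    ∑ e, edgeSum hopp q f e * x e = ∑ d, f (q d) * x (Quot.mk _ d) := by
  rw [sum_darts_eq hopp hne]
  refine Finset.sum_congr rfl fun e _ => ?_
  have h1 : (Quot.mk _ (opp e.out) : EdgeQuot opp) = e :=
    (edgeQuot_opp _).trans e.out_eq
  rw [h1, e.out_eq, ← add_mul, ← edgeSum_mk hopp, e.out_eq]

/-- The cycles modulo `2`. -/
def cycles [Fintype (EdgeQuot opp)] (q : Δ → Q) : Submodule (ZMod 2) (EdgeQuot opp → ZMod 2) where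
  carrier := {x | ∀ f, ∑ e, edgeSum hopp q f e * x e = 0}
  add_mem' {x y} hx hy f := by
    simp only [Pi.add_apply, mul_add, Finset.sum_add_distrib, hx f, hy f, add_zero]
  zero_mem' f := by simp
  smul_mem' c x hx f := by
    simp only [Pi.smul_apply, smul_eq_mul, mul_left_comm _ c, ← Finset.mul_sum, hx f, mul_zero]

/-- The cycles are the orthogonal complement of the range of `edgeSum`, hence the kernel of the
transposed matrix, which has the same rank. -/
theorem finrank_cycles [Fintype (EdgeQuot opp)] [Finite Q] (q : Δ → Q) :
    Module.finrank (ZMod 2) (cycles hopp q) +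
      Module.finrank (ZMod 2) (LinearMap.range (edgeSum hopp q)) = Nat.card (EdgeQuot opp) := by
  classical
  have := Fintype.ofFinite Q
  let M := LinearMap.toMatrix' (edgeSum hopp q)
  have hM : M.mulVecLin = edgeSum hopp q := Matrix.toLin'_toMatrix' _
  have hZ : cycles hopp q = LinearMap.ker M.transpose.mulVecLin := by
    ext x
    rw [LinearMap.mem_ker, Matrix.mulVecLin_apply, ← dotProduct_eq_zero_iff]
    refine forall_congr' fun f => ?_
    rw [dotProduct_comm, Matrix.dotProduct_mulVec, Matrix.vecMul_transpose, ← Matrix.mulVecLin_apply, hM]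
    rfl
  have h1 := LinearMap.finrank_range_add_finrank_ker M.transpose.mulVecLin
  have h2 : Module.finrank (ZMod 2) (LinearMap.range M.transpose.mulVecLin) =
      Module.finrank (ZMod 2) (LinearMap.range (edgeSum hopp q)) := by
    rw [← hM]
    exact Matrix.rank_transpose M
  rw [h2, ← hZ, Module.finrank_fintype_fun_eq_card] at h1
  rw [Nat.card_eq_fintype_card, add_comm]
  exact h1

variable {rot : Δ → Δ}

/-- The Euler characteristic of a combinatorial map is maximal if and only if every cycle modulo `2`
is the boundary of a set of faces. -/
theorem euler_iff [Fintype Δ] (hopp : ∀ d, opp (opp d) = d) (hrot : Function.Bijective rot) (hne : ∀ d, opp d ≠ d) :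
    Nat.card (Quot fun a b : Δ => b = rot a) + Nat.card (Quot fun a b : Δ => b = rot (opp a)) =
      Nat.card (Quot fun a b : Δ => b = opp a) +
        2 * Nat.card (Quot fun a b : Δ => b = rot a ∨ b = opp a) ↔
    ∀ x : Δ → ZMod 2, (∀ d, x (opp d) = x d) →
      (∀ f : Δ → ZMod 2, (∀ d, f (rot d) = f d) → ∑ d, f d * x d = 0) →
      ∃ g : Δ → ZMod 2, (∀ d, g (rot d) = g (opp d)) ∧ ∀ d, x d = g d + g (opp d) := by
  let rV : Δ → Δ → Prop := fun a b => b = rot a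
  let rF : Δ → Δ → Prop := fun a b => b = rot (opp a)
  let rC : Δ → Δ → Prop := fun a b => b = rot a ∨ b = opp a
  let := Fintype.ofFinite (EdgeQuot opp)
  let qV : Δ → Quot rV := Quot.mk _
  let qF : Δ → Quot rF := Quot.mk _
  let cV : Quot rV → Quot rC := Quot.lift (Quot.mk _) fun a b h => Quot.sound (.inl h)
  let cF : Quot rF → Quot rC := Quot.lift (Quot.mk _) fun a b h =>
    (Quot.sound (.inr rfl) : (Quot.mk rC a) = Quot.mk rC (opp a)).trans (Quot.sound (.inl h))
  have hV := finrank_edgeSum hopp qV cV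
    (by rintro ⟨d⟩; exact ⟨Quot.mk _ d, rfl⟩)
    (fun d => (Quot.sound (.inr rfl) : (Quot.mk rC d) = Quot.mk rC (opp d)).symm)
    (fun f hf => ⟨Quot.lift (fun d => f (qV d)) (by
      rintro a b (rfl | rfl)
      · exact congrArg f (Quot.sound rfl)
      · exact (hf a).symm), by ext ⟨d⟩; rfl⟩)
  have hF := finrank_edgeSum hopp qF cF
    (by rintro ⟨d⟩; exact ⟨Quot.mk _ d, rfl⟩)
    (fun d => (Quot.sound (.inr rfl) : (Quot.mk rC d) = Quot.mk rC (opp d)).symm)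
    (fun f hf => ⟨Quot.lift (fun d => f (qF d)) (by
      rintro a b (rfl | rfl)
      · rw [← hf a]
        exact congrArg f (Quot.sound (show rot a = rot (opp (opp a)) by rw [hopp]))
      · exact (hf a).symm), by ext ⟨d⟩; rfl⟩)
  have hE := finrank_cycles hopp qV
  have hqV : ∀ d, qV (rot d) = qV d := fun d =>
    (Quot.sound rfl : Quot.mk rV d = Quot.mk rV (rot d)).symm
  have hface : ∀ (g : Quot rF → ZMod 2) (d : Δ), g (qF (rot d)) = g (qF (opp d)) := by
    intro g d
    have h1 : rF (opp d) (rot d) := show rot d = rot (opp (opp d)) by rw [hopp]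
    exact congrArg g (Quot.sound h1).symm
  -- Boundaries are cycles: `rot d` and `opp d` lie on the same face, so after reindexing one of the
  -- two sums by `rot` they coincide and cancel modulo `2`.
  have hle : LinearMap.range (edgeSum hopp qF) ≤ cycles hopp qV := by
    rintro _ ⟨g, rfl⟩ f
    rw [sum_edgeSum_mul hopp hne]
    simp only [edgeSum_mk, mul_add, Finset.sum_add_distrib]
    rw [CharTwo.add_eq_zero, ← Equiv.sum_comp (Equiv.ofBijective rot hrot)]
    refine Finset.sum_congr rfl fun d _ => ?_
    rw [Equiv.ofBijective_apply, hqV, hface g d]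
  -- The boundaries have dimension `F - C` and the cycles `E - (V - C)`; given the inclusion,
  -- equality of dimensions is equality of spaces.
  have hfin : Nat.card (Quot rV) + Nat.card (Quot rF) =
      Nat.card (EdgeQuot opp) + 2 * Nat.card (Quot rC) ↔
      LinearMap.range (edgeSum hopp qF) = cycles hopp qV := by
    constructor
    · intro h
      exact Submodule.eq_of_le_of_finrank_eq hle (by omega)
    · intro h
      rw [h] at hF
      omega
  refine hfin.trans ⟨fun h x hx hcyc => ?_, fun h => le_antisymm hle fun x hx => ?_⟩
  · let y : EdgeQuot opp → ZMod 2 := Quot.lift x fun a b hab => by rw [hab, hx]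
    have hy : y ∈ cycles hopp qV := by
      intro f
      rw [sum_edgeSum_mul hopp hne]
      exact hcyc (fun d => f (qV d)) fun d => congrArg f (hqV d)
    rw [← h] at hy
    obtain ⟨g, hg⟩ := hy
    exact ⟨fun d => g (qF d), hface g, fun d => (congrFun hg (Quot.mk _ d)).symm⟩
  · obtain ⟨g, hg, hxg⟩ := h (fun d => x (Quot.mk _ d))
      (fun d => congrArg x (edgeQuot_opp d)) (fun f hf => by
        have := hx (Quot.lift f fun a b hab => by rw [hab, hf])
        rw [sum_edgeSum_mul hopp hne] at this
        exact this)
    refine ⟨Quot.lift g fun a b hab => by rw [hab, hg, hopp], ?_⟩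
    ext ⟨d⟩
    exact (hxg d).symm

end homology
end PBT

namespace PBT
namespace Diagram

/-! ### Planarity of composites -/

noncomputable instance fintypeDarts {m₀ : ℕ} {H : Type} {m : H → ℕ} (D : Diagram m₀ m) :
    Fintype D.Darts :=
  Fintype.ofFinite _

theorem rot_bijective {m₀ : ℕ} {H : Type} {m : H → ℕ} {X P : Type} :
    Function.Bijective (Dart.rot : Dart m₀ m X P → Dart m₀ m X P) := by
  let g : Dart m₀ m X P → Dart m₀ m X P
    | .outer i => .outer (finRotate _ i)
    | .hole h i => .hole h ((finRotate _).symm i)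
    | .cross x i => .cross x ((finRotate _).symm i)
    | .pt p i => .pt p ((finRotate _).symm i)
  refine Function.bijective_iff_has_inverse.2 ⟨g, ?_, ?_⟩
  · rintro (i | ⟨h, i⟩ | ⟨x, i⟩ | ⟨p, i⟩) <;>
      simp only [g, Dart.rot, Equiv.apply_symm_apply, Equiv.symm_apply_apply]
  · rintro (i | ⟨h, i⟩ | ⟨x, i⟩ | ⟨p, i⟩) <;>
      simp only [g, Dart.rot, Equiv.apply_symm_apply, Equiv.symm_apply_apply]

theorem exists_forall_eq_of_finRotate {α : Type*} [Nonempty α] {n : ℕ} (g : Fin n → α)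
    (hg : ∀ i, g (finRotate n i) = g i) : ∃ c, ∀ i, g i = c := by
  cases n with
  | zero => exact ⟨Classical.arbitrary α, fun i => i.elim0⟩
  | succ n =>
    refine ⟨g 0, fun i => ?_⟩
    induction i using Fin.induction with
    | zero => rfl
    | succ i ih =>
      rw [← ih, ← hg i.castSucc, finRotate_apply, Fin.coeSucc_eq_succ]

section

variable {m₀ : ℕ} {H : Type} {m : H → ℕ} (D : Diagram m₀ m)

/-- A set of edges, given by its characteristic function modulo `2`, which meets every vertex an
even number of times. -/
structure IsCycle (x : D.Darts → ZMod 2) : Prop where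
  opp : ∀ d, x (D.opp d) = x d
  sum_eq_zero : ∀ f : D.Darts → ZMod 2, (∀ d, f d.rot = f d) → ∑ d, f d * x d = 0

/-- The set of edges `x` is the boundary of the set `g` of faces. -/
structure IsBoundary (x g : D.Darts → ZMod 2) : Prop where
  face : ∀ d, g d.rot = g (D.opp d)
  eq_add : ∀ d, x d = g d + g (D.opp d)

theorem planar_iff_exists_isBoundary :
    D.Planar ↔ ∀ x, D.IsCycle x → ∃ g, D.IsBoundary x g := by
  refine (euler_iff D.opp_opp rot_bijective D.opp_ne).trans ⟨fun h x hx => ?_, fun h x h1 h2 => ?_⟩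
  · obtain ⟨g, h1, h2⟩ := h x hx.1 hx.2
    exact ⟨g, h1, h2⟩
  · obtain ⟨g, h1, h2⟩ := h x ⟨h1, h2⟩
    exact ⟨g, h1, h2⟩

variable {D}

theorem exists_outer_eq {f : D.Darts → ZMod 2} (hf : ∀ d, f d.rot = f d) :
    ∃ c, ∀ i, f (.outer i) = c :=
  exists_forall_eq_of_finRotate (fun i => f (.outer i)) fun i => by
    rw [← hf (.outer (finRotate _ i)), Dart.rot, Equiv.symm_apply_apply]

theorem exists_hole_eq {f : D.Darts → ZMod 2} (hf : ∀ d, f d.rot = f d) (h : H) :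
    ∃ c, ∀ i, f (.hole h i) = c :=
  exists_forall_eq_of_finRotate (fun i => f (.hole h i)) fun i => hf (.hole h i)

theorem sum_eq_zero_of_opp {x : D.Darts → ZMod 2} (hx : ∀ d, x (D.opp d) = x d) :
    ∑ d, x d = 0 :=
  Finset.sum_involution (fun d _ => D.opp d) (fun d _ => by rw [hx, CharTwo.add_self_eq_zero])
    (fun d _ _ => D.opp_ne d) (fun _ _ => Finset.mem_univ _) fun d _ => D.opp_opp d

end

section comp

variable {m₀ : ℕ} {H : Type} {m : H → ℕ} {K : H → Type} {μ : (h : H) → K h → ℕ}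
variable {C : Diagram m₀ m} {S : (h : H) → Diagram (m h) (μ h)}

/-- A function on the half-edges of a composite. -/
def glue {α : Type*} (f : C.Darts → α) (g : (h : H) → (S h).Darts → α) (d : CompDart C S) : α :=
  Sum.elim f (fun q => g q.1 q.2) (compSplit C S d)

theorem glue_out {α : Type*} (f : C.Darts → α) (g : (h : H) → (S h).Darts → α) (d : C.Darts) :
    glue f g (compOut C S d) = f d := by
  rw [glue, compSplit_out, Sum.elim_inl]

theorem glue_in {α : Type*} (f : C.Darts → α) (g : (h : H) → (S h).Darts → α) (h : H)
    (d : (S h).Darts) : glue (C := C) f g (compIn C S h d) = g h d := by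
  rw [glue, compSplit_in, Sum.elim_inr]

theorem sum_comp_darts [Fintype H] (F : (C.comp S).Darts → ZMod 2) :
    ∑ d, F d = ∑ d, F (compOut C S d) + ∑ h, ∑ d, F (compIn C S h d) := by
  rw [← (show C.Darts ⊕ (Σ h, (S h).Darts) ≃ (C.comp S).Darts from compEquiv C S).sum_comp,
    Fintype.sum_sum_type, Fintype.sum_sigma]
  rfl

/-- Vertex functions on the pieces which agree at the attached ends glue to a vertex function on the
composite, because there each attached pair of ends is a two-valent vertex. -/
theorem IsCycle.sum_pieces [Fintype H] {x : (C.comp S).Darts → ZMod 2} (hx : (C.comp S).IsCycle x)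
    (f : C.Darts → ZMod 2) (hf : ∀ d, f d.rot = f d) (g : (h : H) → (S h).Darts → ZMod 2)
    (hg : ∀ h d, g h d.rot = g h d) (hfg : ∀ h i, f (.hole h i) = g h (.outer i)) :
    ∑ d, f d * x (compOut C S d) + ∑ h, ∑ d, g h d * x (compIn C S h d) = 0 := by
  have := hx.sum_eq_zero (glue f g) (by
    intro d
    rcases comp_cases C S d with ⟨a, rfl⟩ | ⟨h, a, rfl⟩
    · rw [glue_out, ← hf]
      cases a with
      | hole h i =>
        rw [hf, hfg]
        exact glue_in f g h (.outer i)
      | outer i => exact glue_out f g (Dart.rot (.outer i))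
      | cross y i => exact glue_out f g (Dart.rot (.cross y i))
      | pt p i => exact glue_out f g (Dart.rot (.pt p i))
    · rw [glue_in, ← hg]
      cases a with
      | outer i =>
        rw [hg, ← hfg]
        exact glue_out f g (.hole h i)
      | hole k i => exact glue_in f g h (Dart.rot (.hole k i))
      | cross y i => exact glue_in f g h (Dart.rot (.cross y i))
      | pt p i => exact glue_in f g h (Dart.rot (.pt p i)))
  rw [sum_comp_darts] at this
  simpa only [glue_out, glue_in] using this

/-- A vertex function on `C` is constant on each hole and is extended by that constant over the
inserted diagram. The added sums vanish because each inner edge is counted twice. -/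
theorem IsCycle.out [Fintype H] {x : (C.comp S).Darts → ZMod 2} (hx : (C.comp S).IsCycle x) :
    C.IsCycle fun d => x (compOut C S d) where
  opp d := (congrArg x (comp_opp_out C S d)).symm.trans (hx.opp _)
  sum_eq_zero f hf := by
    choose c hc using exists_hole_eq hf
    have := hx.sum_pieces f hf (fun h _ => c h) (fun _ _ => rfl) hc
    have h0 : ∀ h, ∑ d, x (compIn C S h d) = 0 := fun h =>
      sum_eq_zero_of_opp fun d => (congrArg x (comp_opp_in C S h d)).symm.trans (hx.opp _)
    simpa only [← Finset.mul_sum, h0, mul_zero, Finset.sum_const_zero, add_zero] using this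

/-- After subtracting its constant value on the outer circle, a vertex function of `S h` extends by
zero to the composite. The constant itself contributes nothing, each edge being counted twice. -/
theorem IsCycle.in [Fintype H] {x : (C.comp S).Darts → ZMod 2} (hx : (C.comp S).IsCycle x)
    (h : H) : (S h).IsCycle fun d => x (compIn C S h d) where
  opp d := (congrArg x (comp_opp_in C S h d)).symm.trans (hx.opp _)
  sum_eq_zero f hf := by
    classical
    obtain ⟨c, hc⟩ := exists_outer_eq hf
    have h0 : ∑ d, x (compIn C S h d) = 0 :=
      sum_eq_zero_of_opp fun d => (congrArg x (comp_opp_in C S h d)).symm.trans (hx.opp _)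
    have := hx.sum_pieces (fun _ => 0) (fun _ => rfl)
      (Function.update (fun _ _ => 0) h fun d => f d - c)
      (by
        intro k d
        by_cases hk : k = h
        · subst hk
          simp only [Function.update_self, hf]
        · rw [Function.update_of_ne hk])
      (by
        intro k i
        by_cases hk : k = h
        · subst hk
          simp only [Function.update_self, hc, sub_self]
        · rw [Function.update_of_ne hk])
    rw [Finset.sum_eq_single h] at this
    · simpa only [Function.update_self, zero_mul, Finset.sum_const_zero, zero_add, sub_mul,
        Finset.sum_sub_distrib, ← Finset.mul_sum, h0, mul_zero, sub_zero] using this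
    · intro k _ hk
      simp only [Function.update_of_ne hk, zero_mul, Finset.sum_const_zero]
    · exact fun hh => absurd (Finset.mem_univ _) hh

theorem IsCycle.pt_eq {D : Diagram m₀ m} {x : D.Darts → ZMod 2} (hx : D.IsCycle x) (p : D.P) :
    x (.pt p 0) = x (.pt p 1) := by
  classical
  have hr : ∀ d : D.Darts, (d.rot = .pt p 0 ↔ d = .pt p 1) ∧ (d.rot = .pt p 1 ↔ d = .pt p 0) := by
    rintro (i | ⟨h, i⟩ | ⟨y, i⟩ | ⟨q, i⟩)
    iterate 3 exact ⟨iff_of_false nofun nofun, iff_of_false nofun nofun⟩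
    simp only [Dart.rot, Dart.pt.injEq]
    refine ⟨and_congr Iff.rfl ?_, and_congr Iff.rfl ?_⟩ <;> revert i <;> decide
  have := hx.sum_eq_zero (fun d => (if d = .pt p 0 then 1 else 0) + if d = .pt p 1 then 1 else 0)
    (by
      intro d
      simp only [hr]
      exact add_comm _ _)
  simp only [add_mul, Finset.sum_add_distrib, ite_mul, one_mul, zero_mul, Finset.sum_ite_eq',
    Finset.mem_univ, if_true] at this
  exact CharTwo.add_eq_zero.1 this

/-- Composites of planar diagrams are planar. -/
theorem Planar.comp (hC : C.Planar) (hS : ∀ h, (S h).Planar) : (C.comp S).Planar := by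
  have := C.finite_holes
  have := Fintype.ofFinite H
  rw [planar_iff_exists_isBoundary] at hC ⊢
  intro x hx
  obtain ⟨f, hf⟩ := hC _ hx.out
  choose g hg using fun h => (planar_iff_exists_isBoundary _).1 (hS h) _ (hx.in h)
  -- Along an attached circle both functions jump by the same value of `x` at every end, so they
  -- differ by a constant.
  have hc : ∀ h, ∃ c, ∀ i, g h (.outer i) + f (.hole h (finRotate _ i)) = c := by
    intro h
    refine exists_forall_eq_of_finRotate _ fun i => ?_
    set j := finRotate (2 * m h) i with hj
    have e1 : g h (.outer i) = g h ((S h).opp (.outer j)) := by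
      rw [← (hg h).face, Dart.rot, hj, Equiv.symm_apply_apply]
    have e2 : f (.hole h (finRotate _ j)) = f (C.opp (.hole h j)) := hf.face (.hole h j)
    have e3 := hx.pt_eq (.inr ⟨h, j⟩)
    have e4 := hf.eq_add (.hole h j)
    have e5 := (hg h).eq_add (.outer j)
    have e6 : f (.hole h j) + f (C.opp (.hole h j)) =
        g h (.outer j) + g h ((S h).opp (.outer j)) := by
      rw [← e4, ← e5]
      exact e3
    rw [e1, e2]
    have hch : (2 : ZMod 2) = 0 := by decide
    linear_combination e6 + (g h (.outer j) - f (.hole h j)) * hch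
  choose c hc using hc
  have hc' : ∀ h i, f (.hole h (finRotate _ i)) = g h (.outer i) + c h := by
    intro h i
    rw [← hc h i, ← add_assoc, CharTwo.add_self_eq_zero, zero_add]
  -- Adding a constant to the faces of one piece does not change their boundary, so the pieces can
  -- be matched independently.
  refine ⟨glue f fun h d => g h d + c h, ?_, ?_⟩
  · intro d
    rcases comp_cases C S d with ⟨a, rfl⟩ | ⟨h, a, rfl⟩
    · rw [comp_opp_out, glue_out, ← hf.face]
      cases a with
      | hole h i =>
        refine (glue_in f _ h (.outer i)).trans ?_
        exact (hc' h i).symm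
      | outer i => exact glue_out f _ (Dart.rot (.outer i))
      | cross y i => exact glue_out f _ (Dart.rot (.cross y i))
      | pt p i => exact glue_out f _ (Dart.rot (.pt p i))
    · rw [comp_opp_in, glue_in, ← (hg h).face]
      cases a with
      | outer i =>
        refine (glue_out f _ (.hole h i)).trans ?_
        have := hc' h ((finRotate _).symm i)
        rwa [Equiv.apply_symm_apply] at this
      | hole k i => exact glue_in f _ h (Dart.rot (.hole k i))
      | cross y i => exact glue_in f _ h (Dart.rot (.cross y i))
      | pt p i => exact glue_in f _ h (Dart.rot (.pt p i))
  · intro d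
    rcases comp_cases C S d with ⟨a, rfl⟩ | ⟨h, a, rfl⟩
    · rw [comp_opp_out, glue_out, glue_out]
      exact hf.eq_add a
    · rw [comp_opp_in, glue_in, glue_in, (hg h).eq_add a]
      have := CharTwo.add_self_eq_zero (c h)
      linear_combination -this

end comp

section relabel

variable {m₀ : ℕ} {H H' : Type} {m : H → ℕ} {D : Diagram m₀ m}

theorem Planar.relabel (hD : D.Planar) (e : H' ≃ H) : (D.relabel e).Planar := by
  let φ := D.relabelEquiv e
  have hrot : ∀ d, φ d.rot = (φ d).rot := by rintro (i | ⟨h, i⟩ | ⟨x, i⟩ | ⟨p, i⟩) <;> rfl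
  have hopp : ∀ d, φ ((D.relabel e).opp d) = D.opp (φ d) := fun d => relabelTo_from e _
  have hV : (D.relabel e).numVertices = D.numVertices :=
    Nat.card_congr (Quot.congr φ fun a b => by rw [← hrot, φ.injective.eq_iff])
  have hE : (D.relabel e).numEdges = D.numEdges :=
    Nat.card_congr (Quot.congr φ fun a b => by rw [← hopp, φ.injective.eq_iff])
  have hF : (D.relabel e).numFaces = D.numFaces :=
    Nat.card_congr (Quot.congr φ fun a b => by rw [← hopp, ← hrot, φ.injective.eq_iff])
  have hC : (D.relabel e).numComponents = D.numComponents :=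
    Nat.card_congr (Quot.congr φ fun a b => by
      rw [← hopp, ← hrot, φ.injective.eq_iff, φ.injective.eq_iff])
  rw [Planar, hV, hE, hF, hC]
  exact hD

theorem Planar.fill (hD : D.Planar) (B : (h : H) → Holeless (m h)) (hB : ∀ h, (B h).Planar) :
    (D.fill B).Planar :=
  (hD.comp hB).relabel _

end relabel

/-! ### Checkerboard colourings -/

/-- A colouring of the half-edges alternating around vertices and along edges. -/
structure Coloring {m₀ : ℕ} {H : Type} {m : H → ℕ} (D : Diagram m₀ m) where
  color : D.Darts → ZMod 2
  opp : ∀ d, color (D.opp d) = color d + 1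
  rot : ∀ d, color d.rot = color d + 1

/-- The half-edges of a diagram. -/
def dartSum {m₀ : ℕ} {H : Type} {m : H → ℕ} (D : Diagram m₀ m) :
    (Fin (2 * m₀) ⊕ (Σ h, Fin (2 * m h))) ⊕ ((D.X × Fin 4) ⊕ (D.P × Fin 2)) ≃ D.Darts where
  toFun := Sum.elim (Sum.elim .outer fun q => .hole q.1 q.2)
    (Sum.elim (fun q => .cross q.1 q.2) fun q => .pt q.1 q.2)
  invFun
    | .outer i => .inl (.inl i)
    | .hole h i => .inl (.inr ⟨h, i⟩)
    | .cross x i => .inr (.inl (x, i))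
    | .pt p i => .inr (.inr (p, i))
  left_inv := by rintro ((i | ⟨h, i⟩) | (⟨x, i⟩ | ⟨p, i⟩)) <;> rfl
  right_inv := by rintro (i | ⟨h, i⟩ | ⟨x, i⟩ | ⟨p, i⟩) <;> rfl

/-- Every vertex has even valence: `2 * m₀`, `2 * m h`, `4` or `2`. -/
theorem isCycle_one {m₀ : ℕ} {H : Type} {m : H → ℕ} (D : Diagram m₀ m) : D.IsCycle fun _ => 1 where
  opp _ := rfl
  sum_eq_zero f hf := by
    have := D.finite_holes
    have := D.finite_X
    have := D.finite_P
    have := Fintype.ofFinite H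
    have := Fintype.ofFinite D.X
    have := Fintype.ofFinite D.P
    have key : ∀ (n : ℕ) (g : Fin n → ZMod 2), Even n → (∀ i, g (finRotate n i) = g i) →
        ∑ i, g i = 0 := by
      intro n g hn hg
      obtain ⟨c, hc⟩ := exists_forall_eq_of_finRotate g hg
      obtain ⟨k, rfl⟩ := hn
      simp only [hc, Finset.sum_const, Finset.card_univ, Fintype.card_fin, add_nsmul]
      exact CharTwo.add_self_eq_zero _
    simp only [mul_one]
    rw [← D.dartSum.sum_comp, Fintype.sum_sum_type, Fintype.sum_sum_type, Fintype.sum_sum_type,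
      Fintype.sum_sigma, Fintype.sum_prod_type, Fintype.sum_prod_type]
    have h1 : ∑ i, f (.outer i) = 0 := key _ _ (even_two_mul _) fun i => by
      rw [← hf (.outer (finRotate _ i)), Dart.rot, Equiv.symm_apply_apply]
    have h2 : ∀ h, ∑ i, f (.hole h i) = 0 := fun h => key _ _ (even_two_mul _) fun i =>
      hf (.hole h i)
    have h3 : ∀ x, ∑ i, f (.cross x i) = 0 := fun x => key _ _ (by decide) fun i => hf (.cross x i)
    have h4 : ∀ p, ∑ i, f (.pt p i) = 0 := fun p => key _ _ (by decide) fun i => hf (.pt p i)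
    simp only [dartSum, Equiv.coe_fn_mk, Sum.elim_inl, Sum.elim_inr, h1, h2, h3, h4,
      Finset.sum_const_zero, add_zero]

/-- If all edges together bound a set of faces, its characteristic function changes across every
edge, which is a checkerboard colouring of the faces read on the half-edges. -/
theorem Planar.nonempty_coloring {m₀ : ℕ} {H : Type} {m : H → ℕ} {D : Diagram m₀ m}
    (hD : D.Planar) : Nonempty D.Coloring := by
  obtain ⟨g, hg⟩ := (planar_iff_exists_isBoundary D).1 hD _ D.isCycle_one
  have h : ∀ d, g (D.opp d) = g d + 1 := by
    intro d
    rw [hg.eq_add d, ← add_assoc, CharTwo.add_self_eq_zero, zero_add]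
  exact ⟨⟨g, h, fun d => (hg.face d).trans (h d)⟩⟩

end Diagram
end PBT

namespace PBT

/-! ### Parity of the number of cycles of a permutation -/

section perm

open Equiv.Perm

theorem quot_mk_eq_iff_sameCycle {α : Type*} [Finite α] (f : Equiv.Perm α) (a b : α) :
    (Quot.mk (fun a b => b = f a) a) = Quot.mk _ b ↔ f.SameCycle a b := by
  constructor
  · intro h
    have := congrArg (Quot.lift (Quotient.mk (SameCycle.setoid f)) fun a b hab =>
      Quotient.sound (show f.SameCycle a b from ⟨1, by rw [hab, zpow_one]⟩)) h
    exact Quotient.exact this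
  · intro h
    obtain ⟨n, rfl⟩ := h.exists_nat_pow_eq
    clear h
    induction n with
    | zero => rfl
    | succ n ih =>
      rw [ih, pow_succ', Equiv.Perm.mul_apply]
      exact Quot.sound rfl

/-- A cycle of length `l` has sign `(-1) ^ (l - 1)`; multiplying over all cycles, fixed points
included, compares the sign with the number of orbits. -/
theorem neg_one_pow_card_quot {α : Type*} [Fintype α] [DecidableEq α] (f : Equiv.Perm α) :
    (-1 : ℤˣ) ^ Nat.card (Quot fun a b => b = f a) = sign f * (-1) ^ Fintype.card α := by
  -- Fixed points need their own labels, since `cycleOf` is the identity at each of them.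
  let F : α → α ⊕ Equiv.Perm α := fun a => if f a = a then .inl a else .inr (f.cycleOf a)
  have hF : ∀ a b, F a = F b ↔ f.SameCycle a b := by
    intro a b
    by_cases ha : f a = a
    · by_cases hb : f b = b
      · simp only [F, ha, hb, if_true, Sum.inl.injEq]
        refine ⟨fun h => h ▸ SameCycle.refl _ _, fun ⟨n, hn⟩ => ?_⟩
        rw [zpow_apply_eq_self_of_apply_eq_self ha] at hn
        exact hn
      · simp only [F, ha, hb, if_true, if_false, reduceCtorEq, false_iff]
        exact fun h => hb (h.apply_eq_self_iff.1 ha)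
    · by_cases hb : f b = b
      · simp only [F, ha, hb, if_true, if_false, reduceCtorEq, false_iff]
        exact fun h => ha (h.apply_eq_self_iff.2 hb)
      · simp only [F, ha, hb, if_false, Sum.inr.injEq]
        exact (sameCycle_iff_cycleOf_eq_of_mem_support (mem_support.2 ha) (mem_support.2 hb)).symm
  have hrange : Finset.univ.image F = f.supportᶜ.disjSum f.cycleFactorsFinset := by
    ext (a | c)
    · simp only [Finset.mem_image, Finset.mem_univ, true_and, Finset.inl_mem_disjSum,
        Finset.mem_compl, notMem_support]
      constructor
      · rintro ⟨b, hb⟩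
        by_cases h : f b = b
        · simp only [F, h, if_true, Sum.inl.injEq] at hb
          rwa [← hb]
        · simp [F, h] at hb
      · intro h
        exact ⟨a, by simp only [F, h, if_true]⟩
    · simp only [Finset.mem_image, Finset.mem_univ, true_and, Finset.inr_mem_disjSum]
      constructor
      · rintro ⟨b, hb⟩
        by_cases h : f b = b
        · simp [F, h] at hb
        · simp only [F, h, if_false, Sum.inr.injEq] at hb
          rw [← hb]
          exact cycleOf_mem_cycleFactorsFinset_iff.2 (mem_support.2 h)
      · intro hc
        obtain ⟨a, ha⟩ := (mem_cycleFactorsFinset_iff.1 hc).1.nonempty_support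
        refine ⟨a, ?_⟩
        have h : f a ≠ a := mem_support.1 (mem_cycleFactorsFinset_support_le hc ha)
        simp only [F, h, if_false, cycle_is_cycleOf ha hc]
  have hcard : Nat.card (Quot fun a b => b = f a) = f.supportᶜ.card + f.cycleFactorsFinset.card := by
    let G : (Quot fun a b => b = f a) → {x // x ∈ Finset.univ.image F} :=
      Quot.lift (fun a => ⟨F a, Finset.mem_image_of_mem _ (Finset.mem_univ _)⟩) fun a b hab =>
        Subtype.ext ((hF a b).2 ⟨1, by rw [hab, zpow_one]⟩)
    have hG : Function.Bijective G := by
      constructor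
      · rintro ⟨a⟩ ⟨b⟩ hab
        exact (quot_mk_eq_iff_sameCycle f a b).2 ((hF a b).1 (congrArg Subtype.val hab))
      · rintro ⟨x, hx⟩
        obtain ⟨a, -, rfl⟩ := Finset.mem_image.1 hx
        exact ⟨Quot.mk _ a, rfl⟩
    rw [Nat.card_congr (Equiv.ofBijective G hG), Nat.card_eq_fintype_card, Fintype.card_coe, hrange,
      Finset.card_disjSum]
  have hct : Multiset.card f.cycleType = f.cycleFactorsFinset.card := by
    rw [cycleType_def, Multiset.card_map]; rfl
  rw [hcard, sign_of_cycleType, sum_cycleType, hct, ← pow_add]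
  have h1 := f.support.card_add_card_compl
  rw [show f.support.card + f.cycleFactorsFinset.card + Fintype.card α =
    (f.supportᶜ.card + f.cycleFactorsFinset.card) + 2 * f.support.card by omega,
    pow_add _ _ (2 * _), pow_mul]
  simp

end perm

/-! ### Parity of the number of circles -/

section circles

variable {Δ : Type*} {opp s s' : Δ → Δ} {o : Δ → ZMod 2}

/-- Circles traversed by alternating the involutions `opp` and `s`, starting from half-edges of
colour `0`. -/
def circlePerm (hopp : ∀ d, opp (opp d) = d) (hs : ∀ d, s (s d) = d)
    (ho : ∀ d, o (opp d) = o d + 1) (hos : ∀ d, o (s d) = o d + 1) :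
    Equiv.Perm {d // o d = 0} where
  toFun d := ⟨s (opp d), by rw [hos, ho, d.2]; decide⟩
  invFun d := ⟨opp (s d), by rw [ho, hos, d.2]; decide⟩
  left_inv d := Subtype.ext (by simp only [hs, hopp])
  right_inv d := Subtype.ext (by simp only [hs, hopp])

theorem zmod_two_eq_one_of_ne {c : ZMod 2} (h : c ≠ 0) : c = 1 := by
  revert c; decide

/-- Both involutions change the colour, so colours alternate along a circle and its half-edges of
colour `0` form a single orbit of `circlePerm`. A half-edge of the other colour is moved to colour
`0` by `opp`. -/
theorem card_circles (hopp : ∀ d, opp (opp d) = d) (hs : ∀ d, s (s d) = d)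
    (ho : ∀ d, o (opp d) = o d + 1) (hos : ∀ d, o (s d) = o d + 1) :
    Nat.card (Quot fun a b => b = opp a ∨ b = s a) =
      Nat.card (Quot fun a b => b = circlePerm hopp hs ho hos a) := by
  let π := circlePerm hopp hs ho hos
  let g : Δ → {d // o d = 0} := fun d =>
    if h : o d = 0 then ⟨d, h⟩ else ⟨opp d, by rw [ho, zmod_two_eq_one_of_ne h]; decide⟩
  have hg : ∀ d : {d // o d = 0}, g d = d := fun d => dif_pos d.2
  have hgo : ∀ d, g (opp d) = g d := by
    intro d
    by_cases h : o d = 0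
    · have h' : o (opp d) ≠ 0 := by rw [ho, h]; decide
      simp only [g, dif_pos h, dif_neg h', hopp]
    · have h' : o (opp d) = 0 := by rw [ho, zmod_two_eq_one_of_ne h]; decide
      simp only [g, dif_neg h, dif_pos h']
  have hgs : ∀ d, o d = 0 → (Quot.mk (fun a b => b = π a) (g (s d))) = Quot.mk _ (g d) := by
    intro d h
    have h' : o (s d) ≠ 0 := by rw [hos, h]; decide
    refine Quot.sound (Subtype.ext ?_)
    simp only [g, dif_pos h, dif_neg h', π, circlePerm, Equiv.coe_fn_mk, hopp, hs]
  refine Nat.card_congr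
    { toFun := Quot.lift (fun d => Quot.mk _ (g d)) ?_
      invFun := Quot.lift (fun d => Quot.mk _ d.1) ?_
      left_inv := ?_
      right_inv := ?_ }
  · rintro a b (rfl | rfl)
    · rw [hgo]
    · by_cases h : o a = 0
      · exact (hgs a h).symm
      · have := hgs (s a) (by rw [hos, zmod_two_eq_one_of_ne h]; decide)
        rwa [hs] at this
  · rintro a b rfl
    exact (Quot.sound (.inl rfl) : (Quot.mk (fun a b => b = opp a ∨ b = s a) a.1) =
      Quot.mk _ (opp a.1)).trans (Quot.sound (.inr rfl))
  · rintro ⟨d⟩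
    change Quot.mk _ (g d).1 = Quot.mk _ d
    by_cases h : o d = 0
    · simp only [g, dif_pos h]
    · simp only [g, dif_neg h]
      exact (Quot.sound (.inl rfl) : (Quot.mk (fun a b => b = opp a ∨ b = s a) d) =
        Quot.mk _ (opp d)).symm
  · rintro ⟨d⟩
    exact congrArg (Quot.mk _) (hg d)

/-- Switching the splitting at one site changes the parity of the number of circles. -/
theorem neg_one_pow_card_circles [Fintype Δ] (hopp : ∀ d, opp (opp d) = d) (hs : ∀ d, s (s d) = d)
    (hs' : ∀ d, s' (s' d) = d) (ho : ∀ d, o (opp d) = o d + 1) (hos : ∀ d, o (s d) = o d + 1)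
    (hos' : ∀ d, o (s' d) = o d + 1) (v : Fin 4 → Δ) (hv : Function.Injective v)
    (hov : ∀ i, o (v (i + 1)) = o (v i) + 1) (hsv : ∀ i, s (v i) = v (Diagram.flatPair 0 i))
    (hsv' : ∀ i, s' (v i) = v (Diagram.flatPair 1 i)) (hne : ∀ d, (∀ i, d ≠ v i) → s' d = s d) :
    (-1 : ℤˣ) ^ Nat.card (Quot fun a b => b = opp a ∨ b = s' a) =
      -(-1) ^ Nat.card (Quot fun a b => b = opp a ∨ b = s a) := by
  classical
  rw [card_circles hopp hs ho hos, card_circles hopp hs' ho hos', neg_one_pow_card_quot,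
    neg_one_pow_card_quot]
  obtain ⟨a, ha⟩ : ∃ a, o (v a) = 0 := by
    by_cases h : o (v 0) = 0
    · exact ⟨0, h⟩
    · exact ⟨0 + 1, by rw [hov, zmod_two_eq_one_of_ne h]; decide⟩
  have hb : o (v (a + 1 + 1)) = 0 := by rw [hov, hov, ha]; decide
  have hab : (⟨v a, ha⟩ : {d // o d = 0}) ≠ ⟨v (a + 1 + 1), hb⟩ := by
    intro h
    exact (show ∀ a : Fin 4, a ≠ a + 1 + 1 by decide) a (hv (congrArg Subtype.val h))
  -- The site has two half-edges of colour `0`, opposite to each other. The two splittings send the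
  -- half-edges of colour `1` to them in opposite ways, so the permutations differ by their
  -- transposition.
  have hπ : circlePerm hopp hs' ho hos' =
      Equiv.swap ⟨v a, ha⟩ ⟨v (a + 1 + 1), hb⟩ * circlePerm hopp hs ho hos := by
    ext ⟨d, hd⟩
    rw [Equiv.Perm.mul_apply]
    have hd1 : o (opp d) = 1 := by rw [ho, hd]; decide
    by_cases h : ∃ i, opp d = v i
    · obtain ⟨i, hi⟩ := h
      rw [hi] at hd1
      have hai : i = a + 1 ∨ i = a + 1 + 1 + 1 := by
        have h0 : i ≠ a := by rintro rfl; rw [ha] at hd1; exact absurd hd1 (by decide)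
        have h2 : i ≠ a + 1 + 1 := by rintro rfl; rw [hb] at hd1; exact absurd hd1 (by decide)
        clear hd1 hi hab hb ha
        revert a i
        decide
      have e1 : circlePerm hopp hs ho hos ⟨d, hd⟩ = ⟨v a, ha⟩ ∧
          s' (opp d) = v (a + 1 + 1) ∨ circlePerm hopp hs ho hos ⟨d, hd⟩ = ⟨v (a + 1 + 1), hb⟩ ∧
          s' (opp d) = v a := by
        have hf : Diagram.flatPair 0 i = a ∧ Diagram.flatPair 1 i = a + 1 + 1 ∨
            Diagram.flatPair 0 i = a + 1 + 1 ∧ Diagram.flatPair 1 i = a := by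
          clear hd1 hi hab hb ha
          revert a i
          decide
        refine hf.imp ?_ ?_ <;> rintro ⟨h1, h2⟩
        · exact ⟨Subtype.ext (show s (opp d) = _ by rw [hi, hsv, h1]), by rw [hi, hsv', h2]⟩
        · exact ⟨Subtype.ext (show s (opp d) = _ by rw [hi, hsv, h1]), by rw [hi, hsv', h2]⟩
      rcases e1 with ⟨h1, h2⟩ | ⟨h1, h2⟩
      · rw [h1, Equiv.swap_apply_left]
        exact h2
      · rw [h1, Equiv.swap_apply_right]
        exact h2
    · have h' : ∀ i, s (opp d) ≠ v i := fun i hi =>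
        h ⟨Diagram.flatPair 0 i, by rw [← hsv, ← hi, hs]⟩
      rw [Equiv.swap_apply_of_ne_of_ne]
      · exact hne _ fun i hi => h ⟨i, hi⟩
      · exact fun e => h' a (congrArg Subtype.val e)
      · exact fun e => h' _ (congrArg Subtype.val e)
  rw [hπ, map_mul, Equiv.Perm.sign_swap hab]
  simp

end circles

/-- A sign which changes whenever one coordinate is switched. -/
theorem eq_mul_neg_one_pow_of_update {Y : Type*} [Fintype Y] [DecidableEq Y]
    (c : (Y → Fin 2) → ℤˣ)
    (hc : ∀ ε y, c (Function.update ε y 1) = -c (Function.update ε y 0)) (ε : Y → Fin 2) :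
    c ε = c 0 * (-1) ^ ∑ y, (ε y : ℕ) := by
  -- The coordinates are switched from `0` to their value in `ε` one at a time.
  have key : ∀ t : Finset Y, c (t.piecewise ε 0) = c 0 * (-1) ^ ∑ y ∈ t, (ε y : ℕ) := by
    intro t
    induction t using Finset.induction_on with
    | empty => simp
    | insert y t hy ih =>
      have h0 : Function.update (t.piecewise ε 0) y 0 = t.piecewise ε 0 := by
        rw [Function.update_eq_self_iff, Finset.piecewise_eq_of_notMem _ _ _ hy]
        rfl
      rw [Finset.piecewise_insert, Finset.sum_insert hy]
      rcases (show ε y = 0 ∨ ε y = 1 by generalize ε y = k; revert k; decide) with h | h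
      · rw [h, h0, ih]
        simp
      · rw [h, hc, h0, ih, pow_add]
        simp
  simpa using key Finset.univ

end PBT

namespace PBT
namespace Diagram

/-! ### States of planar diagrams with four ends on every circle -/

section sites

variable {n : ℕ} (T : Diagram 2 (fun _ : Fin n => 2))

/-- The places where four half-edges meet: the crossings, the holes and the outer circle. -/
abbrev Site : Type := T.X ⊕ (Fin n ⊕ Unit)

variable {T}

/-- The four half-edges at a site. -/
def siteDart : T.Site → Fin 4 → T.Darts
  | .inl x, i => .cross x i
  | .inr (.inl h), i => .hole h i
  | .inr (.inr _), i => .outer i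

/-- Following a strand through the sites, split according to `ε`. -/
def siteSplice (ε : T.Site → Fin 2) : T.Darts → T.Darts
  | .cross x i => .cross x (flatPair (ε (.inl x)) i)
  | .hole h i => .hole h (flatPair (ε (.inr (.inl h))) i)
  | .outer i => .outer (flatPair (ε (.inr (.inr ()))) i)
  | .pt p i => .pt p (i + 1)

theorem siteSplice_siteDart (ε : T.Site → Fin 2) (y : T.Site) (i : Fin 4) :
    siteSplice ε (siteDart y i) = siteDart y (flatPair (ε y) i) := by
  rcases y with x | h | _ <;> rfl

theorem dart_cases (d : T.Darts) : (∃ y i, d = siteDart y i) ∨ ∃ p i, d = .pt p i := by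
  rcases d with i | ⟨h, i⟩ | ⟨x, i⟩ | ⟨p, i⟩
  exacts [.inl ⟨.inr (.inr ()), i, rfl⟩, .inl ⟨.inr (.inl h), i, rfl⟩, .inl ⟨.inl x, i, rfl⟩,
    .inr ⟨p, i, rfl⟩]

theorem siteDart_injective (y : T.Site) : Function.Injective (siteDart y) := by
  intro i j hij
  rcases y with x | h | _
  · exact (Dart.cross.inj hij).2
  · exact eq_of_heq (Dart.hole.inj hij).2
  · exact Dart.outer.inj hij

theorem siteSplice_siteSplice (ε : T.Site → Fin 2) (d : T.Darts) :
    siteSplice ε (siteSplice ε d) = d := by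
  rcases dart_cases d with ⟨y, i, rfl⟩ | ⟨p, i, rfl⟩
  · rw [siteSplice_siteDart, siteSplice_siteDart, flatPair_flatPair]
  · simp only [siteSplice]
    congr 1
    revert i
    decide

theorem Coloring.siteDart_add_one (o : T.Coloring) (y : T.Site) (i : Fin 4) :
    o.color (siteDart y (i + 1)) = o.color (siteDart y i) + 1 := by
  rcases y with x | h | _
  · have := o.rot (.cross x i)
    rwa [Dart.rot, finRotate_apply] at this
  · have := o.rot (.hole h i)
    rwa [Dart.rot, finRotate_apply] at this
  · have := o.rot (.outer (finRotate _ i))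
    rw [Dart.rot, Equiv.symm_apply_apply, finRotate_apply] at this
    change o.color (.outer (i + 1)) = o.color (.outer i) + 1
    rw [this, add_assoc, CharTwo.add_self_eq_zero, add_zero]

/-- Both flat pairings join neighbouring half-edges, and colours alternate around a site. -/
theorem Coloring.siteDart_flatPair (o : T.Coloring) (y : T.Site) (k : Fin 2) (i : Fin 4) :
    o.color (siteDart y (flatPair k i)) = o.color (siteDart y i) + 1 := by
  have h : flatPair k i = i + 1 ∨ flatPair k i = i + 1 + 1 + 1 := by
    revert k i
    decide
  rcases h with h | h <;> rw [h]
  · exact o.siteDart_add_one y i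
  · rw [o.siteDart_add_one, o.siteDart_add_one, o.siteDart_add_one, add_assoc,
      add_assoc, ← add_assoc (1 : ZMod 2), CharTwo.add_self_eq_zero, zero_add]

theorem Coloring.siteSplice (o : T.Coloring) (ε : T.Site → Fin 2) (d : T.Darts) :
    o.color (siteSplice ε d) = o.color d + 1 := by
  rcases dart_cases d with ⟨y, i, rfl⟩ | ⟨p, i, rfl⟩
  · rw [siteSplice_siteDart, o.siteDart_flatPair]
  · have := o.rot (.pt p i)
    rwa [Dart.rot, finRotate_apply] at this

/-- The number of circles of the diagram split at all sites. -/
noncomputable def numLoops (ε : T.Site → Fin 2) : ℕ :=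
  Nat.card (Quot fun a b : T.Darts => b = T.opp a ∨ b = siteSplice ε a)

open Classical in
theorem Coloring.neg_one_pow_numLoops_update (o : T.Coloring) (ε : T.Site → Fin 2) (y : T.Site) :
    (-1 : ℤˣ) ^ numLoops (Function.update ε y 1) = -(-1) ^ numLoops (Function.update ε y 0) := by
  refine neg_one_pow_card_circles (o := o.color) T.opp_opp (siteSplice_siteSplice _)
    (siteSplice_siteSplice _) o.opp (o.siteSplice _) (o.siteSplice _) (siteDart y)
    (siteDart_injective y) (o.siteDart_add_one y) ?_ ?_ ?_
  · intro i
    rw [siteSplice_siteDart, Function.update_self]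
  · intro i
    rw [siteSplice_siteDart, Function.update_self]
  · intro d hd
    rcases dart_cases d with ⟨y', i, rfl⟩ | ⟨p, i, rfl⟩
    · have hy : y' ≠ y := by
        rintro rfl
        exact hd i rfl
      rw [siteSplice_siteDart, siteSplice_siteDart, Function.update_of_ne hy,
        Function.update_of_ne hy]
    · rfl

theorem Coloring.neg_one_pow_numLoops [Fintype T.X] (o : T.Coloring) (ε : T.Site → Fin 2) :
    (-1 : ℤˣ) ^ numLoops ε = (-1) ^ numLoops (0 : T.Site → Fin 2) * (-1) ^ ∑ y, (ε y : ℕ) := by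
  classical
  exact eq_mul_neg_one_pow_of_update (fun ε => (-1 : ℤˣ) ^ numLoops ε)
    (fun ε y => o.neg_one_pow_numLoops_update ε y) ε

/-- The splittings of all sites given by a state, the fundamental tangles in the holes and a pairing
of the outer ends. -/
def siteState (σ : T.X → Bool) (a : Fin n → Fin 2) (k : Fin 2) : T.Site → Fin 2 :=
  Sum.elim (fun x => if σ x then 1 else 0) (Sum.elim a fun _ => k)

variable (σ : T.X → Bool) (a : Fin n → Fin 2) (k : Fin 2)

/-- Closing the outer circle by `flat k` joins only ends that already lie on a common strand, hence
creates no new connection. -/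
theorem strands_siteSplice (hk : flat k ≤ T.part σ fun h => flat (a h)) (d : T.Darts) :
    T.strands σ (fun h => flat (a h)) d (siteSplice (siteState σ a k) d) := by
  rcases d with i | ⟨h, i⟩ | ⟨x, i⟩ | ⟨p, i⟩
  · exact hk (.inr rfl)
  · exact T.strands_hole _ _ (.inr rfl)
  · have := T.strands_splice σ (fun h => flat (a h)) (.cross x i)
    simp only [splice, siteSplice, siteState, Sum.elim_inl, flatPair] at this ⊢
    by_cases h : σ x = true
    · simpa [h] using this
    · simpa [h] using this
  · exact T.strands_splice σ (fun h => flat (a h)) (.pt p i)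

theorem mk_eq_of_strands {d d' : T.Darts} (h : T.strands σ (fun h => flat (a h)) d d') :
    (Quot.mk (fun b b' : T.Darts => b' = T.opp b ∨ b' = siteSplice (siteState σ a k) b) d) =
      Quot.mk _ d' := by
  have hs : ∀ d, (Quot.mk (fun b b' : T.Darts => b' = T.opp b ∨
      b' = siteSplice (siteState σ a k) b) d) = Quot.mk _ (siteSplice (siteState σ a k) d) :=
    fun d => Quot.sound (.inr rfl)
  refine strands_apply_eq (Quot.mk fun b b' : T.Darts => b' = T.opp b ∨
    b' = siteSplice (siteState σ a k) b) (fun d => Quot.sound (.inl rfl)) ?_ ?_ h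
  · rintro (i | ⟨h, i⟩ | ⟨x, i⟩ | ⟨p, i⟩)
    · rfl
    · rfl
    · have := hs (.cross x i)
      simp only [splice, siteSplice, siteState, Sum.elim_inl, flatPair] at this ⊢
      by_cases h : σ x = true
      · simpa [h] using this
      · simpa [h] using this
    · exact hs (.pt p i)
  · rintro h i j (rfl | rfl)
    · rfl
    · exact hs (.hole h i)

/-- The number of circles if the outer ends are paired along strands. -/
theorem numLoops_eq_card (hk : flat k ≤ T.part σ fun h => flat (a h)) :
    numLoops (siteState σ a k) = Nat.card (Quotient (T.strands σ fun h => flat (a h))) := by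
  refine Nat.card_congr
    { toFun := Quot.lift (Quotient.mk _) ?_
      invFun := Quotient.lift (Quot.mk _) ?_
      left_inv := ?_
      right_inv := ?_ }
  · rintro d d' (rfl | rfl)
    · exact Quotient.sound (T.strands_opp _ _ d)
    · exact Quotient.sound (strands_siteSplice σ a k hk d)
  · exact fun d d' h => mk_eq_of_strands σ a k h
  · rintro ⟨d⟩
    rfl
  · rintro ⟨d⟩
    rfl

end sites

/-- Every strand is closed or has an outer end. -/
theorem card_strands {m₀ : ℕ} {H : Type} {m : H → ℕ} (D : Diagram m₀ m) (σ : D.X → Bool)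
    (r : ∀ h, Setoid (Fin (2 * m h))) :
    Nat.card (Quotient (D.strands σ r)) = Nat.card (Quotient (D.part σ r)) + D.closed σ r := by
  classical
  let f : Quotient (D.part σ r) → {c : Quotient (D.strands σ r) //
      ¬ ∀ i, Quotient.mk _ (Dart.outer i) ≠ c} :=
    Quotient.lift (fun i => ⟨Quotient.mk _ (.outer i), fun h => h i rfl⟩)
      fun i j hij => Subtype.ext (Quotient.sound hij)
  have hf : Function.Bijective f := by
    constructor
    · rintro ⟨i⟩ ⟨j⟩ hij
      have h : Quotient.mk (D.strands σ r) (.outer i) = Quotient.mk _ (.outer j) :=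
        congrArg Subtype.val hij
      have h' : D.strands σ r (.outer i) (.outer j) := Quotient.exact h
      exact Quotient.sound h'
    · rintro ⟨c, hc⟩
      simp only [ne_eq, not_forall, not_not] at hc
      obtain ⟨i, rfl⟩ := hc
      exact ⟨Quotient.mk _ i, rfl⟩
  rw [Nat.card_congr (Equiv.ofBijective f hf), closed, add_comm, ← Nat.card_sum]
  exact Nat.card_congr (Equiv.sumCompl _).symm

/-! ### Connections of ends and signs of states in planar diagrams -/

section planar

variable {n : ℕ} {T : Diagram 2 (fun _ : Fin n => 2)}
variable (σ : T.X → Bool) (a : Fin n → Fin 2) (k : Fin 2)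

/-- The sign of a colour. -/
def colorSign (c : ZMod 2) : ℤ := if c = 0 then 1 else -1

theorem colorSign_add_one : ∀ c, colorSign (c + 1) = -colorSign c := by decide

open Classical in
/-- The ends of a strand have balanced colours. -/
theorem Coloring.sum_outer (o : T.Coloring) (d₀ : T.Darts) :
    ∑ i : Fin 4, (if T.strands σ (fun h => flat (a h)) (.outer i) d₀ then
      colorSign (o.color (.outer i)) else 0) = 0 := by
  have := T.finite_X
  have := T.finite_P
  have := Fintype.ofFinite T.X
  have := Fintype.ofFinite T.P
  let F : T.Darts → ℤ := fun d =>
    if T.strands σ (fun h => flat (a h)) d d₀ then colorSign (o.color d) else 0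
  have hF : ∀ d d', T.strands σ (fun h => flat (a h)) d d' → o.color d' = o.color d + 1 →
      F d' = -F d := by
    intro d d' h hc
    have : T.strands σ (fun h => flat (a h)) d' d₀ ↔ T.strands σ (fun h => flat (a h)) d d₀ :=
      ⟨strands_trans h, strands_trans (strands_symm h)⟩
    simp only [F, this, hc, colorSign_add_one]
    split_ifs <;> simp
  -- The two halves of an edge lie on the same strand and have opposite colours.
  have htot : ∑ d, F d = 0 := by
    have h1 : ∑ d, F (T.opp d) = ∑ d, F d :=
      Equiv.sum_comp (Function.Involutive.toPerm T.opp T.opp_opp) F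
    have h2 : ∑ d, F (T.opp d) = -∑ d, F d := by
      rw [← Finset.sum_neg_distrib]
      exact Finset.sum_congr rfl fun d _ => hF d _ (T.strands_opp _ _ d) (o.opp d)
    omega
  -- At a crossing or a hole the half-edges cancel in the pairs joined by the strands, so only the
  -- outer ends remain in the total.
  have hfour : ∀ (y : T.Site) (k : Fin 2), (∀ i, T.strands σ (fun h => flat (a h)) (siteDart y i)
      (siteDart y (flatPair k i))) → ∑ i, F (siteDart y i) = 0 := by
    intro y k h
    have h1 := fun i => hF _ _ (h i) (o.siteDart_flatPair y k i)
    have h0 := h1 0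
    have h2 := h1 2
    rw [Fin.sum_univ_four]
    fin_cases k
    · change F (siteDart y 3) = _ at h0
      change F (siteDart y 1) = _ at h2
      omega
    · change F (siteDart y 1) = _ at h0
      change F (siteDart y 3) = _ at h2
      omega
  rw [← T.dartSum.sum_comp, Fintype.sum_sum_type, Fintype.sum_sum_type, Fintype.sum_sum_type,
    Fintype.sum_sigma, Fintype.sum_prod_type, Fintype.sum_prod_type] at htot
  have h2 : ∀ h, ∑ i, F (.hole h i) = 0 := fun h =>
    hfour (.inr (.inl h)) (a h) fun i => T.strands_hole _ _ (.inr rfl)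
  have h3 : ∀ x, ∑ i, F (.cross x i) = 0 := fun x => by
    refine hfour (.inl x) (if σ x then 1 else 0) fun i => ?_
    have := T.strands_splice σ (fun h => flat (a h)) (.cross x i)
    simp only [splice, siteDart, flatPair] at this ⊢
    by_cases h : σ x = true
    · simpa [h] using this
    · simpa [h] using this
  have h4 : ∀ p, ∑ i, F (.pt p i) = 0 := fun p => by
    have h := hF (.pt p 0) (.pt p 1) (T.strands_splice _ _ (.pt p 0)) (o.rot (.pt p 0))
    rw [Fin.sum_univ_two, h]
    omega
  simp only [dartSum, Equiv.coe_fn_mk, Sum.elim_inl, Sum.elim_inr, h2, h3, h4,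
    Finset.sum_const_zero, add_zero] at htot
  exact htot

/-- Every block contains as many even as odd ends, so the blocks are two pairs of cyclic neighbours
or a single block of four. -/
theorem eq_flat_of_balanced (p : Setoid (Fin 4)) [DecidableRel p]
    (h : ∀ j, ∑ i : Fin 4, (if p i j then (-1 : ℤ) ^ (i : ℕ) else 0) = 0) :
    (∃ k, p = flat k) ∨ p = ⊤ := by
  -- Written as a kernel, the partition ranges over finitely many functions and the claim is
  -- decidable.
  obtain ⟨f, rfl⟩ : ∃ f : Fin 4 → Fin 4, p = Setoid.ker f :=
    ⟨fun i => (Quotient.mk p i).out, by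
      ext i j
      rw [Setoid.ker_def, Quotient.out_inj, Quotient.eq]⟩
  have key : ∀ f : Fin 4 → Fin 4,
      (∀ j, ∑ i : Fin 4, (if f i = f j then (-1 : ℤ) ^ (i : ℕ) else 0) = 0) →
      (∃ k, ∀ i j, f i = f j ↔ j = i ∨ j = flatPair k i) ∨ ∀ i j, f i = f j := by
    decide +kernel
  rcases key f (fun j => by
      have := h j
      simp only [Setoid.ker_def] at this
      convert this) with ⟨k, hk⟩ | hk
  · exact .inl ⟨k, Setoid.ext hk⟩
  · exact .inr (Setoid.ext fun i j => iff_of_true (hk i j) trivial)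

/-- The ends of a planar diagram are connected as in a fundamental tangle. -/
theorem Planar.exists_part_eq_flat (hT : T.Planar) :
    ∃ k, T.part σ (fun h => flat (a h)) = flat k := by
  classical
  obtain ⟨o⟩ := hT.nonempty_coloring
  have ho : ∀ i : Fin 4, colorSign (o.color (.outer i)) =
      colorSign (o.color (.outer 0)) * (-1) ^ (i : ℕ) := by
    have h := fun i => (congrArg colorSign (o.siteDart_add_one (.inr (.inr ())) i)).trans
      (colorSign_add_one _)
    intro i
    have h0 := h 0
    have h1 := h 1
    have h2 := h 2
    simp only [siteDart] at h0 h1 h2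
    change colorSign (o.color (.outer 1)) = -colorSign (o.color (.outer 0)) at h0
    change colorSign (o.color (.outer 2)) = -colorSign (o.color (.outer 1)) at h1
    change colorSign (o.color (.outer 3)) = -colorSign (o.color (.outer 2)) at h2
    fin_cases i
    · change colorSign (o.color (.outer 0)) = _; simp
    · change colorSign (o.color (.outer 1)) = _; rw [h0]; simp
    · change colorSign (o.color (.outer 2)) = _; rw [h1, h0]; simp
    · change colorSign (o.color (.outer 3)) = _; rw [h2, h1, h0]; norm_num
  have hne : ∀ c, colorSign c ≠ 0 := by decide
  rcases eq_flat_of_balanced (T.part σ fun h => flat (a h)) (fun j => by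
    have := o.sum_outer σ a (.outer j)
    refine (mul_eq_zero.1 (Eq.trans ?_ this)).resolve_left (hne (o.color (.outer 0)))
    rw [Finset.mul_sum]
    refine Finset.sum_congr rfl fun i _ => ?_
    rw [ho i, mul_ite, mul_zero]
    rfl) with h | h
  · exact h
  -- If all four ends were connected, both pairings of the outer ends would give the same number of
  -- circles, whereas switching the pairing changes its parity.
  · exfalso
    have e : ∀ k, numLoops (siteState σ a k) =
        Nat.card (Quotient (T.strands σ fun h => flat (a h))) :=
      fun k => numLoops_eq_card σ a k (h ▸ le_top)
    have hu : ∀ k, siteState σ a k = Function.update (siteState σ a 0) (.inr (.inr ())) k := by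
      intro k
      ext (x | h | u)
      · rw [Function.update_of_ne (by simp)]; rfl
      · rw [Function.update_of_ne (by simp)]; rfl
      · rw [show (Sum.inr (Sum.inr u) : T.Site) = .inr (.inr ()) from rfl, Function.update_self]
        rfl
    have := o.neg_one_pow_numLoops_update (siteState σ a 0) (.inr (.inr ()))
    rw [← hu, ← hu, e, e] at this
    rcases Nat.even_or_odd (Nat.card (Quotient (T.strands σ fun h => flat (a h)))) with h | h
    · rw [h.neg_one_pow] at this; exact absurd this (by decide)
    · rw [h.neg_one_pow] at this; exact absurd this (by decide)

theorem card_quotient_flat (k : Fin 2) : Nat.card (Quotient (flat k)) = 2 := by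
  let f : Fin 4 → Fin 2 := if k = 0 then ![0, 1, 1, 0] else ![0, 0, 1, 1]
  have hf : ∀ i j, f i = f j ↔ j = i ∨ j = flatPair k i := by
    revert k; decide
  have hs : Function.Surjective f := by
    revert k; decide
  let g : Quotient (flat k) → Fin 2 := Quotient.lift f fun i j h => (hf i j).2 h
  have hg : Function.Bijective g := by
    constructor
    · rintro ⟨i⟩ ⟨j⟩ hij
      exact Quotient.sound ((hf i j).1 hij)
    · intro k
      obtain ⟨i, hi⟩ := hs k
      exact ⟨Quotient.mk _ i, hi⟩
  rw [Nat.card_congr (Equiv.ofBijective g hg), Nat.card_eq_fintype_card, Fintype.card_fin]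

/-- The parity of the number of splittings of type A in states without closed strands. -/
theorem Planar.exists_sign [Fintype T.X] (hT : T.Planar) : ∃ c : ℤˣ,
    ∀ (σ : T.X → Bool) (a : Fin n → Fin 2) (k : Fin 2),
    T.part σ (fun h => flat (a h)) = flat k → T.closed σ (fun h => flat (a h)) = 0 →
      (-1 : ℤˣ) ^ (Nat.card {x // σ x = true} + (∑ h, (a h : ℕ) + k)) = c := by
  obtain ⟨o⟩ := hT.nonempty_coloring
  -- The constant is read off from the reference splitting with index `0` at every site.
  refine ⟨(-1) ^ numLoops (0 : T.Site → Fin 2), fun σ a k hp hc => ?_⟩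
  have h1 := o.neg_one_pow_numLoops (siteState σ a k)
  -- Without closed strands there are exactly two circles, one for each class of `flat k`, so the
  -- left side is `1`.
  rw [numLoops_eq_card σ a k hp.ge, card_strands, hc, hp] at h1
  have h2 : Nat.card (Quotient (flat k)) = 2 := card_quotient_flat k
  rw [h2, Fintype.sum_sum_type, Fintype.sum_sum_type] at h1
  have h3 : ∑ x, (siteState σ a k (.inl x) : ℕ) = Nat.card {x // σ x = true} := by
    rw [Nat.card_eq_fintype_card, Fintype.card_subtype, Finset.card_filter]
    refine Finset.sum_congr rfl fun x _ => ?_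
    by_cases h : σ x = true <;> simp [siteState, h]
  rw [h3] at h1
  simp only [siteState, Sum.elim_inr, Sum.elim_inl, Finset.univ_unique, Finset.sum_singleton] at h1
  rw [add_zero, neg_one_sq] at h1
  rw [← mul_right_inj ((-1 : ℤˣ) ^ numLoops (0 : T.Site → Fin 2)), ← h1, ← pow_add, ← two_mul]
  simp

end planar

end Diagram
end PBT

namespace PBT
namespace Diagram

/-! ### Brackets as state sums -/

theorem numCircles_eq_closed (L : Holeless 0) (σ : L.X → Bool)
    (r : Fin 0 → Setoid (Fin (2 * 2))) : numCircles L σ = L.closed σ r := by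
  rw [closed_eq_card (f := Quot.mk fun a b : L.Darts => b = L.opp a ∨ b = L.splice σ a) ?_
    Quot.mk_surjective]
  · exact Nat.card_congr (Equiv.subtypeUnivEquiv fun _ i => i.elim0).symm
  · intro a b
    constructor
    · intro h
      have := congrArg (Quot.lift (Quotient.mk (L.strands σ r)) (by
        rintro a b (rfl | rfl)
        · exact Quotient.sound (L.strands_opp σ r a)
        · exact Quotient.sound (L.strands_splice σ r a))) h
      exact Quotient.exact this
    · exact strands_apply_eq (Quot.mk fun a b : L.Darts => b = L.opp a ∨ b = L.splice σ a)
        (fun a => Quot.sound (Or.inl rfl)) (fun a => Quot.sound (Or.inr rfl)) fun h => h.elim0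

/-- Indices are crossed: the arcs of closure `k` pair the ends as the fundamental tangle `1 - k`
does. Hence closure `k` turns the tangle `k` into one circle and the other tangle into two. -/
theorem closer_opp (k : Fin 2) (h : Fin 1) (i : Fin 4) :
    (closer k).opp (.hole h i) = .hole h (flatPair (1 - k) i) := by
  fin_cases k <;> fin_cases i <;> rfl

/-- A flat partition is the kernel of a labelling. -/
def flatLabel (k : Fin 2) : Fin 4 → Fin 2 := if k = 0 then ![0, 1, 1, 0] else ![0, 0, 1, 1]

theorem flatLabel_eq_iff : ∀ (k : Fin 2) (i j : Fin 4),
    flatLabel k i = flatLabel k j ↔ j = i ∨ j = flatPair k i := by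
  decide

theorem flatLabel_surjective : ∀ k : Fin 2, Function.Surjective (flatLabel k) := by
  decide

/-- The arcs outside repeat the pairing inside, so each pair of ends closes up by itself. -/
theorem closer_closed_of_ne (k : Fin 2) (σ : (closer k).X → Bool) :
    (closer k).closed σ (fun _ => flat (1 - k)) = 2 := by
  let f : (closer k).Darts → Fin 2
    | .outer i => i.elim0
    | .hole _ i => flatLabel (1 - k) i
    | .cross x _ => x.elim
    | .pt p _ => p.elim
  have hf : ∀ i, flatLabel (1 - k) (flatPair (1 - k) i) = flatLabel (1 - k) i := fun i =>
    ((flatLabel_eq_iff (1 - k) i _).2 (.inr rfl)).symm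
  rw [closed_eq_card (f := f)]
  · rw [Nat.card_congr (Equiv.subtypeUnivEquiv fun _ i => i.elim0), Nat.card_eq_fintype_card,
      Fintype.card_fin]
  · rintro (i | ⟨h, i⟩ | ⟨⟨⟩, -⟩ | ⟨⟨⟩, -⟩) (j | ⟨h', j⟩ | ⟨⟨⟩, -⟩ | ⟨⟨⟩, -⟩)
    · exact i.elim0
    · exact i.elim0
    · exact j.elim0
    obtain rfl : h = h' := Subsingleton.elim _ _
    constructor
    · intro hij
      exact (closer k).strands_hole σ _ ((flatLabel_eq_iff _ i j).1 hij)
    · refine strands_apply_eq f ?_ ?_ ?_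
      · rintro (i | ⟨h, i⟩ | ⟨⟨⟩, -⟩ | ⟨⟨⟩, -⟩)
        · exact i.elim0
        · rw [closer_opp]
          exact (hf i).symm
      · rintro (i | ⟨h, i⟩ | ⟨⟨⟩, -⟩ | ⟨⟨⟩, -⟩) <;> rfl
      · intro h i j hij
        exact (flatLabel_eq_iff _ i j).2 hij
  · intro l
    obtain ⟨i, hi⟩ := flatLabel_surjective (1 - k) l
    exact ⟨.hole 0 i, hi⟩

/-- The two different pairings of four ends alternate along one circle. -/
theorem closer_closed_self (k : Fin 2) (σ : (closer k).X → Bool) :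
    (closer k).closed σ (fun _ => flat k) = 1 := by
  rw [closed_eq_card (f := fun _ => ())]
  · rw [Nat.card_congr (Equiv.subtypeUnivEquiv fun _ i => i.elim0), Nat.card_unique]
  · have h1 : ∀ i, (closer k).strands σ (fun _ => flat k) (.hole 0 i)
        (.hole 0 (flatPair (1 - k) i)) := by
      intro i
      rw [← closer_opp]
      exact strands_opp _ _ _ _
    have h2 : ∀ i, (closer k).strands σ (fun _ => flat k) (.hole 0 i) (.hole 0 (flatPair k i)) :=
      fun i => strands_hole _ _ _ (.inr rfl)
    have key : ∀ i, (closer k).strands σ (fun _ => flat k) (.hole 0 0) (.hole 0 i) := by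
      have h3 : ∀ k i : Fin 2, ∀ i : Fin 4, 0 = i ∨ flatPair (1 - k) 0 = i ∨ flatPair k 0 = i ∨
          flatPair k (flatPair (1 - k) 0) = i := by decide
      intro i
      rcases h3 k 0 i with rfl | rfl | rfl | rfl
      exacts [Setoid.refl' _ _, h1 0, h2 0, strands_trans (h1 0) (h2 _)]
    have key' : ∀ d, (closer k).strands σ (fun _ => flat k) (.hole 0 0) d := by
      rintro (i | ⟨h, i⟩ | ⟨⟨⟩, -⟩ | ⟨⟨⟩, -⟩)
      · exact i.elim0
      · obtain rfl : h = 0 := Subsingleton.elim _ _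
        exact key i
    exact fun a b => iff_of_true rfl (strands_trans (strands_symm (key' a)) (key' b))
  · exact fun _ => ⟨.hole 0 0, rfl⟩

/-- The crossings of the closure of a ball tangle diagram. -/
def closureX (k : Fin 2) (B : Holeless 2) : B.X ≃ (closure k B).X where
  toFun x := .inr ⟨0, x⟩
  invFun
    | .inl x => x.elim
    | .inr q => q.2
  left_inv _ := rfl
  right_inv
    | .inl x => x.elim
    | .inr ⟨h, x⟩ => by
      obtain rfl : h = 0 := Subsingleton.elim _ _
      rfl

/-- The only state of the diagram of a closure. -/
def closerState (k : Fin 2) : (closer k).X → Bool := Empty.elim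

theorem closure_closed (k : Fin 2) (B : Holeless 2) (σ : (closure k B).X → Bool)
    (r : Fin 0 → Setoid (Fin (2 * 2))) : (closure k B).closed σ r =
      (closer k).closed (closerState k) (fun _ => B.part (fun x => σ (closureX k B x)) r) +
        B.closed (fun x => σ (closureX k B x)) r := by
  let e : Fin 0 ≃ (Σ _ : Fin 1, Fin 0) :=
    ⟨fun i => i.elim0, fun q => q.2, fun i => i.elim0, fun q => q.2.elim0⟩
  let s : (q : Σ _ : Fin 1, Fin 0) → Setoid (Fin (2 * 2)) := fun q => q.2.elim0
  have h1 : (closure k B).closed σ (fun i => s (e i)) = ((closer k).comp fun _ => B).closed σ s :=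
    relabel_closed _ e σ s
  have h2 := comp_closed (C := closer k) (S := fun _ => B) σ s
  rw [Fin.sum_univ_one] at h2
  have hr : ∀ r r' : Fin 0 → Setoid (Fin (2 * 2)), r = r' := fun r r' => funext fun i => i.elim0
  have h3 : innerPart (C := closer k) (S := fun _ => B) σ s =
      fun _ => B.part (fun x => σ (closureX k B x)) r := by
    funext h
    obtain rfl : h = 0 := Subsingleton.elim _ _
    exact congrArg (B.part fun x => σ (closureX k B x)) (hr _ _)
  have h4 : (fun i => s ⟨0, i⟩) = r := hr _ _
  rw [hr r fun i => s (e i), h1, h2, h3, hr r fun i => s ⟨0, i⟩]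
  congr 2
  exact funext fun x => x.elim

/-- The bracket of a closure of a planar ball tangle diagram. -/
theorem bracket_closure (k : Fin 2) {B : Holeless 2} (hB : B.Planar)
    (r : Fin 0 → Setoid (Fin (2 * 2))) :
    bracket root8 (closure k B) = val root8 0 B r (flat k) := by
  obtain rfl : r = fun h => flat (Fin.elim0 h) := funext fun h => h.elim0
  rw [val, ← finsum_comp_equiv ((closureX k B).arrowCongr (Equiv.refl Bool)).symm]
  refine finsum_congr fun σ => ?_
  have h1 : ((closureX k B).arrowCongr (Equiv.refl Bool)).symm σ =
      fun x => σ (closureX k B x) := rfl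
  rw [h1, weight_comp_equiv, root8_delta, numCircles_eq_closed _ _ fun h => flat (Fin.elim0 h),
    closure_closed]
  change weight root8 σ * _ = _
  rw [mul_assoc]
  congr 1
  obtain ⟨l, hl⟩ := hB.exists_part_eq_flat (fun x => σ (closureX k B x)) Fin.elim0
  rw [hl]
  -- If `l = k`, the closure adds one circle, removed again by the exponent `d - 1`. Otherwise it
  -- adds two, the exponent is positive and the term is a power of zero.
  by_cases hk : l = k
  · subst hk
    rw [closer_closed_self, Nat.add_sub_cancel_left, if_pos rfl, mul_one]
  · obtain rfl : l = 1 - k := (show ∀ l k : Fin 2, l ≠ k → l = 1 - k by decide) l k hk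
    rw [closer_closed_of_ne, zero_pow (by omega), if_neg fun h => hk (flat_injective h), mul_zero]

/-! ### Fundamental tangles and fillings -/

theorem fundamental_opp (k : Fin 2) (i : Fin 4) :
    (fundamental k).opp (.outer i) = .outer (flatPair k i) := by
  fin_cases k <;> fin_cases i <;> rfl

theorem fundamental_planar (k : Fin 2) : (fundamental k).Planar := by
  rw [planar_iff_exists_isBoundary]
  intro x hx
  have hxo : ∀ i : Fin 4, x (.outer (flatPair k i)) = x (.outer i) := fun i => by
    rw [← fundamental_opp, hx.opp]
  -- The region cut off by each strand receives the coefficient of that strand and the middle region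
  -- receives `0`. The condition selects the alternate ends that represent the two cut-off regions.
  refine ⟨fun
    | .outer i => if flatLabel 0 i = flatLabel 1 i ↔ k = 1 then x (.outer i) else 0
    | _ => 0, ?_, ?_⟩
  · rintro (i | ⟨h, i⟩ | ⟨⟨⟩, -⟩ | ⟨⟨⟩, -⟩)
    · rw [fundamental_opp]
      fin_cases k <;> fin_cases i <;> rfl
    · exact h.elim0
  · rintro (i | ⟨h, i⟩ | ⟨⟨⟩, -⟩ | ⟨⟨⟩, -⟩)
    · rw [fundamental_opp]
      fin_cases k <;> fin_cases i <;>
        first | exact (add_zero _).symm | exact (hxo _).symm.trans (zero_add _).symm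
    · exact h.elim0

theorem fundamental_part (k : Fin 2) (σ : (fundamental k).X → Bool)
    (r : Fin 0 → Setoid (Fin (2 * 2))) : (fundamental k).part σ r = flat k := by
  let f : (fundamental k).Darts → Quotient (flat k)
    | .outer i => Quotient.mk _ i
    | .hole h _ => h.elim0
    | .cross x _ => x.elim
    | .pt p _ => p.elim
  refine le_antisymm (fun i j hij => ?_) fun i j hij => ?_
  · have : f (.outer i) = f (.outer j) := by
      refine strands_apply_eq f ?_ ?_ (fun h => h.elim0) hij
      · rintro (i | ⟨h, i⟩ | ⟨⟨⟩, -⟩ | ⟨⟨⟩, -⟩)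
        · rw [fundamental_opp]
          exact Quotient.sound (.inr rfl)
        · exact h.elim0
      · rintro (i | ⟨h, i⟩ | ⟨⟨⟩, -⟩ | ⟨⟨⟩, -⟩) <;> rfl
    exact Quotient.exact this
  · rcases hij with rfl | rfl
    · exact Setoid.refl' _ _
    · have := (fundamental k).strands_opp σ r (.outer i)
      rwa [fundamental_opp] at this

theorem fundamental_closed (k : Fin 2) (σ : (fundamental k).X → Bool)
    (r : Fin 0 → Setoid (Fin (2 * 2))) : (fundamental k).closed σ r = 0 := by
  rw [closed, Nat.card_eq_zero]
  left
  constructor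
  rintro ⟨⟨i | ⟨h, i⟩ | ⟨⟨⟩, -⟩ | ⟨⟨⟩, -⟩⟩, hc⟩
  · exact hc i rfl
  · exact h.elim0

open Classical in
theorem val_fundamental (A δ : ℂ) (k : Fin 2) (r : Fin 0 → Setoid (Fin (2 * 2)))
    (p : Setoid (Fin (2 * 2))) :
    val A δ (fundamental k) r p = if p = flat k then 1 else 0 := by
  have : Unique ((fundamental k).X → Bool) := inferInstanceAs (Unique (Empty → Bool))
  have : Fintype (fundamental k).X := inferInstanceAs (Fintype Empty)
  have : IsEmpty (fundamental k).X := inferInstanceAs (IsEmpty Empty)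
  rw [val, finsum_unique, fundamental_part, fundamental_closed, weight_eq_prod,
    Finset.univ_eq_empty, Finset.prod_empty, pow_zero, one_mul, one_mul]
  exact if_congr eq_comm rfl rfl

open Classical in
theorem val_fill {m₀ : ℕ} {H : Type} {m : H → ℕ} [Fintype H] (A δ : ℂ) (T : Diagram m₀ m)
    (B : (h : H) → Holeless (m h)) (r : Fin 0 → Setoid (Fin (2 * 2))) (p : Setoid (Fin (2 * m₀))) :
    val A δ (T.fill B) r p = ∑ q : (h : H) → Setoid (Fin (2 * m h)),
      (∏ h, val A δ (B h) r (q h)) * val A δ T q p := by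
  let e : Fin 0 ≃ (Σ _ : H, Fin 0) :=
    ⟨fun i => i.elim0, fun q => q.2, fun i => i.elim0, fun q => q.2.elim0⟩
  let s : (q : Σ _ : H, Fin 0) → Setoid (Fin (2 * 2)) := fun q => q.2.elim0
  have hr : ∀ r r' : Fin 0 → Setoid (Fin (2 * 2)), r = r' := fun r r' => funext fun i => i.elim0
  have h1 : val A δ (T.fill B) (fun i => s (e i)) p = val A δ (T.comp B) s p :=
    val_relabel A δ _ e s p
  rw [hr r fun i => s (e i), h1, val_comp]
  refine Finset.sum_congr rfl fun q _ => ?_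
  congr 1

/-- No state of a planar ball tangle contributes to a partition which is not flat, so sums over
partitions reduce to the fundamental tangles. -/
theorem val_eq_zero {B : Holeless 2} (hB : B.Planar) (A δ : ℂ) (r : Fin 0 → Setoid (Fin (2 * 2)))
    {p : Setoid (Fin (2 * 2))} (hp : ∀ k, p ≠ flat k) : val A δ B r p = 0 := by
  obtain rfl : r = fun h => flat (Fin.elim0 h) := funext fun h => h.elim0
  refine (finsum_congr (g := fun _ => (0 : ℂ)) fun σ => ?_).trans finsum_zero
  obtain ⟨k, hk⟩ := hB.exists_part_eq_flat σ Fin.elim0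
  rw [hk, if_neg (hp k).symm, mul_zero]

/-- The expansion of a filling with planar ball tangle diagrams. -/
theorem val_fill_planar {n : ℕ} (A δ : ℂ) (T : Diagram 2 (fun _ : Fin n => 2))
    (B : Fin n → Holeless 2) (hB : ∀ h, (B h).Planar) (r : Fin 0 → Setoid (Fin (2 * 2)))
    (p : Setoid (Fin (2 * 2))) : val A δ (T.fill B) r p = ∑ a : Fin n → Fin 2,
      (∏ h, val A δ (B h) r (flat (a h))) * val A δ T (fun h => flat (a h)) p := by
  classical
  rw [val_fill]
  symm
  -- The families of flat partitions form a subset of all families; outside it one factor of the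
  -- product is zero.
  convert Fintype.sum_of_injective (M := ℂ) (fun (a : Fin n → Fin 2) h => flat (a h)) ?_
    (fun a => (∏ h, val A δ (B h) r (flat (a h))) * val A δ T (fun h => flat (a h)) p)
    (fun q => (∏ h, val A δ (B h) r (q h)) * val A δ T q p) ?_ fun _ => rfl using 2
  · exact congrArg (@Finset.univ _) (Subsingleton.elim _ _)
  · intro a b hab
    exact funext fun h => flat_injective (congrFun hab h)
  · intro q hq
    have : ∃ h, ∀ k, q h ≠ flat k := by
      by_contra! hc
      choose a ha using hc
      exact hq ⟨a, funext fun h => (ha h).symm⟩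
    obtain ⟨h, hh⟩ := this
    rw [Finset.prod_eq_zero (Finset.mem_univ h) (val_eq_zero (hB h) A δ r hh), zero_mul]

end Diagram

/-! ### The matrix of brackets -/

open Diagram

variable {n : ℕ}

/-- The state sum of a fundamental tangle is an indicator, so filling the holes with `α` selects one
term of the expansion, and closure `k` selects the partition `flat k`. -/
theorem bracket_linkOf (T : TangleDiagram n) (k : Fin 2) (α : Fin n → Fin 2) :
    bracket root8 (linkOf T k α) = val root8 0 T.1 (fun h => flat (α h)) (flat k) := by
  have hp := fun h => fundamental_planar (α h)
  rw [linkOf, bracket_closure k (T.2.fill _ hp) fun h => h.elim0, val_fill_planar _ _ _ _ hp,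
    Finset.sum_eq_single α]
  · simp [val_fundamental]
  · intro a _ ha
    obtain ⟨h, hh⟩ := Function.ne_iff.1 ha
    rw [Finset.prod_eq_zero (Finset.mem_univ h), zero_mul]
    rw [val_fundamental, if_neg fun e => hh (flat_injective e)]
  · simp

theorem bracketMatrix_apply (T : TangleDiagram n) (k : Fin 2) (i : Fin (2 ^ n)) :
    bracketMatrix T k i = (-Complex.I) ^ expSeq n i * Complex.I ^ (k : ℕ) *
      val root8 0 T.1 (fun h => flat (lexTuple n i h)) (flat k) := by
  rw [← bracket_linkOf]
  rfl

theorem expSeq_eq_sum (n i : ℕ) : expSeq n i = ∑ j, (lexTuple n i j : ℕ) := by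
  induction n generalizing i with
  | zero => simp [expSeq]
  | succ n ih =>
    rw [Fin.sum_univ_succ]
    simp only [expSeq, lexTuple, Fin.cons_zero, Fin.cons_succ, ← ih]
    split_ifs
    · simp
    · simp [add_comm]

theorem lexTuple_bijective (n : ℕ) :
    Function.Bijective fun (i : Fin (2 ^ n)) => lexTuple n i := by
  rw [Fintype.bijective_iff_injective_and_card]
  exact ⟨fun i j h => (lexTuple_strictMono n).injective (congrArg toLex h), by simp⟩

/-- The matrices of brackets of isotopic diagrams agree up to an eighth root of unity. -/
theorem bracketMatrix_of_isotopic {T T' : TangleDiagram n} (h : Isotopic T.1 T'.1) :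
    ∃ z : ℂ, z ^ 8 = 1 ∧ bracketMatrix T = z • bracketMatrix T' := by
  obtain ⟨u, hu⟩ := h.exists_val_eq
  refine ⟨root8 ^ u, by rw [← pow_mul, mul_comm, pow_mul, root8_pow_eight, one_pow], ?_⟩
  ext k i
  rw [Matrix.smul_apply, bracketMatrix_apply, bracketMatrix_apply,
    hu _ (fun h => ⟨lexTuple n i h, rfl⟩), smul_eq_mul]
  ring

/-- The matrix of brackets of a filling. -/
theorem bracketMatrix_fill (T : TangleDiagram n) (B : Fin n → TangleDiagram 0)
    (h : (T.1.fill fun j => (B j).1).Planar) :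
    bracketMatrix ⟨T.1.fill fun j => (B j).1, h⟩ =
      bracketMatrix T * xi n fun j => bracketMatrix (B j) := by
  ext k l
  -- The second rows of the matrices of the fillings produce `i ^ t` with `t` the number of indices
  -- equal to `1`; the columns of the matrix of `T` carry `(-i) ^ t`.
  have hn : (-Complex.I) * Complex.I = 1 := by simp
  rw [Matrix.mul_apply, bracketMatrix_apply]
  change (-Complex.I) ^ 0 * _ * _ = _
  rw [val_fill_planar _ _ _ _ fun j => (B j).2, Finset.mul_sum,
    ← (Equiv.ofBijective _ (lexTuple_bijective n)).sum_comp]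
  refine Finset.sum_congr rfl fun i _ => ?_
  have hxi : xi n (fun j => bracketMatrix (B j)) i l = Complex.I ^ expSeq n i *
      ∏ j, val root8 0 (B j).1 (fun h => flat (lexTuple 0 l h)) (flat (lexTuple n i j)) := by
    change (∏ j, bracketMatrix (B j) (lexTuple n i j) 0) = _
    rw [expSeq_eq_sum, ← Finset.prod_pow_eq_pow_sum, ← Finset.prod_mul_distrib]
    refine Finset.prod_congr rfl fun j _ => ?_
    refine (bracketMatrix_apply (B j) _ _).trans ?_
    have hr : ∀ r r' : Fin 0 → Setoid (Fin (2 * 2)), r = r' := fun r r' => funext fun i => i.elim0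
    change (-Complex.I) ^ 0 * _ * _ = _
    rw [pow_zero, one_mul, hr (fun h => flat (lexTuple 0 l h))]
  rw [hxi, bracketMatrix_apply, pow_zero, one_mul]
  change _ * ((∏ j, val root8 0 (B j).1 (fun h => flat (lexTuple 0 l h)) (flat (lexTuple n i j))) *
    val root8 0 T.1 (fun h => flat (lexTuple n i h)) (flat k)) = _
  have : (-Complex.I) ^ expSeq n i * Complex.I ^ expSeq n i = 1 := by
    rw [← mul_pow, hn, one_pow]
  linear_combination (-(Complex.I ^ (k : ℕ) * ((∏ j, val root8 0 (B j).1
    (fun h => flat (lexTuple 0 l h)) (flat (lexTuple n i j))) *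
    val root8 0 T.1 (fun h => flat (lexTuple n i h)) (flat k)))) * this

end PBT

namespace PBT

open Diagram

variable {n : ℕ}

/-! ### Integrality -/

/-- With `N` crossings and `α` splittings of type A the weight is `A ^ (2α - N)`, and `A² = i`. -/
theorem weight_root8 {X : Type} [Finite X] (σ : X → Bool) :
    root8 ^ Nat.card X * weight root8 σ = Complex.I ^ Nat.card {x // σ x = true} := by
  have hX : Nat.card X = Nat.card {x // σ x = true} + Nat.card {x // σ x = false} := by
    rw [← Nat.card_congr (Equiv.sumCompl fun x => σ x = true), Nat.card_sum]
    simp only [Bool.not_eq_true]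
  rw [hX, weight, ← root8_sq, pow_two, pow_add, mul_mul_mul_comm, ← mul_pow, ← mul_pow,
    mul_inv_cancel₀ root8_ne_zero, one_pow, mul_one]

theorem exists_int_I_pow {e : ℕ} (h : (-1 : ℤˣ) ^ e = 1) :
    Complex.I ^ e ∈ (Int.castRingHom ℂ).range := by
  rw [neg_one_pow_eq_one_iff_even (by decide)] at h
  obtain ⟨m, rfl⟩ := h
  rw [← two_mul, pow_mul, Complex.I_sq]
  exact pow_mem (neg_mem (one_mem _)) m

/-- Multiplication by `A ^ N` turns each surviving weight into `i ^ α`. With the powers of `±i` in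
the matrix, the exponents of `i` have the same parity for all states and all entries by
`Planar.exists_sign`. One further factor `i ^ d` makes them even. -/
theorem exists_int_smul (T : TangleDiagram n) : ∃ M : Matrix (Fin 2) (Fin (2 ^ n)) ℤ, ∃ z : ℂ,
    z ^ 8 = 1 ∧ M.map (Int.cast : ℤ → ℂ) = z • bracketMatrix T := by
  classical
  have := T.1.finite_X
  let := Fintype.ofFinite T.1.X
  obtain ⟨c, hc⟩ := T.2.exists_sign
  obtain ⟨d, hd⟩ : ∃ d : ℕ, (-1 : ℤˣ) ^ d = c := by
    rcases Int.units_eq_one_or c with rfl | rfl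
    exacts [⟨0, rfl⟩, ⟨1, rfl⟩]
  have hI : Complex.I ^ 8 = 1 := by
    rw [show Complex.I ^ 8 = (Complex.I ^ 4) ^ 2 by ring, Complex.I_pow_four, one_pow]
  have key : ∀ k i, Complex.I ^ d * root8 ^ Nat.card T.1.X * bracketMatrix T k i ∈
      (Int.castRingHom ℂ).range := by
    intro k i
    rw [bracketMatrix_apply, val, finsum_eq_sum_of_fintype, Finset.mul_sum, Finset.mul_sum]
    refine sum_mem fun σ _ => ?_
    split_ifs with hp
    · by_cases h0 : T.1.closed σ (fun h => flat (lexTuple n i h)) = 0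
      · have h1 := hc σ _ k hp h0
        rw [← expSeq_eq_sum] at h1
        have h2 : (-1 : ℤˣ) ^ (d + (Nat.card {x // σ x = true} + (expSeq n i + k))) = 1 := by
          rw [pow_add, h1, hd, Int.units_mul_self]
        rw [h0, pow_zero, mul_one, mul_one]
        have h3 : Complex.I ^ d * root8 ^ Nat.card T.1.X *
            ((-Complex.I) ^ expSeq n i * Complex.I ^ (k : ℕ) * weight root8 σ) =
            (-1) ^ expSeq n i *
              Complex.I ^ (d + (Nat.card {x // σ x = true} + (expSeq n i + k))) := by
          rw [pow_add, pow_add, pow_add, ← weight_root8, neg_pow]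
          ring
        rw [h3]
        exact mul_mem (pow_mem (neg_mem (one_mem _)) _) (exists_int_I_pow h2)
      · rw [zero_pow h0]
        simp
    · simp
  choose M hM using key
  refine ⟨Matrix.of M, Complex.I ^ d * root8 ^ Nat.card T.1.X, ?_, ?_⟩
  · rw [mul_pow, pow_right_comm, hI, pow_right_comm, root8_pow_eight, one_pow, one_pow, one_mul]
  · ext k i
    exact hM k i

/-! ### The invariant -/

/-- The invariant of an `n`-punctured ball tangle diagram. -/
noncomputable def invariant (T : TangleDiagram n) : PM 2 (2 ^ n) ℤ :=
  PM.mk (exists_int_smul T).choose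

/-- At a nonzero entry of `X` the two integers have equal eighth powers, hence agree up to sign.
This forces `z = ± w`, and the same sign then holds for all entries. -/
theorem eq_or_eq_neg_of_smul_eq {a b : ℕ} {X : Matrix (Fin a) (Fin b) ℂ}
    {M N : Matrix (Fin a) (Fin b) ℤ} {z w : ℂ} (hz : z ^ 8 = 1) (hw : w ^ 8 = 1)
    (hM : M.map (Int.cast : ℤ → ℂ) = z • X) (hN : N.map (Int.cast : ℤ → ℂ) = w • X) :
    M = N ∨ M = -N := by
  have hinj : Function.Injective fun M : Matrix (Fin a) (Fin b) ℤ => M.map (Int.cast : ℤ → ℂ) :=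
    Matrix.map_injective Int.cast_injective
  by_cases h0 : ∀ i j, X i j = 0
  · left
    apply hinj
    have : X = 0 := Matrix.ext h0
    change M.map _ = N.map _
    rw [hM, hN, this, smul_zero, smul_zero]
  push Not at h0
  obtain ⟨i, j, hij⟩ := h0
  have h1 : ((M i j : ℤ) : ℂ) = z * X i j := congrFun (congrFun hM i) j
  have h2 : ((N i j : ℤ) : ℂ) = w * X i j := congrFun (congrFun hN i) j
  have h3 : M i j ^ 8 = N i j ^ 8 := by
    have : ((M i j : ℤ) : ℂ) ^ 8 = ((N i j : ℤ) : ℂ) ^ 8 := by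
      rw [h1, h2, mul_pow, mul_pow, hz, hw]
    exact_mod_cast this
  have h4 : M i j = N i j ∨ M i j = -N i j := by
    rw [← abs_eq_abs]
    have := congrArg abs h3
    rw [abs_pow, abs_pow] at this
    exact (pow_left_inj₀ (abs_nonneg _) (abs_nonneg _) (by decide)).1 this
  have h5 : z = w ∨ z = -w := by
    rcases h4 with h4 | h4 <;> rw [h4] at h1
    · exact .inl (mul_right_cancel₀ hij (h1.symm.trans h2))
    · right
      rw [Int.cast_neg, h2, ← neg_mul] at h1
      exact (mul_right_cancel₀ hij h1).symm
  rcases h5 with rfl | rfl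
  · exact .inl (hinj (hM.trans hN.symm))
  · right
    apply hinj
    change M.map _ = (-N).map _
    rw [hM, neg_smul, ← hN]
    ext
    simp

theorem PM.mk_eq_iff {a b : ℕ} {R : Type} [CommRing R] {M N : Matrix (Fin a) (Fin b) R} :
    PM.mk M = PM.mk N ↔ M = N ∨ M = -N :=
  ⟨fun h => Quotient.exact h, fun h => Quotient.sound h⟩

/-- By uniqueness up to sign the class does not depend on the chosen integral multiple. -/
theorem invariant_eq_mk_iff (T : TangleDiagram n) (M : Matrix (Fin 2) (Fin (2 ^ n)) ℤ) :
    invariant T = PM.mk M ↔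
      ∃ z : ℂ, z ^ 8 = 1 ∧ M.map (Int.cast : ℤ → ℂ) = z • bracketMatrix T := by
  obtain ⟨w, hw, hN⟩ := (exists_int_smul T).choose_spec
  rw [invariant, PM.mk_eq_iff]
  constructor
  · rintro (h | h)
    · exact ⟨w, hw, h ▸ hN⟩
    · refine ⟨-w, by rw [Even.neg_pow (by decide), hw], ?_⟩
      rw [neg_smul, ← hN, h]
      ext
      simp
  · rintro ⟨z, hz, hM⟩
    exact eq_or_eq_neg_of_smul_eq hw hz hN hM

theorem invariant_eq_of_isotopic {T T' : TangleDiagram n} (h : Isotopic T.1 T'.1) :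
    invariant T = invariant T' := by
  obtain ⟨u, hu, hT⟩ := bracketMatrix_of_isotopic h
  obtain ⟨w, hw, hN⟩ := (exists_int_smul T).choose_spec
  refine ((invariant_eq_mk_iff T' _).2 ⟨w * u, by rw [mul_pow, hw, hu, one_mul], ?_⟩).symm
  rw [hN, hT, smul_smul]

/-- The scalars normalizing `T` and the fillings multiply to an eighth root of unity, and `ξⁿ` is
multilinear; so the product of the integral representatives is an integral multiple of the matrix of
the filling. -/
theorem invariant_fill (T : TangleDiagram n) (B : Fin n → TangleDiagram 0)
    (h : (T.1.fill fun j => (B j).1).Planar) :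
    invariant ⟨T.1.fill fun j => (B j).1, h⟩ =
      PM.mul (invariant T) (xiClass n fun j => invariant (B j)) := by
  obtain ⟨w, hw, hM⟩ := (exists_int_smul T).choose_spec
  choose z hz hN using fun j => (exists_int_smul (B j)).choose_spec
  set M := (exists_int_smul T).choose with hMdef
  set N := fun j => (exists_int_smul (B j)).choose with hNdef
  have hx : PM.mul (invariant T) (xiClass n fun j => invariant (B j)) =
      PM.mk (M * xi n N) :=
    congrArg (PM.mul (PM.mk M)) (xiClass_mk n N)
  rw [hx, invariant_eq_mk_iff]
  refine ⟨w * ∏ j, z j, ?_, ?_⟩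
  · rw [mul_pow, hw, ← Finset.prod_pow, Finset.prod_congr rfl fun j _ => hz j,
      Finset.prod_const_one, one_mul]
  · have hxi : (xi n N).map (Int.cast : ℤ → ℂ) =
        (∏ j, z j) • xi n fun j => bracketMatrix (B j) := by
      ext i l
      rw [Matrix.smul_apply, Matrix.map_apply]
      change ((∏ j, N j (lexTuple n i j) 0 : ℤ) : ℂ) =
        (∏ j, z j) * ∏ j, bracketMatrix (B j) (lexTuple n i j) 0
      rw [Int.cast_prod, ← Finset.prod_mul_distrib]
      exact Finset.prod_congr rfl fun j _ => congrFun (congrFun (hN j) _) _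
    rw [bracketMatrix_fill, mul_smul, ← Matrix.mul_smul, ← hxi, ← Matrix.smul_mul, ← hM]
    exact Matrix.map_mul (f := Int.castRingHom ℂ)

end PBT

theorem theorem3p6 :
    ∃ F : (n : ℕ) → PBT.TangleDiagram n → PBT.PM 2 (2 ^ n) ℤ,
      (∀ (n : ℕ) (T : PBT.TangleDiagram n) (M : Matrix (Fin 2) (Fin (2 ^ n)) ℤ),
        F n T = PBT.PM.mk M ↔
          ∃ z : ℂ, z ^ 8 = 1 ∧ M.map (Int.cast : ℤ → ℂ) = z • PBT.bracketMatrix T) ∧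
      (∀ (n : ℕ) (T T' : PBT.TangleDiagram n),
        PBT.Diagram.Isotopic T.1 T'.1 → F n T = F n T') ∧
      (∀ (n : ℕ) (T : PBT.TangleDiagram n) (B : Fin n → PBT.TangleDiagram 0),
        ∃ h : (T.1.fill fun j => (B j).1).Planar,
          F 0 ⟨T.1.fill fun j => (B j).1, h⟩ =
            PBT.PM.mul (F n T) (PBT.xiClass n fun j => F 0 (B j))) :=
  ⟨fun _ => PBT.invariant, fun _ => PBT.invariant_eq_mk_iff,
    fun _ _ _ => PBT.invariant_eq_of_isotopic,
    fun _ T B => ⟨T.2.fill _ fun j => (B j).2, PBT.invariant_fill T B _⟩⟩
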